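/- Let $\mathbb T=\mathbb R/2\pi\mathbb Z$. Let $\Omega\subset\mathbb R^3$ be a toroidal domain (its closure is diffeomorphic to a closed solid torus) with real analytic boundary, and let $B$ be a Beltrami field on $\Omega$: $\operatorname{curl}B=\lambda B$ in $\Omega$ for some constant $\lambda\neq0$ and $B\cdot N=0$ on $\partial\Omega$, with $B$ of class $C^1$ up to the boundary. Let $\varphi=(\varphi_1,\varphi_2):\partial\Omega\to\mathbb T^2$ be global analytic coordinates on $\partial\Omega$ in which $$Y:=B|_{\partial\Omega}=\omega_1\,\partial_{\varphi_1}+\omega_2\,\partial_{\varphi_2},$$ where $\omega\in\mathbb R^2$ is Diophantine, i.e. there are $\gamma>0$ and $\tau>1$ with $|k\cdot\omega|\ge\gamma|k|^{-\tau}$ for all $k\in\mathbb Z^2\setminus\{0\}$. Norms $|\cdot|$ of tangent fields, the gradient $\nabla$ on $\partial\Omega$ and the dual $1$-form $X^\flat$ are taken with respect to the metric induced from $\mathbb R^3$, and $G(\varphi)$ is the matrix of this metric in the coordinates $\varphi$. Assume that $B$ is nondegenerate of type I: if $w:=\omega/\big(\frac1{4\pi^2}\int_{\mathbb T^2}|Y|^2d\varphi\big)^{1/2}$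 is the frequency vector of the rescaled field $\widehat Y=w_1\partial_{\varphi_1}+w_2\partial_{\varphi_2}$, whose square has mean $1$, and $\mathcal R$ is the zero-mean solution on $\mathbb T^2$ of $w_1\partial_{\varphi_1}\mathcal R+w_2\partial_{\varphi_2}\mathcal R=1-|\widehat Y|^2$, then the matrix $$\int_{\mathbb T^2}G(\varphi)^{-1}\begin{pmatrix}1-w_1\partial_{\varphi_1}\mathcal R&-w_2\partial_{\varphi_1}\mathcal R\\-w_1\partial_{\varphi_2}\mathcal R&1-w_2\partial_{\varphi_2}\mathcal R\end{pmatrix}d\varphi$$ is invertible. Then there is $\varepsilon>0$ such that for every $c\in\mathbb R$ with $|c|<\varepsilon$ there are real constants $b,a_1,a_2$, a real analytic function $H$ on $\partial\Omega$ and an analytic tangent vector field $X$ on $\partial\Omega$ of the form $$X=(1+c)^{1/2}Y+\nabla H+a_1\nabla\varphi_1+a_2\nabla\varphi_2$$ (so that $X^\flat$ is closed), all depending on $c$, such that: 1. $|X|^2=(1+b)|Y|^2+c$ on $\partial\Omega$. 2. $X$ is analytically conjugate to the linear field on $\mathbb T^2$ with frequency vector $(1+c)^{1/2}\omega$, which is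 Diophantine. 3. For each integer $r\ge0$ there is a constant $C$ independent of $c$ such that $\|H\|_{C^r(\partial\Omega)}+|b|+|a_1|+|a_2|\le C|c|$ for all $|c|<\varepsilon$. Moreover, for each integer $r\ge0$, $X$ depends continuously on $c\in(-\varepsilon,\varepsilon)$ in the $C^r$ topology of vector fields. -/

import Mathlib

open scoped Topology Matrix ENNReal

noncomputable section

namespace Beltrami

/-- Euclidean three-space. -/
abbrev E3 : Type := EuclideanSpace ℝ (Fin 3)

/-- The universal cover of the torus `𝕋² = (ℝ / 2πℤ)²`. Functions and vector fields on `𝕋²` are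
functions on the plane that are `2π`-periodic in each variable. -/
abbrev Plane : Type := Fin 2 → ℝ

/-! ### Domains in space -/

/-- The standard open solid torus of revolution with radii `2` and `1`. -/
def solidTorus : Set E3 :=
  {x | (Real.sqrt (x 0 ^ 2 + x 1 ^ 2) - 2) ^ 2 + x 2 ^ 2 < 1}

/-- A toroidal domain: its closure is diffeomorphic to the closed solid torus. The diffeomorphism
is required to be smooth up to the boundary, that is, to be the restriction of a smooth
diffeomorphism between neighbourhoods. The domain may be knotted. -/
def IsToroidalDomain (Ω : Set E3) : Prop :=
  ∃ (U : Set E3) (Ψ : E3 → E3), IsOpen U ∧ closure solidTorus ⊆ U ∧ ContDiffOn ℝ (⊤ : ℕ∞) Ψ U ∧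
    Set.InjOn Ψ U ∧ (∀ x ∈ U, Function.Bijective (fderiv ℝ Ψ x)) ∧ Ψ '' solidTorus = Ω

/-- `f` is a defining function of `Ω` near its boundary point `p`: the differential of `f` at `p`
is not zero, and close to `p` the domain is `{f < 0}`. The gradient of `f` at `p` is
then a positive multiple of the outer normal. -/
def IsDefiningFunctionAt (Ω : Set E3) (p : E3) (f : E3 → ℝ) : Prop :=
  ContDiffAt ℝ 1 f p ∧ f p = 0 ∧ fderiv ℝ f p ≠ 0 ∧ ∀ᶠ x in 𝓝 p, (x ∈ Ω ↔ f x < 0)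

/-- The boundary of `Ω` is a real analytic surface, with `Ω` on one side of it. -/
def HasAnalyticBoundary (Ω : Set E3) : Prop :=
  ∀ p ∈ frontier Ω, ∃ f : E3 → ℝ, IsDefiningFunctionAt Ω p f ∧ AnalyticAt ℝ f p

/-- `spacePartial B x i j` is `∂ᵢ Bⱼ` at the point `x`. -/
def spacePartial (B : E3 → E3) (x : E3) (i j : Fin 3) : ℝ :=
  (fderiv ℝ B x (EuclideanSpace.single i 1)) j

/-- The curl of a vector field in space. -/
def curl (B : E3 → E3) (x : E3) : E3 :=
  !₂[spacePartial B x 1 2 - spacePartial B x 2 1,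
     spacePartial B x 2 0 - spacePartial B x 0 2,
     spacePartial B x 0 1 - spacePartial B x 1 0]

/-- A Beltrami field on `Ω`: `curl B = lam B` in `Ω` for a nonzero constant `lam`, and `B · N = 0`
on the boundary. The field is a classical solution, of class `C¹` up to the boundary. -/
def IsBeltramiField (Ω : Set E3) (B : E3 → E3) : Prop :=
  ContDiffOn ℝ 1 B (closure Ω) ∧
  (∃ lam : ℝ, lam ≠ 0 ∧ ∀ x ∈ Ω, curl B x = lam • B x) ∧
  (∀ p ∈ frontier Ω, ∀ f : E3 → ℝ, IsDefiningFunctionAt Ω p f → fderiv ℝ f p (B p) = 0)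

/-! ### Functions on the torus -/

/-- The vector `2πk`. -/
def latticeVec (k : Fin 2 → ℤ) : Plane := fun i => 2 * Real.pi * (k i : ℝ)

/-- The function descends to `𝕋²`. -/
def IsPeriodic {α : Type} (f : Plane → α) : Prop :=
  ∀ (x : Plane) (k : Fin 2 → ℤ), f (x + latticeVec k) = f x

/-- The partial derivatives `(∂₁ f, ∂₂ f)`. -/
def partials (f : Plane → ℝ) (x : Plane) : Fin 2 → ℝ :=
  fun i => fderiv ℝ f x (Pi.single i 1)

/-- The integral over `𝕋²`. -/
def torusIntegral (f : Plane → ℝ) : ℝ :=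
  ∫ x in Set.Icc (0 : Plane) (fun _ => 2 * Real.pi), f x

/-- The average over `𝕋²`. -/
def torusMean (f : Plane → ℝ) : ℝ := (4 * Real.pi ^ 2)⁻¹ * torusIntegral f

/-- The `C^r` norm (possibly infinite): the supremum of all derivatives of order at most `r`. -/
def crNorm {F : Type} [NormedAddCommGroup F] [NormedSpace ℝ F] (r : ℕ) (f : Plane → F) : ℝ≥0∞ :=
  ⨆ (j : ℕ) (_ : j ≤ r) (x : Plane), ‖iteratedFDeriv ℝ j f x‖ₑ

/-- Diophantine vectors of the plane. -/
def IsDiophantine (ω : Fin 2 → ℝ) : Prop :=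
  ∃ γ τ : ℝ, 0 < γ ∧ 1 < τ ∧ ∀ k : Fin 2 → ℤ, k ≠ 0 →
    γ * Real.sqrt ((k 0 : ℝ) ^ 2 + (k 1 : ℝ) ^ 2) ^ (-τ) ≤ |∑ i, (k i : ℝ) * ω i|

/-- Lift to the plane of a real analytic diffeomorphism of `𝕋²`. -/
def IsAnalyticTorusDiffeo (Φ : Plane → Plane) : Prop :=
  AnalyticOnNhd ℝ Φ Set.univ ∧ Function.Bijective Φ ∧
  (∀ x, Function.Bijective (fderiv ℝ Φ x)) ∧
  ∃ A : Matrix (Fin 2) (Fin 2) ℤ, IsUnit A.det ∧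
    ∀ (x : Plane) (k : Fin 2 → ℤ), Φ (x + latticeVec k) = Φ x + latticeVec (A *ᵥ k)

/-- The vector field `X` on `𝕋²` is analytically conjugate to the constant field `ω'`: there is an
analytic diffeomorphism `Φ` of `𝕋²` with `Φ^* X = ω'`. -/
def IsAnalyticallyConjugateToLinear (X : Plane → Fin 2 → ℝ) (ω' : Fin 2 → ℝ) : Prop :=
  ∃ Φ : Plane → Plane, IsAnalyticTorusDiffeo Φ ∧ ∀ x, fderiv ℝ Φ x ω' = X (Φ x)

/-! ### Toroidal surfaces in analytic coordinates -/

/-- `K` is the inverse of a system of global real analytic coordinates `φ : S → 𝕋²` on the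
surface `S`: it is a periodic analytic immersion, it is injective modulo periods, and its image
is `S`. -/
def IsAnalyticCoordinates (S : Set E3) (K : Plane → E3) : Prop :=
  AnalyticOnNhd ℝ K Set.univ ∧ IsPeriodic K ∧
  (∀ x y, K x = K y → ∃ k : Fin 2 → ℤ, y = x + latticeVec k) ∧
  (∀ x, Function.Injective (fderiv ℝ K x)) ∧ Set.range K = S

/-- The matrix `G = DKᵀ DK` of the induced metric in the coordinates. -/
def metricMatrix (K : Plane → E3) (x : Plane) : Matrix (Fin 2) (Fin 2) ℝ :=
  Matrix.of fun i j =>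
    inner ℝ (fderiv ℝ K x (Pi.single i 1)) (fderiv ℝ K x (Pi.single j 1))

/-- The gradient on the surface with the induced metric, in the coordinates: `∇f = G⁻¹ ∂f`. -/
def surfGrad (K : Plane → E3) (f : Plane → ℝ) (x : Plane) : Fin 2 → ℝ :=
  (metricMatrix K x)⁻¹ *ᵥ partials f x

/-- The components `G Z` of the `1`-form dual to the vector field `Z` with the induced metric. -/
def flat (K : Plane → E3) (Z : Plane → Fin 2 → ℝ) (x : Plane) : Fin 2 → ℝ :=
  metricMatrix K x *ᵥ Z x

/-- The squared length `Z · G Z` of the vector field `Z` with the induced metric. -/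
def normSqField (K : Plane → E3) (Z : Plane → Fin 2 → ℝ) (x : Plane) : ℝ :=
  Z x ⬝ᵥ flat K Z x

/-- The `1`-form `θ₁ dφ₁ + θ₂ dφ₂` is closed. -/
def IsClosedForm (θ : Plane → Fin 2 → ℝ) : Prop :=
  ∀ x, partials (fun y => θ y 1) x 0 = partials (fun y => θ y 0) x 1

/-- The matrix `∫ G⁻¹ (δᵢⱼ - ωⱼ ∂ᵢR) dφ`. -/
def typeIMatrix (K : Plane → E3) (ω : Fin 2 → ℝ) (R : Plane → ℝ) :
    Matrix (Fin 2) (Fin 2) ℝ :=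
  Matrix.of fun i j => torusIntegral fun x =>
    ((metricMatrix K x)⁻¹ *
      (1 - Matrix.of fun i' j' => ω j' * partials R x i')) i j

/-- The frequency vector after the field is rescaled so that its square has mean `1`. -/
def normalizedFreq (K : Plane → E3) (ω : Fin 2 → ℝ) : Fin 2 → ℝ :=
  (Real.sqrt (torusMean (normSqField K fun _ => ω)))⁻¹ • ω

/-- Nondegeneracy of type I of the field that is the constant `ω` in the coordinates. With `w`
the rescaled frequency vector, `R` is the zero mean solution of `w₁ ∂₁R + w₂ ∂₂R = 1 - |w|²`, where
`|w|` is the length for the induced metric, and the matrix built from `w` and `R` is invertible. -/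
def IsNondegenerateTypeI (K : Plane → E3) (ω : Fin 2 → ℝ) : Prop :=
  ∃ R : Plane → ℝ, ContDiff ℝ (⊤ : ℕ∞) R ∧ IsPeriodic R ∧ torusMean R = 0 ∧
    (∀ x, normalizedFreq K ω ⬝ᵥ partials R x =
      1 - normSqField K (fun _ => normalizedFreq K ω) x) ∧
    (typeIMatrix K (normalizedFreq K ω) R).det ≠ 0

/-- The vector field `(1 + c)^{1/2} Y + ∇H + a₁ ∇φ₁ + a₂ ∇φ₂`, where `Y` is the constant `ω` in the
coordinates `φ`. -/
def perturbedField (K : Plane → E3) (ω : Fin 2 → ℝ) (c : ℝ) (H : Plane → ℝ) (a : Fin 2 → ℝ)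
    (x : Plane) : Fin 2 → ℝ :=
  Real.sqrt (1 + c) • ω + surfGrad K H x + ∑ i, a i • surfGrad K (fun y => y i) x

end Beltrami

end

open Beltrami

open scoped Topology Matrix ENNReal Pointwise

noncomputable section

namespace Beltrami

/-! The field is sought as `X = √(1+c) Z`, where `Z = ω + G⁻¹(∂H + α)` has a closed dual form, is
conjugate to `ω`, and satisfies `|Z|² = (1 + β sin s)|Y|² + e(s)` for a parameter `s`. Such a `Z` is
an invariant Lagrangian torus of frequency `ω`, the graph of a closed form, for the Hamiltonian
`½|p|² - ½(1 + β sin s)|Y|²`. At `s = 0` the field `Y` is one: its dual form is closed because the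
normal component of `curl B = λB` vanishes on the boundary (`isClosedForm_flat_of_beltrami`).

The tori for the other `s` come from a Newton (KAM) scheme that keeps the frequency fixed. The
unknowns are a reparametrization of the torus and a correction `dH + a` of the form. Linearizing the
energy and frequency equations gives two equations `ω · ∂g = u - mean u`, solved with loss of domain
by the Diophantine condition (`Wiener.exists_cohomological`). The constant `a` makes the second one
solvable. This needs only that the mean of `G⁻¹` be invertible, which holds by positivity. The new
errors are quadratic (`ApproxTorus.Solves.step`, `ApproxTorus.Solves.exists_newton_step`), and the
iteration converges to `exists_invariant_tori`, rewritten on the surface in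
`exists_invariant_fields`. The parameter enters through `sin s`, so `s` is one more angle in all
Fourier norms, and joint analyticity in `(θ, s)` costs nothing.

With the frequency fixed, the energy `e(s)` is an output that cannot be prescribed. Nondegeneracy of
type I says precisely what is needed to get `e'(0) ≠ 0` (`deriv_energy_ne_zero`): if `e'(0) = 0`,
the first order change of `α` lies in the kernel of the type I matrix, hence vanishes, but its
product with `ω` is `β/2` times the mean of `|Y|²`. So `e` can be inverted near `0`, and `σ` with
`e(σ(c)) = c/(1+c)` exists (`exists_reparametrization`). Multiplying `Z` at `s = σ(c)` by `√(1+c)`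
turns the constant into `c` and the frequency into `√(1+c) ω`. The estimates in `c` follow from
smoothness of the family in its parameters. -/

/-! ### Fourier series with exponential weights. -/

/-- Frequencies of the characters in the angles and in the parameter. -/
abbrev Freq : Type := (Fin 2 → ℤ) × ℤ

/-- The length of a frequency. -/
def wt (j : Freq) : ℝ := |(j.1 0 : ℝ)| + |(j.1 1 : ℝ)| + |(j.2 : ℝ)|

/-- The phase of the character with frequency `j`. -/
def phase (j : Freq) (s : ℝ) (θ : Plane) : ℝ := j.1 0 * θ 0 + j.1 1 * θ 1 + j.2 * s

/-- The character with frequency `j`. -/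
def chi (j : Freq) (s : ℝ) (θ : Plane) : ℂ := Complex.exp ((phase j s θ : ℝ) * Complex.I)

lemma wt_nonneg (j : Freq) : 0 ≤ wt j := by unfold wt; positivity

lemma wt_add_le (j l : Freq) : wt (j + l) ≤ wt j + wt l := by
  simp only [wt, Prod.fst_add, Prod.snd_add, Pi.add_apply, Int.cast_add]
  have h0 := abs_add_le (j.1 0 : ℝ) (l.1 0)
  have h1 := abs_add_le (j.1 1 : ℝ) (l.1 1)
  have h2 := abs_add_le (j.2 : ℝ) (l.2)
  linarith

lemma wt_neg (j : Freq) : wt (-j) = wt j := by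
  simp [wt]

lemma abs_fst_le_wt (j : Freq) (i : Fin 2) : |(j.1 i : ℝ)| ≤ wt j := by
  have h0 := abs_nonneg (j.1 0 : ℝ)
  have h1 := abs_nonneg (j.1 1 : ℝ)
  have h2 := abs_nonneg (j.2 : ℝ)
  fin_cases i <;> simp [wt] <;> linarith

lemma norm_chi (j : Freq) (s : ℝ) (θ : Plane) : ‖chi j s θ‖ = 1 := by
  simp [chi, Complex.norm_exp_ofReal_mul_I]

lemma chi_add (j l : Freq) (s : ℝ) (θ : Plane) : chi (j + l) s θ = chi j s θ * chi l s θ := by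
  simp only [chi, ← Complex.exp_add, phase]
  congr 1
  push_cast [Prod.fst_add, Prod.snd_add, Pi.add_apply]
  ring

lemma chi_neg (j : Freq) (s : ℝ) (θ : Plane) :
    chi (-j) s θ = (starRingEnd ℂ) (chi j s θ) := by
  simp only [chi, ← Complex.exp_conj, map_mul, Complex.conj_ofReal, Complex.conj_I, phase]
  congr 1
  push_cast [Prod.fst_neg, Prod.snd_neg, Pi.neg_apply]
  ring

/-- The function is an absolutely convergent combination of characters, and the `ℓ¹` norm of the
coefficients with exponential weights of rate `ρ` is at most `M`. -/
def Wiener (ρ M : ℝ) (u : ℝ → Plane → ℂ) : Prop :=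
  ∃ (T : Type) (_ : Countable T) (c : T → ℂ) (j : T → Freq) (B : ℝ),
    HasSum (fun t => ‖c t‖ * Real.exp (ρ * wt (j t))) B ∧ B ≤ M ∧
    ∀ s θ, HasSum (fun t => c t * chi (j t) s θ) (u s θ)

/-- Real valued functions with a weighted bound on their Fourier coefficients. -/
def RWiener (ρ M : ℝ) (u : ℝ → Plane → ℝ) : Prop := Wiener ρ M fun s θ => (u s θ : ℂ)

lemma le_mul_exp_wt {ρ : ℝ} (hρ : 0 ≤ ρ) (a : ℝ) (ha : 0 ≤ a) (j : Freq) :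
    a ≤ a * Real.exp (ρ * wt j) :=
  le_mul_of_one_le_right ha (Real.one_le_exp (mul_nonneg hρ (wt_nonneg j)))

lemma Wiener.mono {ρ ρ' M M' : ℝ} {u : ℝ → Plane → ℂ} (h : Wiener ρ M u) (hρ : ρ' ≤ ρ)
    (hM : M ≤ M') : Wiener ρ' M' u := by
  obtain ⟨T, hT, c, j, B, hB, hBM, hu⟩ := h
  have hle : ∀ t, ‖c t‖ * Real.exp (ρ' * wt (j t)) ≤ ‖c t‖ * Real.exp (ρ * wt (j t)) := fun t => by
    have := wt_nonneg (j t)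
    gcongr
  have hs : Summable fun t => ‖c t‖ * Real.exp (ρ' * wt (j t)) :=
    Summable.of_nonneg_of_le (fun t => by positivity) hle hB.summable
  exact ⟨T, hT, c, j, _, hs.hasSum, (hasSum_le hle hs.hasSum hB).trans (hBM.trans hM), hu⟩

lemma Wiener.nonneg {ρ M : ℝ} {u : ℝ → Plane → ℂ} (h : Wiener ρ M u) : 0 ≤ M := by
  obtain ⟨T, hT, c, j, B, hB, hBM, hu⟩ := h
  exact (hB.nonneg fun t => by positivity).trans hBM

lemma Wiener.norm_le {ρ M : ℝ} {u : ℝ → Plane → ℂ} (h : Wiener ρ M u) (hρ : 0 ≤ ρ) (s : ℝ)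
    (θ : Plane) : ‖u s θ‖ ≤ M := by
  obtain ⟨T, hT, c, j, B, hB, hBM, hu⟩ := h
  refine le_trans ?_ hBM
  rw [← (hu s θ).tsum_eq]
  refine tsum_of_norm_bounded hB fun t => ?_
  rw [norm_mul, norm_chi, mul_one]
  exact le_mul_exp_wt hρ _ (norm_nonneg _) _

/-- A representation may repeat frequencies, so the representations of the summands are just
concatenated over a sigma type. No coefficients are ever collected or convolved. Sums, products,
power series and compositions all reduce to this lemma. -/
lemma Wiener.tsum {ι : Type} [Countable ι] {ρ M M₀ : ℝ} {u : ι → ℝ → Plane → ℂ} {m : ι → ℝ}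
    {v : ℝ → Plane → ℂ} (hρ : 0 ≤ ρ) (hu : ∀ i, Wiener ρ (m i) (u i)) (hm : HasSum m M₀)
    (hM : M₀ ≤ M) (hv : ∀ s θ, HasSum (fun i => u i s θ) (v s θ)) : Wiener ρ M v := by
  choose T hT c j B hB hBm hrep using hu
  have hBs : Summable B := Summable.of_nonneg_of_le
    (fun i => (hB i).nonneg fun t => by positivity) hBm hm.summable
  have hsum : Summable fun p : (Σ i, T i) => ‖c p.1 p.2‖ * Real.exp (ρ * wt (j p.1 p.2)) := by
    refine (summable_sigma_of_nonneg fun p => by positivity).2 ⟨fun i => (hB i).summable, ?_⟩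
    exact hBs.congr fun i => (hB i).tsum_eq.symm
  have htot := hsum.hasSum.sigma hB
  refine ⟨Σ i, T i, inferInstance, fun p => c p.1 p.2, fun p => j p.1 p.2, _, hsum.hasSum,
    (hasSum_le hBm htot hm).trans hM, fun s θ => ?_⟩
  have hsC : Summable fun p : (Σ i, T i) => c p.1 p.2 * chi (j p.1 p.2) s θ := by
    refine Summable.of_norm_bounded hsum fun p => ?_
    rw [norm_mul, norm_chi, mul_one]
    exact le_mul_exp_wt hρ _ (norm_nonneg _) _
  have h2 := hsC.hasSum.sigma fun i => hrep i s θ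
  rw [(hv s θ).unique h2]
  exact hsC.hasSum

lemma Wiener.char (ρ : ℝ) (a : ℂ) (l : Freq) :
    Wiener ρ (‖a‖ * Real.exp (ρ * wt l)) fun s θ => a * chi l s θ :=
  ⟨Unit, inferInstance, fun _ => a, fun _ => l, _, hasSum_unique _, le_rfl,
    fun _ _ => hasSum_unique (fun _ : Unit => a * chi l _ _)⟩

lemma wt_zero : wt 0 = 0 := by simp [wt]

lemma chi_zero (s : ℝ) (θ : Plane) : chi 0 s θ = 1 := by simp [chi, phase]

lemma Wiener.const (ρ : ℝ) (a : ℂ) : Wiener ρ ‖a‖ fun _ _ => a := by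
  simpa [wt_zero, chi_zero] using Wiener.char ρ a 0

lemma Wiener.char_mul {ρ M : ℝ} {u : ℝ → Plane → ℂ} (h : Wiener ρ M u) (hρ : 0 ≤ ρ) (a : ℂ)
    (l : Freq) : Wiener ρ (‖a‖ * Real.exp (ρ * wt l) * M) fun s θ => a * chi l s θ * u s θ := by
  obtain ⟨T, hT, c, j, B, hB, hBM, hu⟩ := h
  have hle : ∀ t, ‖a * c t‖ * Real.exp (ρ * wt (l + j t)) ≤
      ‖a‖ * Real.exp (ρ * wt l) * (‖c t‖ * Real.exp (ρ * wt (j t))) := fun t => by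
    have h1 : Real.exp (ρ * wt (l + j t)) ≤ Real.exp (ρ * wt l) * Real.exp (ρ * wt (j t)) := by
      rw [← Real.exp_add, ← mul_add]
      exact Real.exp_le_exp.2 (mul_le_mul_of_nonneg_left (wt_add_le _ _) hρ)
    rw [norm_mul]
    calc _ ≤ ‖a‖ * ‖c t‖ * (Real.exp (ρ * wt l) * Real.exp (ρ * wt (j t))) := by gcongr
      _ = _ := by ring
  have hB' := hB.mul_left (‖a‖ * Real.exp (ρ * wt l))
  have hs : Summable fun t => ‖a * c t‖ * Real.exp (ρ * wt (l + j t)) :=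
    Summable.of_nonneg_of_le (fun t => by positivity) hle hB'.summable
  refine ⟨T, hT, fun t => a * c t, fun t => l + j t, _, hs.hasSum,
    (hasSum_le hle hs.hasSum hB').trans (by gcongr), fun s θ => ?_⟩
  have := (hu s θ).mul_left (a * chi l s θ)
  refine this.congr_fun fun t => ?_
  rw [chi_add]; ring

/-- Only the first factor is expanded: multiplication by a single character shifts frequencies, and
the weight is submultiplicative because `wt` is subadditive. -/
lemma Wiener.mul {ρ M M' : ℝ} {u v : ℝ → Plane → ℂ} (hu : Wiener ρ M u) (hv : Wiener ρ M' v)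
    (hρ : 0 ≤ ρ) : Wiener ρ (M * M') fun s θ => u s θ * v s θ := by
  have hM' := hv.nonneg
  obtain ⟨T, hT, c, j, B, hB, hBM, hu⟩ := hu
  exact Wiener.tsum hρ (fun t => hv.char_mul hρ (c t) (j t)) (hB.mul_right M') (by gcongr)
    fun s θ => (hu s θ).mul_right _

lemma Wiener.const_mul {ρ M : ℝ} {u : ℝ → Plane → ℂ} (h : Wiener ρ M u) (hρ : 0 ≤ ρ) (a : ℂ) :
    Wiener ρ (‖a‖ * M) fun s θ => a * u s θ := (Wiener.const ρ a).mul h hρ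

lemma Wiener.add {ρ M M' : ℝ} {u v : ℝ → Plane → ℂ} (hu : Wiener ρ M u) (hv : Wiener ρ M' v)
    (hρ : 0 ≤ ρ) : Wiener ρ (M + M') fun s θ => u s θ + v s θ := by
  refine Wiener.tsum (ι := Bool) (u := fun b => if b then u else v)
    (m := fun b => if b then M else M') hρ (fun b => by cases b <;> simpa) (hasSum_fintype _)
    (by simp) fun s θ => ?_
  convert hasSum_fintype (fun b : Bool => (if b then u else v) s θ) using 1
  simp

lemma Wiener.neg {ρ M : ℝ} {u : ℝ → Plane → ℂ} (h : Wiener ρ M u) (hρ : 0 ≤ ρ) :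
    Wiener ρ M fun s θ => -u s θ := by
  simpa using h.const_mul hρ (-1)

lemma Wiener.sub {ρ M M' : ℝ} {u v : ℝ → Plane → ℂ} (hu : Wiener ρ M u) (hv : Wiener ρ M' v)
    (hρ : 0 ≤ ρ) : Wiener ρ (M + M') fun s θ => u s θ - v s θ := by
  simpa [sub_eq_add_neg] using hu.add (hv.neg hρ) hρ

lemma Wiener.pow {ρ M : ℝ} {u : ℝ → Plane → ℂ} (h : Wiener ρ M u) (hρ : 0 ≤ ρ) (n : ℕ) :
    Wiener ρ (M ^ n) fun s θ => u s θ ^ n := by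
  induction n with
  | zero => simpa using Wiener.const ρ 1
  | succ n ih => simpa [pow_succ] using ih.mul h hρ

lemma Wiener.conj {ρ M : ℝ} {u : ℝ → Plane → ℂ} (h : Wiener ρ M u) :
    Wiener ρ M fun s θ => (starRingEnd ℂ) (u s θ) := by
  obtain ⟨T, hT, c, j, B, hB, hBM, hu⟩ := h
  refine ⟨T, hT, fun t => (starRingEnd ℂ) (c t), fun t => -j t, B, by simpa [wt_neg] using hB, hBM,
    fun s θ => ?_⟩
  have := (Complex.hasSum_conj' ).2 (hu s θ)
  simpa [chi_neg] using this

/-- Lets complex constructions be turned into real ones without any symmetry of the chosen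
coefficients. -/
lemma Wiener.re {ρ M : ℝ} {u : ℝ → Plane → ℂ} (h : Wiener ρ M u) (hρ : 0 ≤ ρ) :
    RWiener ρ M fun s θ => (u s θ).re := by
  have := (h.add h.conj hρ).const_mul hρ (1 / 2)
  unfold RWiener
  convert this using 1
  · norm_num; ring
  · funext s θ
    rw [Complex.re_eq_add_conj]; ring

lemma Wiener.exp_sub_one {ρ M : ℝ} {u : ℝ → Plane → ℂ} (h : Wiener ρ M u) (hρ : 0 ≤ ρ) :
    Wiener ρ (Real.exp M - 1) fun s θ => Complex.exp (u s θ) - 1 := by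
  refine Wiener.tsum (ι := ℕ) (u := fun n s θ => ((n + 1).factorial : ℂ)⁻¹ * u s θ ^ (n + 1))
    (m := fun n => ((n + 1).factorial : ℝ)⁻¹ * M ^ (n + 1)) hρ (fun n => ?_)
    (M₀ := Real.exp M - 1) ?_ le_rfl fun s θ => ?_
  · simpa using (h.pow hρ (n + 1)).const_mul hρ (((n + 1).factorial : ℂ)⁻¹)
  · have := NormedSpace.exp_series_hasSum_exp' (𝕂 := ℝ) M
    rw [← Real.exp_eq_exp_ℝ, ← hasSum_nat_add_iff' 1] at this
    simpa using this
  · have := NormedSpace.exp_series_hasSum_exp' (𝕂 := ℂ) (u s θ)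
    rw [← Complex.exp_eq_exp_ℂ, ← hasSum_nat_add_iff' 1] at this
    simpa using this

lemma Wiener.exp {ρ M : ℝ} {u : ℝ → Plane → ℂ} (h : Wiener ρ M u) (hρ : 0 ≤ ρ) :
    Wiener ρ (Real.exp M) fun s θ => Complex.exp (u s θ) := by
  simpa using (h.exp_sub_one hρ).add (Wiener.const ρ 1) hρ

/-! ### Real valued functions -/

section Real

variable {ρ ρ' M M' : ℝ} {u v : ℝ → Plane → ℝ}

lemma RWiener.mono (h : RWiener ρ M u) (hρ : ρ' ≤ ρ) (hM : M ≤ M') : RWiener ρ' M' u :=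
  Wiener.mono h hρ hM

lemma RWiener.nonneg (h : RWiener ρ M u) : 0 ≤ M := Wiener.nonneg h

lemma RWiener.abs_le (h : RWiener ρ M u) (hρ : 0 ≤ ρ) (s : ℝ) (θ : Plane) : |u s θ| ≤ M := by
  simpa using Wiener.norm_le h hρ s θ

lemma RWiener.const (ρ a : ℝ) : RWiener ρ |a| fun _ _ => a := by
  simpa [RWiener] using Wiener.const ρ (a : ℂ)

lemma RWiener.zero (ρ : ℝ) (hM : 0 ≤ M) : RWiener ρ M fun _ _ => 0 :=
  (RWiener.const ρ 0).mono le_rfl (by simpa)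

lemma RWiener.mul (hu : RWiener ρ M u) (hv : RWiener ρ M' v) (hρ : 0 ≤ ρ) :
    RWiener ρ (M * M') fun s θ => u s θ * v s θ := by
  simpa [RWiener] using Wiener.mul hu hv hρ

lemma RWiener.add (hu : RWiener ρ M u) (hv : RWiener ρ M' v) (hρ : 0 ≤ ρ) :
    RWiener ρ (M + M') fun s θ => u s θ + v s θ := by
  simpa [RWiener] using Wiener.add hu hv hρ

lemma RWiener.sub (hu : RWiener ρ M u) (hv : RWiener ρ M' v) (hρ : 0 ≤ ρ) :
    RWiener ρ (M + M') fun s θ => u s θ - v s θ := by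
  simpa [RWiener] using Wiener.sub hu hv hρ

lemma RWiener.neg (hu : RWiener ρ M u) (hρ : 0 ≤ ρ) : RWiener ρ M fun s θ => -u s θ := by
  simpa [RWiener] using Wiener.neg hu hρ

lemma RWiener.const_mul (hu : RWiener ρ M u) (hρ : 0 ≤ ρ) (a : ℝ) :
    RWiener ρ (|a| * M) fun s θ => a * u s θ := (RWiener.const ρ a).mul hu hρ

lemma RWiener.tsum {ι : Type} [Countable ι] {M₀ : ℝ} {u : ι → ℝ → Plane → ℝ} {m : ι → ℝ}
    (hρ : 0 ≤ ρ) (hu : ∀ i, RWiener ρ (m i) (u i)) (hm : HasSum m M₀)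
    (hM : M₀ ≤ M) (hv : ∀ s θ, HasSum (fun i => u i s θ) (v s θ)) : RWiener ρ M v :=
  Wiener.tsum hρ hu hm hM fun s θ => Complex.hasSum_ofReal.2 (hv s θ)

/-- The only explicit source of dependence on `s` in the scheme: `sin s` is the real part of `-i`
times the character of frequency `(0, 1)`. -/
lemma RWiener.sin (ρ : ℝ) (hρ : 0 ≤ ρ) : RWiener ρ (Real.exp ρ) fun s _ => Real.sin s := by
  have h1 := (Wiener.char ρ (-Complex.I) (0, 1)).re hρ
  convert h1 using 1
  · simp [wt]
  · funext s θ
    simp [chi, phase, Complex.exp_ofReal_mul_I_re, Complex.exp_ofReal_mul_I_im]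

lemma RWiener.inv_one_add (hu : RWiener ρ M u) (hρ : 0 ≤ ρ) (hM : M ≤ 1 / 2) :
    RWiener ρ (2 * M) fun s θ => (1 + u s θ)⁻¹ - 1 := by
  have hM0 := hu.nonneg
  refine RWiener.tsum (ι := ℕ) (u := fun n s θ => (-u s θ) ^ (n + 1)) (m := fun n => M ^ (n + 1))
    hρ (fun n => ?_) (M₀ := (1 - M)⁻¹ - 1) ?_ ?_ fun s θ => ?_
  · simpa [RWiener] using (Wiener.neg hu hρ).pow hρ (n + 1)
  · have := hasSum_geometric_of_lt_one hM0 (by linarith)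
    rw [← hasSum_nat_add_iff' 1] at this
    simpa using this
  · rw [inv_eq_one_div, div_sub_one (by linarith), div_le_iff₀ (by linarith)]
    nlinarith
  · have hb := hu.abs_le hρ s θ
    have := hasSum_geometric_of_abs_lt_one (r := -u s θ) (by rw [abs_neg]; linarith)
    rw [← hasSum_nat_add_iff' 1] at this
    simpa using this

lemma mul_exp_le {δ x : ℝ} (hδ : 0 < δ) : x ≤ Real.exp (δ * x) / δ := by
  rw [le_div_iff₀ hδ]
  have := Real.add_one_le_exp (δ * x)
  linarith

/-! ### Composition with a perturbation of the identity -/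

/-- Displacing the angles by `f` multiplies a character by the exponential of this function. The
parameter is not displaced, hence the frequency `(j.1, 0)`. -/
lemma Wiener.exp_phase {η : ℝ} {f : ℝ → Plane → Fin 2 → ℝ}
    (hf : ∀ i, RWiener ρ η fun s θ => f s θ i) (hρ : 0 ≤ ρ) (j : Freq) :
    Wiener ρ (wt j * η) fun s θ => (phase (j.1, 0) s (f s θ) : ℝ) * Complex.I := by
  have hη := (hf 0).nonneg
  have h := (((hf 0).const_mul hρ (j.1 0)).add ((hf 1).const_mul hρ (j.1 1)) hρ)
  have h2 := Wiener.const_mul h hρ Complex.I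
  have h3 := Wiener.mono h2 le_rfl (?_ : _ ≤ wt j * η)
  · convert h3 using 3 with s θ
    simp only [phase]
    push_cast
    ring
  · simp only [Complex.norm_I, one_mul, wt]
    have := abs_nonneg (j.2 : ℝ)
    nlinarith

lemma chi_add_right (j : Freq) (s : ℝ) (θ y : Plane) :
    chi j s (θ + y) = chi j s θ * Complex.exp ((phase (j.1, 0) s y : ℝ) * Complex.I) := by
  simp only [chi, ← Complex.exp_add, phase, Pi.add_apply]
  congr 1
  push_cast
  ring

/-- The factor `exp(i k · f)` has norm at most `exp(|k| η)`, which is paid for by giving up `η` of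
the rate of decay. -/
lemma Wiener.comp {η : ℝ} {u : ℝ → Plane → ℂ} {f : ℝ → Plane → Fin 2 → ℝ} (hu : Wiener ρ M u)
    (hf : ∀ i, RWiener ρ' η fun s θ => f s θ i) (hρ' : 0 ≤ ρ') (h : ρ' + η ≤ ρ) :
    Wiener ρ' M fun s θ => u s (θ + f s θ) := by
  obtain ⟨T, hT, c, j, B, hB, hBM, hu⟩ := hu
  have hle : ∀ t, ‖c t‖ * Real.exp (ρ' * wt (j t)) * Real.exp (wt (j t) * η) ≤
      ‖c t‖ * Real.exp (ρ * wt (j t)) := fun t => by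
    rw [mul_assoc, ← Real.exp_add]
    have := wt_nonneg (j t)
    gcongr
    nlinarith
  have hs := Summable.of_nonneg_of_le (fun t => by positivity) hle hB.summable
  refine Wiener.tsum hρ' (fun t => ((Wiener.exp_phase hf hρ' (j t)).exp hρ').char_mul hρ' (c t)
    (j t)) hs.hasSum ((hasSum_le hle hs.hasSum hB).trans hBM) fun s θ => ?_
  refine (hu s (θ + f s θ)).congr_fun fun t => ?_
  rw [chi_add_right, mul_assoc]

/-- Mean value estimate: each character gains the factor `exp(i k · f) - 1`, of size about `|k| η`,
and the power of `|k|` costs `1/δ` together with a further loss `δ` of the rate. -/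
lemma Wiener.comp_sub {η δ : ℝ} {u : ℝ → Plane → ℂ} {f : ℝ → Plane → Fin 2 → ℝ}
    (hu : Wiener ρ M u) (hf : ∀ i, RWiener ρ' η fun s θ => f s θ i) (hρ' : 0 ≤ ρ') (hδ : 0 < δ)
    (h : ρ' + η + δ ≤ ρ) : Wiener ρ' (M * η / δ) fun s θ => u s (θ + f s θ) - u s θ := by
  have hη := (hf 0).nonneg
  obtain ⟨T, hT, c, j, B, hB, hBM, hu⟩ := hu
  have hle : ∀ t, ‖c t‖ * Real.exp (ρ' * wt (j t)) * (Real.exp (wt (j t) * η) - 1) ≤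
      ‖c t‖ * Real.exp (ρ * wt (j t)) * (η / δ) := fun t => by
    have hw := wt_nonneg (j t)
    -- This is `eˣ - 1 ≤ x eˣ`, obtained from `1 - x ≤ e⁻ˣ`.
    have h1 : Real.exp (wt (j t) * η) - 1 ≤ wt (j t) * η * Real.exp (wt (j t) * η) := by
      have h2 := Real.add_one_le_exp (-(wt (j t) * η))
      have h3 : Real.exp (-(wt (j t) * η)) * Real.exp (wt (j t) * η) = 1 := by
        rw [← Real.exp_add]; simp
      nlinarith [Real.exp_pos (wt (j t) * η)]
    have h4 : wt (j t) ≤ Real.exp (δ * wt (j t)) / δ := mul_exp_le hδ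
    calc ‖c t‖ * Real.exp (ρ' * wt (j t)) * (Real.exp (wt (j t) * η) - 1)
        ≤ ‖c t‖ * Real.exp (ρ' * wt (j t)) *
          ((Real.exp (δ * wt (j t)) / δ) * η * Real.exp (wt (j t) * η)) := by
          refine mul_le_mul_of_nonneg_left (h1.trans ?_) (by positivity)
          gcongr
      _ = ‖c t‖ * (Real.exp (ρ' * wt (j t) + δ * wt (j t) + wt (j t) * η)) * (η / δ) := by
          rw [Real.exp_add, Real.exp_add]; ring
      _ ≤ _ := by
          gcongr
          nlinarith
  have hB' := hB.mul_right (η / δ)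
  have hs := Summable.of_nonneg_of_le (fun t => mul_nonneg (by positivity) (by
    have := wt_nonneg (j t)
    have := Real.one_le_exp (mul_nonneg this hη)
    linarith)) hle hB'.summable
  refine Wiener.tsum hρ' (fun t => ((Wiener.exp_phase hf hρ' (j t)).exp_sub_one hρ').char_mul hρ'
    (c t) (j t)) hs.hasSum ((hasSum_le hle hs.hasSum hB').trans ?_) fun s θ => ?_
  · rw [mul_div_assoc]; gcongr
  refine ((hu s (θ + f s θ)).sub (hu s θ)).congr_fun fun t => ?_
  rw [chi_add_right]; ring

lemma RWiener.comp {η : ℝ} {f : ℝ → Plane → Fin 2 → ℝ} (hu : RWiener ρ M u)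
    (hf : ∀ i, RWiener ρ' η fun s θ => f s θ i) (hρ' : 0 ≤ ρ') (h : ρ' + η ≤ ρ) :
    RWiener ρ' M fun s θ => u s (θ + f s θ) := Wiener.comp hu hf hρ' h

lemma RWiener.comp_sub {η δ : ℝ} {f : ℝ → Plane → Fin 2 → ℝ}
    (hu : RWiener ρ M u) (hf : ∀ i, RWiener ρ' η fun s θ => f s θ i) (hρ' : 0 ≤ ρ') (hδ : 0 < δ)
    (h : ρ' + η + δ ≤ ρ) : RWiener ρ' (M * η / δ) fun s θ => u s (θ + f s θ) - u s θ := by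
  simpa [RWiener] using Wiener.comp_sub hu hf hρ' hδ h

/-! ### Derivatives in the angles -/

/-- The differential of the phase in the angles. -/
def phaseCLM (j : Freq) : Plane →L[ℝ] ℝ :=
  (j.1 0 : ℝ) • ContinuousLinearMap.proj 0 + (j.1 1 : ℝ) • ContinuousLinearMap.proj 1

lemma phaseCLM_apply (j : Freq) (y : Plane) : phaseCLM j y = j.1 0 * y 0 + j.1 1 * y 1 := by
  simp [phaseCLM]

lemma phaseCLM_single (j : Freq) (i : Fin 2) : phaseCLM j (Pi.single i 1) = j.1 i := by
  fin_cases i <;> simp [phaseCLM]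

lemma norm_phaseCLM_le (j : Freq) : ‖phaseCLM j‖ ≤ wt j := by
  refine ContinuousLinearMap.opNorm_le_bound _ (wt_nonneg j) fun y => ?_
  rw [phaseCLM_apply, Real.norm_eq_abs, wt]
  have h0 := norm_le_pi_norm y 0
  have h1 := norm_le_pi_norm y 1
  rw [Real.norm_eq_abs] at h0 h1
  calc _ ≤ |(j.1 0 : ℝ)| * |y 0| + |(j.1 1 : ℝ)| * |y 1| := by
        rw [← abs_mul, ← abs_mul]; exact abs_add_le _ _
    _ ≤ |(j.1 0 : ℝ)| * ‖y‖ + |(j.1 1 : ℝ)| * ‖y‖ := by gcongr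
    _ ≤ _ := by
      have := mul_nonneg (abs_nonneg (j.2 : ℝ)) (norm_nonneg y)
      linarith

lemma hasFDerivAt_chi (j : Freq) (s : ℝ) (θ : Plane) :
    HasFDerivAt (chi j s)
      ((Complex.I * chi j s θ) • (Complex.ofRealCLM.comp (phaseCLM j))) θ := by
  have h1 : HasFDerivAt (phase j s) (phaseCLM j) θ := by
    have : phase j s = fun θ => phaseCLM j θ + j.2 * s := by
      funext θ; simp [phase, phaseCLM_apply]
    rw [this]
    exact (phaseCLM j).hasFDerivAt.add_const _
  have h2 := ((Complex.ofRealCLM.hasFDerivAt.comp θ h1).mul_const Complex.I).cexp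
  refine h2.congr_fderiv ?_
  ext y
  simp [chi]
  ring

/-- Termwise differentiation, stated for an arbitrary representation. It is also what identifies the
derivative of the solution of the cohomological equation in the direction `ω`. -/
lemma hasFDerivAt_of_hasSum_chi {T : Type} {c : T → ℂ} {j : T → Freq} {u : Plane → ℂ} {s : ℝ}
    (hs : Summable fun t => ‖c t‖ * wt (j t))
    (hu : ∀ θ, HasSum (fun t => c t * chi (j t) s θ) (u θ)) (θ : Plane) :
    ∃ D : Plane →L[ℝ] ℂ, HasFDerivAt u D θ ∧
      ∀ y, HasSum (fun t => c t * (Complex.I * phaseCLM (j t) y) * chi (j t) s θ) (D y) := by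
  set D' : T → Plane → (Plane →L[ℝ] ℂ) := fun t θ =>
    c t • ((Complex.I * chi (j t) s θ) • (Complex.ofRealCLM.comp (phaseCLM (j t)))) with hD'
  have hD'b : ∀ t θ, ‖D' t θ‖ ≤ ‖c t‖ * wt (j t) := fun t θ => by
    rw [hD']
    simp only [norm_smul, norm_mul, Complex.norm_I, one_mul, norm_chi]
    gcongr
    refine (ContinuousLinearMap.opNorm_comp_le _ _).trans ?_
    simpa using norm_phaseCLM_le (j t)
  have hfun : u = fun θ => ∑' t, c t * chi (j t) s θ := by
    funext θ; exact (hu θ).tsum_eq.symm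
  refine ⟨∑' t, D' t θ, ?_, fun y => ?_⟩
  · rw [hfun]
    exact hasFDerivAt_tsum hs (fun t θ => (hasFDerivAt_chi (j t) s θ).const_mul (c t))
      (fun t θ => hD'b t θ) (hu 0).summable θ
  · have hsD : Summable fun t => D' t θ := Summable.of_norm_bounded hs fun t => hD'b t θ
    have := hsD.hasSum.mapL (ContinuousLinearMap.apply ℝ ℂ y)
    refine this.congr_fun fun t => ?_
    simp [hD']
    ring

lemma wt_mul_exp_le {δ : ℝ} (hδ : 0 < δ) (a : ℝ) (ha : 0 ≤ a) (j : Freq) :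
    a * wt j * Real.exp ((ρ - δ) * wt j) ≤ a * Real.exp (ρ * wt j) / δ := by
  have h4 : wt j ≤ Real.exp (δ * wt j) / δ := mul_exp_le hδ
  calc _ ≤ a * (Real.exp (δ * wt j) / δ) * Real.exp ((ρ - δ) * wt j) := by gcongr
    _ = a * Real.exp (δ * wt j + (ρ - δ) * wt j) / δ := by rw [Real.exp_add]; ring
    _ = _ := by ring_nf

lemma summable_norm_mul_wt {T : Type} {c : T → ℂ} {j : T → Freq} (hρ : 0 < ρ)
    (h : Summable fun t => ‖c t‖ * Real.exp (ρ * wt (j t))) :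
    Summable fun t => ‖c t‖ * wt (j t) := by
  refine Summable.of_nonneg_of_le (fun t => by have := wt_nonneg (j t); positivity)
    (fun t => ?_) (h.div_const ρ)
  simpa using wt_mul_exp_le (ρ := ρ) hρ ‖c t‖ (norm_nonneg _) (j t)

/-- The Cauchy estimate: a derivative brings down a factor at most `wt j`, and `wt j ≤ exp(δ wt
j)/δ`. -/
lemma Wiener.hasFDerivAt {δ : ℝ} {u : ℝ → Plane → ℂ} (hu : Wiener ρ M u) (hδ : 0 < δ)
    (hδρ : δ ≤ ρ) : ∃ D : ℝ → Plane → (Plane →L[ℝ] ℂ), (∀ s θ, HasFDerivAt (u s) (D s θ) θ) ∧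
      ∀ i, Wiener (ρ - δ) (M / δ) fun s θ => D s θ (Pi.single i 1) := by
  have hM := hu.nonneg
  obtain ⟨T, hT, c, j, B, hB, hBM, hu⟩ := hu
  have hB' := hB.div_const δ
  choose D hD hDsum using fun s θ => hasFDerivAt_of_hasSum_chi
    (summable_norm_mul_wt (hδ.trans_le hδρ) hB.summable) (hu s) θ
  refine ⟨D, hD, fun i => ?_⟩
  have hle : ∀ t, ‖c t * (Complex.I * phaseCLM (j t) (Pi.single i 1))‖ *
      Real.exp ((ρ - δ) * wt (j t)) ≤ ‖c t‖ * Real.exp (ρ * wt (j t)) / δ := fun t => by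
    refine le_trans ?_ (wt_mul_exp_le hδ _ (norm_nonneg _) _)
    rw [norm_mul, norm_mul, Complex.norm_I, one_mul, phaseCLM_single, Complex.norm_real,
      Real.norm_eq_abs]
    gcongr
    exact abs_fst_le_wt _ _
  have hs' := Summable.of_nonneg_of_le (fun t => by positivity) hle hB'.summable
  exact ⟨T, hT, _, j, _, hs'.hasSum, (hasSum_le hle hs'.hasSum hB').trans (by gcongr),
    fun s θ => hDsum s θ _⟩

lemma RWiener.differentiable (hu : RWiener ρ M u) (hρ : 0 < ρ) (s : ℝ) :
    Differentiable ℝ (u s) := fun θ => by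
  obtain ⟨D, hD, -⟩ := Wiener.hasFDerivAt hu hρ le_rfl
  simpa [Function.comp_def] using
    (Complex.reCLM.hasFDerivAt.comp θ (hD s θ)).differentiableAt

lemma RWiener.partials {δ : ℝ} (hu : RWiener ρ M u) (hδ : 0 < δ) (hδρ : δ ≤ ρ) (i : Fin 2) :
    RWiener (ρ - δ) (M / δ) fun s θ => partials (u s) θ i := by
  obtain ⟨D, hD, hb⟩ := Wiener.hasFDerivAt hu hδ hδρ
  have := hb i
  unfold RWiener
  convert this using 3 with s θ
  have h1 := Complex.ofRealCLM.hasFDerivAt.comp θ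
    (hu.differentiable (hδ.trans_le hδρ) s θ).hasFDerivAt
  have h2 := h1.unique (hD s θ)
  rw [← h2]
  simp [Beltrami.partials]

end Real

/-! ### Integration over the torus -/

/-- The fundamental domain of `𝕋²`. -/
def cell : Set Plane := Set.Icc (0 : Plane) fun _ => 2 * Real.pi

lemma two_pi_nonneg : (0 : Plane) ≤ fun _ => 2 * Real.pi := fun _ => by
  simpa using Real.pi_pos.le

lemma volume_cell : MeasureTheory.volume.real cell = 4 * Real.pi ^ 2 := by
  have := Real.volume_Icc_pi_toReal two_pi_nonneg
  rw [MeasureTheory.measureReal_def, cell, this]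
  simp
  ring

lemma isCompact_cell : IsCompact cell := isCompact_Icc

/-- The divergence theorem on the cell for the vector field `u eᵢ`: the contributions of opposite
faces cancel by periodicity. -/
lemma integral_fderiv_eq_zero {E : Type} [NormedAddCommGroup E] [NormedSpace ℝ E] [CompleteSpace E]
    {u : Plane → E} (hu : ContDiff ℝ 1 u) (hp : IsPeriodic u) (i : Fin 2) :
    ∫ x in cell, fderiv ℝ u x (Pi.single i 1) = 0 := by
  have hc : Continuous fun x => fderiv ℝ u x (Pi.single i 1) :=
    (hu.continuous_fderiv one_ne_zero).clm_apply continuous_const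
  have h := MeasureTheory.integral_divergence_of_hasFDerivAt_off_countable' (n := 1)
    (0 : Plane) (fun _ => 2 * Real.pi) two_pi_nonneg (fun l => if l = i then u else 0)
    (fun l x => if l = i then fderiv ℝ u x else 0) ∅ Set.countable_empty
    (fun l => by
      split_ifs
      · exact hu.continuous.continuousOn
      · exact continuousOn_const)
    (fun x _ l => by
      split_ifs
      · exact (hu.differentiable one_ne_zero x).hasFDerivAt
      · exact hasFDerivAt_const _ _)
    (by
      refine (ContinuousOn.integrableOn_compact isCompact_Icc ?_)
      refine Continuous.continuousOn ?_
      refine continuous_finsetSum _ fun l _ => ?_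
      by_cases hl : l = i
      · subst hl; simpa using hc
      · simpa [hl] using continuous_const)
  have hL : ∀ x : Plane, (∑ l : Fin 2, (if l = i then fderiv ℝ u x else 0) (Pi.single l 1)) =
      fderiv ℝ u x (Pi.single i 1) := fun x => by
    rw [Finset.sum_eq_single i] <;> simp +contextual
  simp only [hL] at h
  rw [cell, h]
  refine Finset.sum_eq_zero fun l _ => ?_
  by_cases hl : l = i
  · subst hl
    simp only [if_true]
    rw [sub_eq_zero]
    congr 1
    funext x
    -- Translation by `2π` in the coordinate `l` carries the face at `0` to the face at `2π`.
    have := hp (l.insertNth (0 : ℝ) x) (Pi.single l 1)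
    rw [Pi.zero_apply, ← this]
    congr 1
    funext m
    rcases Fin.eq_self_or_eq_succAbove l m with rfl | ⟨y, rfl⟩
    · simp [latticeVec]
    · simp [latticeVec, Fin.succAbove_ne]
  · simp [hl]

lemma chi_periodic (j : Freq) (s : ℝ) : IsPeriodic (chi j s) := fun θ k => by
  rw [chi_add_right]
  have : Complex.exp ((phase (j.1, 0) s (latticeVec k) : ℝ) * Complex.I) = 1 := by
    rw [Complex.exp_eq_one_iff]
    refine ⟨j.1 0 * k 0 + j.1 1 * k 1, ?_⟩
    simp only [phase, latticeVec]
    push_cast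
    ring
  rw [this, mul_one]

lemma contDiff_chi (j : Freq) (s : ℝ) : ContDiff ℝ 1 (chi j s) := by
  have : phase j s = fun θ => phaseCLM j θ + j.2 * s := by
    funext θ; simp [phase, phaseCLM_apply]
  have h : ContDiff ℝ 1 (phase j s) := by
    rw [this]
    exact (phaseCLM j).contDiff.add contDiff_const
  exact ContDiff.cexp (ContDiff.mul (Complex.ofRealCLM.contDiff.comp h) contDiff_const)

lemma integral_chi (j : Freq) (s : ℝ) :
    ∫ θ in cell, chi j s θ =
      if j.1 = 0 then (4 * Real.pi ^ 2 : ℝ) * Complex.exp ((j.2 * s : ℝ) * Complex.I) else 0 := by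
  split_ifs with hj
  · have : ∀ θ, chi j s θ = Complex.exp ((j.2 * s : ℝ) * Complex.I) := fun θ => by
      simp [chi, phase, hj]
    simp only [this, MeasureTheory.setIntegral_const, volume_cell, Complex.real_smul]
  · obtain ⟨i, hi⟩ : ∃ i, j.1 i ≠ 0 := by
      by_contra h
      exact hj (funext fun i => by simpa using not_exists.1 h i)
    have h := integral_fderiv_eq_zero (contDiff_chi j s) (chi_periodic j s) i
    have h2 : ∀ θ, fderiv ℝ (chi j s) θ (Pi.single i 1) =
        (Complex.I * j.1 i) * chi j s θ := fun θ => by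
      rw [(hasFDerivAt_chi j s θ).fderiv]
      simp [phaseCLM_single]
      ring
    simp only [h2, MeasureTheory.integral_const_mul, mul_eq_zero] at h
    rcases h with h | h
    · simp [hi] at h
    · exact h

lemma continuous_chi (j : Freq) (s : ℝ) : Continuous (chi j s) := (contDiff_chi j s).continuous

/-- At fixed `s`, the Fourier coefficient in the angles collects all terms with angular frequency
`k`. The exponentials in `s` remain, since there is no integration in the parameter. -/
lemma hasSum_integral_chi {T : Type} [Countable T] {c : T → ℂ} {j : T → Freq} {u : Plane → ℂ}
    {s : ℝ} (hs : Summable fun t => ‖c t‖)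
    (hu : ∀ θ, HasSum (fun t => c t * chi (j t) s θ) (u θ)) (k : Fin 2 → ℤ) :
    HasSum (fun t => if (j t).1 = k then c t * Complex.exp (((j t).2 * s : ℝ) * Complex.I) else 0)
      ((4 * Real.pi ^ 2 : ℝ)⁻¹ * ∫ θ in cell, u θ * chi (-k, 0) s θ) := by
  have hterm : ∀ t θ, c t * chi (j t) s θ * chi (-k, 0) s θ = c t * chi (j t + (-k, 0)) s θ :=
    fun t θ => by rw [chi_add, mul_assoc]
  have h := MeasureTheory.hasSum_integral_of_summable_integral_norm
    (μ := MeasureTheory.volume.restrict cell)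
    (F := fun t θ => c t * chi (j t) s θ * chi (-k, 0) s θ) (fun t => by
      refine ContinuousOn.integrableOn_compact isCompact_cell (Continuous.continuousOn ?_)
      exact (continuous_const.mul (continuous_chi _ _)).mul (continuous_chi _ _)) (by
      simp only [norm_mul, norm_chi, mul_one, MeasureTheory.setIntegral_const, volume_cell,
        smul_eq_mul]
      exact hs.mul_left _)
  have h2 : ∀ θ, ∑' t, c t * chi (j t) s θ * chi (-k, 0) s θ = u θ * chi (-k, 0) s θ := fun θ =>
    ((hu θ).mul_right _).tsum_eq
  simp only [h2] at h
  have h3 := h.mul_left (((4 * Real.pi ^ 2 : ℝ)⁻¹ : ℝ) : ℂ)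
  refine h3.congr_fun fun t => ?_
  rw [MeasureTheory.integral_congr_ae (.of_forall (hterm t)), MeasureTheory.integral_const_mul,
    integral_chi]
  have hpi : ((4 * Real.pi ^ 2 : ℝ) : ℂ) ≠ 0 := Complex.ofReal_ne_zero.2 (by positivity)
  by_cases hk : (j t).1 = k
  · have hk' : (j t + (-k, 0)).1 = 0 := by simp [hk]
    have hk2 : (j t + (-k, 0)).2 = (j t).2 := by simp
    rw [if_pos hk, if_pos hk', hk2, Complex.ofReal_inv]
    field_simp
  · have hk' : ¬ (j t + (-k, 0)).1 = 0 := by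
      intro h0
      exact hk (by simpa [add_neg_eq_zero] using h0)
    rw [if_neg hk, if_neg hk', mul_zero, mul_zero]

/-! ### The cohomological equation -/

/-- A lower bound for the small divisors `k · ω`, with exponent `N` and constant `C`. -/
def SmallDivisorBound (ω : Fin 2 → ℝ) (N : ℕ) (C : ℝ) : Prop :=
  ∀ k : Fin 2 → ℤ, k ≠ 0 → (k 0 * ω 0 + k 1 * ω 1 : ℝ) ≠ 0 ∧
    |(k 0 * ω 0 + k 1 * ω 1 : ℝ)|⁻¹ ≤ C * (|(k 0 : ℝ)| + |(k 1 : ℝ)|) ^ N / N.factorial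

lemma dotProduct_partials (ω : Fin 2 → ℝ) (f : Plane → ℝ) (x : Plane) :
    ω ⬝ᵥ partials f x = fderiv ℝ f x ω := by
  have : ω = ω 0 • Pi.single 0 1 + ω 1 • Pi.single 1 1 := by
    ext i; fin_cases i <;> simp
  conv_rhs => rw [this, map_add, map_smul, map_smul]
  simp [dotProduct, partials, Fin.sum_univ_two]

/-- Divide each coefficient by `i k · ω` and drop the terms with `k = 0`, which make up the mean.
The last clause, that `g` vanishes at every `s` where `u` does, is what keeps the whole Newton
scheme trivial at `s = 0`. It is not immediate, because the coefficients of a representation need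
not vanish when the function vanishes at one value of `s`. -/
lemma Wiener.exists_cohomological {ω : Fin 2 → ℝ} {N : ℕ} {C ρ M δ : ℝ} {u : ℝ → Plane → ℂ}
    (hω : SmallDivisorBound ω N C) (hC : 0 ≤ C) (hu : Wiener ρ M u) (hδ : 0 < δ) (hδρ : δ ≤ ρ) :
    ∃ g : ℝ → Plane → ℂ, Wiener (ρ - δ) (C / δ ^ N * M) g ∧
      Wiener ρ M (fun s _ => (4 * Real.pi ^ 2 : ℝ)⁻¹ * ∫ θ in cell, u s θ) ∧
      (∀ s θ, ∃ D : Plane →L[ℝ] ℂ, HasFDerivAt (g s) D θ ∧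
        D ω = u s θ - (4 * Real.pi ^ 2 : ℝ)⁻¹ * ∫ θ in cell, u s θ) ∧
      ∀ s, (∀ θ, u s θ = 0) → ∀ θ, g s θ = 0 := by
  have hM := hu.nonneg
  have hρ : 0 < ρ := hδ.trans_le hδρ
  obtain ⟨T, hT, c, j, B, hB, hBM, hu⟩ := hu
  set div : Freq → ℝ := fun l => l.1 0 * ω 0 + l.1 1 * ω 1 with hdiv
  set b : T → ℂ := fun t => if (j t).1 = 0 then 0 else c t * (Complex.I * div (j t))⁻¹ with hb
  have hbd : ∀ δ' > 0, ∀ t, ‖b t‖ * Real.exp ((ρ - δ') * wt (j t)) ≤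
      C / δ' ^ N * (‖c t‖ * Real.exp (ρ * wt (j t))) := fun δ' hδ' t => by
    have hw := wt_nonneg (j t)
    rw [hb]
    by_cases h0 : (j t).1 = 0
    · simp only [h0, if_true, norm_zero, zero_mul]; positivity
    simp only [h0, if_false, norm_mul, norm_inv, Complex.norm_I, one_mul, Complex.norm_real,
      Real.norm_eq_abs]
    have h1 := (hω _ h0).2
    have h2 : (|((j t).1 0 : ℝ)| + |((j t).1 1 : ℝ)|) ^ N / N.factorial ≤
        Real.exp (δ' * wt (j t)) / δ' ^ N := by
      -- The factorial in `SmallDivisorBound` is there for this inequality: `(δ'x)^N / N! ≤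
      -- exp(δ'x)`, so the small divisors cost exactly `C/δ'^N`.
      have h3 := Real.pow_div_factorial_le_exp (δ' * wt (j t)) (by positivity) N
      rw [le_div_iff₀ (by positivity), div_mul_eq_mul_div, ← mul_pow]
      refine le_trans ?_ h3
      rw [mul_comm δ']
      gcongr
      unfold wt
      linarith [abs_nonneg ((j t).2 : ℝ)]
    calc ‖c t‖ * |div (j t)|⁻¹ * Real.exp ((ρ - δ') * wt (j t))
        ≤ ‖c t‖ * (C * (Real.exp (δ' * wt (j t)) / δ' ^ N)) *
          Real.exp ((ρ - δ') * wt (j t)) := by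
          gcongr
          refine h1.trans ?_
          rw [mul_div_assoc]
          gcongr
      _ = C / δ' ^ N * (‖c t‖ * Real.exp (δ' * wt (j t) + (ρ - δ') * wt (j t))) := by
          rw [Real.exp_add]; ring
      _ = _ := by ring_nf
  have hbs : ∀ δ' > 0, Summable fun t => ‖b t‖ * Real.exp ((ρ - δ') * wt (j t)) := fun δ' hδ' =>
    Summable.of_nonneg_of_le (fun t => by positivity) (hbd δ' hδ') (hB.summable.mul_left _)
  -- The rate lost here is `δ/2` and not `δ`: a positive rate must be left for differentiation even
  -- when `δ = ρ`.
  have hbw : Summable fun t => ‖b t‖ * wt (j t) := by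
    refine summable_norm_mul_wt (ρ := ρ - δ / 2) (by linarith) (hbs _ (by positivity))
  have hb1 : Summable fun t => ‖b t‖ :=
    Summable.of_nonneg_of_le (fun t => norm_nonneg _)
      (fun t => le_mul_exp_wt (by linarith) _ (norm_nonneg _) _) (hbs (δ / 2) (by positivity))
  have hc1 : Summable fun t => ‖c t‖ :=
    Summable.of_nonneg_of_le (fun t => norm_nonneg _)
      (fun t => le_mul_exp_wt hρ.le _ (norm_nonneg _) _) hB.summable
  have hgs : ∀ s θ, Summable fun t => b t * chi (j t) s θ := fun s θ =>
    Summable.of_norm_bounded hb1 fun t => by rw [norm_mul, norm_chi, mul_one]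
  set g : ℝ → Plane → ℂ := fun s θ => ∑' t, b t * chi (j t) s θ with hg
  have hgsum : ∀ s θ, HasSum (fun t => b t * chi (j t) s θ) (g s θ) := fun s θ => (hgs s θ).hasSum
  have hmean : ∀ s, HasSum
      (fun t => if (j t).1 = 0 then c t * Complex.exp (((j t).2 * s : ℝ) * Complex.I) else 0)
      ((4 * Real.pi ^ 2 : ℝ)⁻¹ * ∫ θ in cell, u s θ) := fun s => by
    have := hasSum_integral_chi hc1 (hu s) 0
    simpa [chi, phase] using this
  refine ⟨g, ⟨T, hT, b, j, _, (hbs δ hδ).hasSum,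
    (hasSum_le (hbd δ hδ) (hbs δ hδ).hasSum (hB.mul_left _)).trans (by gcongr), hgsum⟩, ?_, ?_, ?_⟩
  · have hle : ∀ t, ‖if (j t).1 = 0 then c t else 0‖ * Real.exp (ρ * wt (j t)) ≤
        ‖c t‖ * Real.exp (ρ * wt (j t)) := fun t => by
      split_ifs
      · exact le_rfl
      · simp; positivity
    have hs := Summable.of_nonneg_of_le (fun t => by positivity) hle hB.summable
    refine ⟨T, hT, fun t => if (j t).1 = 0 then c t else 0, j, _, hs.hasSum,
      (hasSum_le hle hs.hasSum hB).trans hBM, fun s θ => (hmean s).congr_fun fun t => ?_⟩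
    split_ifs with h0
    · simp [chi, phase, h0]
    · simp [h0]
  · intro s θ
    obtain ⟨D, hD, hDs⟩ := hasFDerivAt_of_hasSum_chi hbw (hgsum s) θ
    refine ⟨D, hD, (hDs ω).unique ?_⟩
    refine ((hu s θ).sub (hmean s)).congr_fun fun t => ?_
    rw [hb, phaseCLM_apply]
    by_cases h0 : (j t).1 = 0
    · simp [h0, chi, phase]
    · have h1 : (div (j t) : ℂ) ≠ 0 := Complex.ofReal_ne_zero.2 (hω _ h0).1
      have h2 : (((j t).1 0 * ω 0 + (j t).1 1 * ω 1 : ℝ) : ℂ) = div (j t) := rfl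
      simp only [h0, if_false, sub_zero, h2]
      field_simp [Complex.I_ne_zero]
  · intro s h0 θ
    -- At this `s` every angular Fourier coefficient of `u` vanishes, so the terms with a given
    -- angular frequency `k` sum to zero. The divisor `k · ω` is constant on such a group, so the
    -- corresponding terms of `g` also sum to zero.
    have hfib : ∀ k, HasSum
        (fun t : {t // (j t).1 = k} => c t * Complex.exp (((j t).2 * s : ℝ) * Complex.I)) 0 :=
      fun k => by
      have := hasSum_integral_chi hc1 (hu s) k
      simp only [h0, zero_mul, MeasureTheory.integral_zero, mul_zero] at this
      have h1 := (hasSum_subtype_iff_indicator (s := {t | (j t).1 = k})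
        (f := fun t => c t * Complex.exp (((j t).2 * s : ℝ) * Complex.I)) (a := 0)).2
        (by
          refine this.congr_fun fun t => ?_
          simp only [Set.indicator_apply, Set.mem_ofPred_eq])
      exact h1
    have hsig := (Equiv.sigmaFiberEquiv fun t => (j t).1).hasSum_iff.2 (hgsum s θ)
    have hz : ∀ k, HasSum (fun t : {t // (j t).1 = k} => b t * chi (j t) s θ) 0 := fun k => by
      by_cases hk : k = 0
      · subst hk
        have : (fun t : {t // (j t).1 = 0} => b t * chi (j t) s θ) = fun _ => 0 := by
          funext t
          simp [hb, t.2]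
        rw [this]
        exact hasSum_zero
      · have h1 := (hfib k).mul_left ((Complex.I * div (k, 0))⁻¹ * chi (k, 0) s θ)
        rw [mul_zero] at h1
        refine h1.congr_fun fun t => ?_
        have hkt : j t = (k, 0) + (0, (j t).2) := by
          ext <;> simp [t.2]
        have hd : div (j t) = div (k, 0) := by simp [hdiv, t.2]
        have hchi : chi (j t) s θ =
            chi (k, 0) s θ * Complex.exp (((j t).2 * s : ℝ) * Complex.I) := by
          conv_lhs => rw [hkt, chi_add]
          simp [chi, phase]
        have hne : ¬ (j t).1 = 0 := by rw [t.2]; exact hk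
        rw [hb]
        simp only [hne, if_false, hd, hchi]
        ring
    exact (hsig.sigma hz).unique hasSum_zero

lemma ofReal_torusMean (u : Plane → ℝ) :
    ((torusMean u : ℝ) : ℂ) = (4 * Real.pi ^ 2 : ℝ)⁻¹ * ∫ θ in cell, (u θ : ℂ) := by
  rw [torusMean, torusIntegral, integral_complex_ofReal]
  simp [cell]

lemma RWiener.exists_cohomological {ω : Fin 2 → ℝ} {N : ℕ} {C ρ M δ : ℝ} {u : ℝ → Plane → ℝ}
    (hω : SmallDivisorBound ω N C) (hC : 0 ≤ C) (hu : RWiener ρ M u) (hδ : 0 < δ) (hδρ : δ ≤ ρ) :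
    ∃ g : ℝ → Plane → ℝ, RWiener (ρ - δ) (C / δ ^ N * M) g ∧
      RWiener ρ M (fun s _ => torusMean (u s)) ∧ (∀ s, Differentiable ℝ (g s)) ∧
      (∀ s θ, ω ⬝ᵥ Beltrami.partials (g s) θ = u s θ - torusMean (u s)) ∧
      ∀ s, (∀ θ, u s θ = 0) → ∀ θ, g s θ = 0 := by
  obtain ⟨g, hg, hm, hD, h0⟩ := Wiener.exists_cohomological hω hC hu hδ hδρ
  have key : ∀ s θ, ∃ D : Plane →L[ℝ] ℝ, HasFDerivAt (fun θ => (g s θ).re) D θ ∧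
      D ω = u s θ - torusMean (u s) := fun s θ => by
    obtain ⟨D, hD, hDω⟩ := hD s θ
    refine ⟨Complex.reCLM.comp D, Complex.reCLM.hasFDerivAt.comp θ hD, ?_⟩
    rw [← ofReal_torusMean] at hDω
    simp [hDω]
  refine ⟨fun s θ => (g s θ).re, hg.re (by linarith), ?_, fun s θ => ?_, fun s θ => ?_,
    fun s hs θ => ?_⟩
  · unfold RWiener
    simpa only [ofReal_torusMean] using hm
  · obtain ⟨D, hD, -⟩ := key s θ
    exact hD.differentiableAt
  · obtain ⟨D, hD, hDω⟩ := key s θ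
    rw [dotProduct_partials, hD.fderiv, hDω]
  · simp [h0 s (fun θ => by simp [hs θ]) θ]

/-! ### Vector and matrix valued functions -/

/-- All components satisfy the weighted Fourier bound. -/
def VecWiener (ρ M : ℝ) (w : ℝ → Plane → Fin 2 → ℝ) : Prop :=
  ∀ i, RWiener ρ M fun s θ => w s θ i

/-- All entries satisfy the weighted Fourier bound. -/
def MatWiener (ρ M : ℝ) (A : ℝ → Plane → Matrix (Fin 2) (Fin 2) ℝ) : Prop :=
  ∀ i j, RWiener ρ M fun s θ => A s θ i j

section VecMat

variable {ρ ρ' M M' η δ : ℝ} {w w' : ℝ → Plane → Fin 2 → ℝ}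
  {A A' : ℝ → Plane → Matrix (Fin 2) (Fin 2) ℝ} {f : ℝ → Plane → Fin 2 → ℝ}

lemma VecWiener.mono (h : VecWiener ρ M w) (hρ : ρ' ≤ ρ) (hM : M ≤ M') : VecWiener ρ' M' w :=
  fun i => (h i).mono hρ hM

lemma VecWiener.add (h : VecWiener ρ M w) (h' : VecWiener ρ M' w') (hρ : 0 ≤ ρ) :
    VecWiener ρ (M + M') fun s θ => w s θ + w' s θ := fun i => (h i).add (h' i) hρ

lemma VecWiener.neg (h : VecWiener ρ M w) (hρ : 0 ≤ ρ) :
    VecWiener ρ M fun s θ => -w s θ := fun i => (h i).neg hρ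

lemma VecWiener.comp_sub (h : VecWiener ρ M w) (hf : VecWiener ρ' η f) (hρ' : 0 ≤ ρ')
    (hδ : 0 < δ) (hle : ρ' + η + δ ≤ ρ) :
    VecWiener ρ' (M * η / δ) fun s θ => w s (θ + f s θ) - w s θ :=
  fun i => (h i).comp_sub hf hρ' hδ hle

lemma VecWiener.dot (h : VecWiener ρ M w) (h' : VecWiener ρ M' w') (hρ : 0 ≤ ρ) :
    RWiener ρ (2 * M * M') fun s θ => w s θ ⬝ᵥ w' s θ := by
  have := ((h 0).mul (h' 0) hρ).add ((h 1).mul (h' 1) hρ) hρ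
  simp only [dotProduct, Fin.sum_univ_two]
  exact this.mono le_rfl (by linarith)

lemma MatWiener.mono (h : MatWiener ρ M A) (hρ : ρ' ≤ ρ) (hM : M ≤ M') : MatWiener ρ' M' A :=
  fun i j => (h i j).mono hρ hM

lemma MatWiener.add (h : MatWiener ρ M A) (h' : MatWiener ρ M' A') (hρ : 0 ≤ ρ) :
    MatWiener ρ (M + M') fun s θ => A s θ + A' s θ := fun i j => (h i j).add (h' i j) hρ

lemma MatWiener.transpose (h : MatWiener ρ M A) : MatWiener ρ M fun s θ => (A s θ)ᵀ :=
  fun i j => h j i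

lemma MatWiener.comp (h : MatWiener ρ M A) (hf : VecWiener ρ' η f) (hρ' : 0 ≤ ρ')
    (hle : ρ' + η ≤ ρ) : MatWiener ρ' M fun s θ => A s (θ + f s θ) :=
  fun i j => (h i j).comp hf hρ' hle

lemma MatWiener.comp_sub (h : MatWiener ρ M A) (hf : VecWiener ρ' η f) (hρ' : 0 ≤ ρ')
    (hδ : 0 < δ) (hle : ρ' + η + δ ≤ ρ) :
    MatWiener ρ' (M * η / δ) fun s θ => A s (θ + f s θ) - A s θ :=
  fun i j => (h i j).comp_sub hf hρ' hδ hle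

lemma MatWiener.mulVec (h : MatWiener ρ M A) (h' : VecWiener ρ M' w) (hρ : 0 ≤ ρ) :
    VecWiener ρ (2 * M * M') fun s θ => A s θ *ᵥ w s θ :=
  fun i => VecWiener.dot (w := fun s θ => A s θ i) (h i) h' hρ

lemma MatWiener.mul (h : MatWiener ρ M A) (h' : MatWiener ρ M' A') (hρ : 0 ≤ ρ) :
    MatWiener ρ (2 * M * M') fun s θ => A s θ * A' s θ := fun i j => by
  simpa only [Matrix.mul_apply, dotProduct] using
    VecWiener.dot (w := fun s θ => A s θ i) (w' := fun s θ l => A' s θ l j) (h i)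
      (fun l => h' l j) hρ

/-- The adjugate formula for `2 × 2` matrices: only the scalar determinant `1 + d` has to be
inverted, by a geometric series, and `M ≤ 1/16` keeps `|d| ≤ 3M` below `1/2`. -/
lemma MatWiener.exists_inv_one_add (h : MatWiener ρ M A) (hρ : 0 ≤ ρ) (hM : M ≤ 1 / 16) :
    ∃ Ai : ℝ → Plane → Matrix (Fin 2) (Fin 2) ℝ, (∀ s θ, Ai s θ * (1 + A s θ) = 1) ∧
      MatWiener ρ (8 * M) fun s θ => Ai s θ - 1 := by
  have hM0 := (h 0 0).nonneg
  have hdet : RWiener ρ (3 * M) fun s θ =>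
      A s θ 0 0 + A s θ 1 1 + (A s θ 0 0 * A s θ 1 1 - A s θ 0 1 * A s θ 1 0) :=
    (((h 0 0).add (h 1 1) hρ).add (((h 0 0).mul (h 1 1) hρ).sub ((h 0 1).mul (h 1 0) hρ) hρ)
      hρ).mono le_rfl (by nlinarith)
  have hdet1 := hdet.inv_one_add hρ (by linarith)
  set d : ℝ → Plane → ℝ := fun s θ =>
      A s θ 0 0 + A s θ 1 1 + (A s θ 0 0 * A s θ 1 1 - A s θ 0 1 * A s θ 1 0) with hd
  have hd_ne : ∀ s θ, 1 + d s θ ≠ 0 := fun s θ => by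
    have := (abs_le.1 (hdet.abs_le hρ s θ)).1
    linarith
  refine ⟨fun s θ => (1 + d s θ)⁻¹ • !![1 + A s θ 1 1, -A s θ 0 1; -A s θ 1 0, 1 + A s θ 0 0],
    fun s θ => ?_, ?_⟩
  · have h1 := hd_ne s θ
    rw [Matrix.smul_mul, inv_smul_eq_iff₀ h1]
    ext i j
    fin_cases i <;> fin_cases j <;>
      simp [Matrix.mul_apply, Fin.sum_univ_two, hd] <;> ring
  · have key : ∀ u : ℝ → Plane → ℝ, RWiener ρ M u →
        RWiener ρ (8 * M) fun s θ => (1 + d s θ)⁻¹ * u s θ := fun u hu => by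
      have := ((hdet1.mul hu hρ).add hu hρ).mono (le_refl ρ) (M' := 8 * M) (by nlinarith)
      convert this using 3
      ring
    have key1 : ∀ u : ℝ → Plane → ℝ, RWiener ρ M u →
        RWiener ρ (8 * M) fun s θ => (1 + d s θ)⁻¹ * (1 + u s θ) - 1 := fun u hu => by
      have := ((hdet1.mul hu hρ).add (hu.add hdet1 hρ) hρ).mono (le_refl ρ) (M' := 8 * M)
        (by nlinarith)
      convert this using 3
      ring
    intro i j
    fin_cases i <;> fin_cases j
    · simpa using key1 _ (h 1 1)
    · simpa using (key _ (h 0 1)).neg hρ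
    · simpa using (key _ (h 1 0)).neg hρ
    · simpa using key1 _ (h 0 0)

lemma torusMean_eq_zero {u : Plane → ℝ} (h : ∀ θ, u θ = 0) : torusMean u = 0 := by
  simp [torusMean, torusIntegral, h]

lemma VecWiener.exists_cohomological {ω : Fin 2 → ℝ} {N : ℕ} {C : ℝ}
    (hω : SmallDivisorBound ω N C) (hC : 0 ≤ C) (hw : VecWiener ρ M w) (hδ : 0 < δ)
    (hδρ : δ ≤ ρ) :
    ∃ g : ℝ → Plane → Fin 2 → ℝ, VecWiener (ρ - δ) (C / δ ^ N * M) g ∧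
      VecWiener ρ M (fun s _ i => torusMean fun θ => w s θ i) ∧
      (∀ s i, Differentiable ℝ fun θ => g s θ i) ∧
      (∀ s θ i, ω ⬝ᵥ partials (fun θ => g s θ i) θ = w s θ i - torusMean fun θ => w s θ i) ∧
      ∀ s, (∀ θ, w s θ = 0) → ∀ θ, g s θ = 0 := by
  choose g hg hm hd hdω h0 using fun i => (hw i).exists_cohomological hω hC hδ hδρ
  exact ⟨fun s θ i => g i s θ, hg, hm, fun s i => hd i s, fun s θ i => hdω i s θ,
    fun s h θ => funext fun i => h0 i s (fun θ => by simp [h θ]) θ⟩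

end VecMat

/-! ### One step of the Newton scheme: solving the linearized equations -/

/-- The Jacobian matrix of a map of the plane. -/
def jacobian (f : Plane → Fin 2 → ℝ) (θ : Plane) : Matrix (Fin 2) (Fin 2) ℝ :=
  Matrix.of fun i j => partials (fun y => f y i) θ j

lemma jacobian_mulVec (f : Plane → Fin 2 → ℝ) (θ : Plane) (ω : Fin 2 → ℝ) (i : Fin 2) :
    (jacobian f θ *ᵥ ω) i = ω ⬝ᵥ partials (fun y => f y i) θ := by
  rw [dotProduct_comm]; rfl

lemma partials_zero (θ : Plane) : partials (fun _ => 0) θ = 0 := by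
  ext i; simp [partials]

lemma partials_neg (f : Plane → ℝ) (θ : Plane) : partials (fun y => -f y) θ = -partials f θ := by
  ext i; simp [partials, fderiv_fun_neg]

lemma partials_add {f g : Plane → ℝ} {θ : Plane} (hf : DifferentiableAt ℝ f θ)
    (hg : DifferentiableAt ℝ g θ) :
    partials (fun y => f y + g y) θ = partials f θ + partials g θ := by
  ext i; simp [partials, fderiv_fun_add hf hg]

lemma partials_const_mul {f : Plane → ℝ} {θ : Plane} (a : ℝ) (hf : DifferentiableAt ℝ f θ) :
    partials (fun y => a * f y) θ = a • partials f θ := by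
  ext i; simp [partials, fderiv_const_mul hf a]

/-- The solution of the linearized equations, with bounds. -/
lemma exists_newton_correction {ω : Fin 2 → ℝ} {N : ℕ} {C B ρ δ ε : ℝ}
    {P : ℝ → Plane → Matrix (Fin 2) (Fin 2) ℝ} {Q : ℝ → Matrix (Fin 2) (Fin 2) ℝ}
    {e₁ : ℝ → Plane → Fin 2 → ℝ} {e₂ : ℝ → Plane → ℝ}
    (hω : SmallDivisorBound ω N C) (hC : 1 ≤ C) (hB : 1 ≤ B) (hδ : 0 < δ) (hδ1 : δ ≤ 1)
    (hδρ : 4 * δ ≤ ρ) (hP : MatWiener ρ B P) (hQ : MatWiener ρ B fun s _ => Q s)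
    (hPQ : ∀ s, (Matrix.of fun i j => torusMean fun θ => P s θ i j) * Q s = 1)
    (he₁ : VecWiener ρ ε e₁) (he₂ : RWiener ρ ε e₂)
    {E : ℝ} (hE : E = C * B / δ ^ (N + 1)) :
    ∃ (H : ℝ → Plane → ℝ) (a : ℝ → Fin 2 → ℝ) (f : ℝ → Plane → Fin 2 → ℝ),
      RWiener (ρ - δ) (E * ε) H ∧ VecWiener (ρ - 2 * δ) (E * ε) (fun s => partials (H s)) ∧
      VecWiener (ρ - 2 * δ) (6 * E ^ 3 * ε) (fun s _ => a s) ∧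
      VecWiener (ρ - 3 * δ) (15 * E ^ 4 * ε) f ∧
      MatWiener (ρ - 4 * δ) (15 * E ^ 5 * ε) (fun s => jacobian (f s)) ∧
      (∀ s θ, jacobian (f s) θ *ᵥ ω = e₁ s θ + P s θ *ᵥ (partials (H s) θ + a s)) ∧
      (∀ s θ, ω ⬝ᵥ partials (H s) θ = torusMean (e₂ s) - e₂ s θ) ∧
      (∀ s i, Differentiable ℝ fun θ => f s θ i) ∧ 
      ∀ s, (∀ θ, e₁ s θ = 0) → (∀ θ, e₂ s θ = 0) →
        (∀ θ, H s θ = 0) ∧ a s = 0 ∧ ∀ θ, f s θ = 0 := by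
  have hε := he₂.nonneg
  -- The single constant `E` dominates `B`, `1/δ`, `C/δ^N` and `C/δ^(N+1)`, so all later bounds are
  -- powers of `E` times `ε`.
  have hCN : C / δ ^ N * B ≤ E := by
    rw [hE, div_mul_eq_mul_div, pow_succ, ← div_div, le_div_iff₀ hδ]
    exact mul_le_of_le_one_right (by positivity) hδ1
  have hCN1 : C / δ ^ N ≤ E := (le_mul_of_one_le_right (by positivity) hB).trans hCN
  have hBE : B ≤ E := by
    refine le_trans ?_ hCN
    refine le_mul_of_one_le_left (by linarith) ?_
    rw [one_le_div (by positivity)]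
    exact (pow_le_one₀ hδ.le hδ1).trans hC
  have hE1 : 1 ≤ E := hB.trans hBE
  have hdE : 1 / δ ≤ E := by
    rw [hE, div_le_div_iff₀ hδ (by positivity), one_mul, pow_succ]
    have h1 : δ ^ N ≤ 1 := pow_le_one₀ hδ.le hδ1
    have h2 : 1 ≤ C * B := one_le_mul_of_one_le_of_one_le hC hB
    exact mul_le_mul (h1.trans h2) le_rfl hδ.le (by positivity)
  have hCNd : C / δ ^ N / δ ≤ E := by
    rw [hE, div_div, ← pow_succ]
    gcongr
    exact le_mul_of_one_le_right (by linarith) hB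
  have h12 : E ≤ E ^ 2 := le_self_pow₀ hE1 two_ne_zero
  have h13 : E ≤ E ^ 3 := le_self_pow₀ hE1 three_ne_zero
  have h24 : E ^ 2 ≤ E ^ 4 := pow_le_pow_right₀ hE1 (by norm_num)
  have h34 : E ^ 3 ≤ E ^ 4 := pow_le_pow_right₀ hE1 (by norm_num)
  have hEE : 1 ≤ E ^ 2 := one_le_pow₀ hE1
  -- The system is triangular: the energy equation determines `H = -g₂` first, since the constant
  -- `a` changes the energy at first order only by the constant `ω · a`.
  obtain ⟨g₂, hg₂, -, hg₂d, hg₂ω, hg₂0⟩ := he₂.exists_cohomological hω (by linarith) hδ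
    (by linarith)
  have hdg₂ : VecWiener (ρ - 2 * δ) (E * ε) fun s => partials fun θ => -g₂ s θ := fun i => by
    have := (hg₂.neg (by linarith)).partials hδ (by linarith) i
    refine this.mono (by linarith) ?_
    calc C / δ ^ N * ε / δ = C / δ ^ N / δ * ε := by ring
      _ ≤ _ := by gcongr
  have hr : VecWiener (ρ - 2 * δ) (3 * E ^ 2 * ε)
      fun s θ => e₁ s θ + P s θ *ᵥ partials (fun θ => -g₂ s θ) θ := by
    refine ((he₁.mono (by linarith) le_rfl).add ((hP.mono (by linarith) hBE).mulVec hdg₂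
      (by linarith)) (by linarith)).mono le_rfl ?_
    nlinarith
  set r : ℝ → Plane → Fin 2 → ℝ :=
    fun s θ => e₁ s θ + P s θ *ᵥ partials (fun θ => -g₂ s θ) θ with hr_def
  obtain ⟨g, hg, hmr, hgd, hgω, hg0⟩ := hr.exists_cohomological hω (by linarith) hδ (by linarith)
  choose p hp hPm hpd hpω hp0 using
    fun i j => (hP i j).exists_cohomological hω (by linarith) hδ (by linarith)
  -- The choice of `a` gives `e₁ + P(∂H + a)` zero mean. This is the only use of the invertibility
  -- of the mean of `P`.
  set a : ℝ → Fin 2 → ℝ := fun s => -(Q s *ᵥ fun i => torusMean fun θ => r s θ i) with ha_def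
  have ha : VecWiener (ρ - 2 * δ) (6 * E ^ 3 * ε) fun s _ => a s := by
    refine (((hQ.mono (by linarith) hBE).mulVec hmr (by linarith)).neg (by linarith)).mono
      le_rfl ?_
    exact le_of_eq (by ring)
  -- Here `g` and `p` are the primitives along `ω` of `r` and of `P`, minus their means. In `g + p
  -- a` the two mean terms cancel by the choice of `a`.
  set f : ℝ → Plane → Fin 2 → ℝ := fun s θ => g s θ + (Matrix.of fun i j => p i j s θ) *ᵥ a s
    with hf_def
  have hpE : MatWiener (ρ - 3 * δ) E fun s θ => Matrix.of fun i j => p i j s θ := fun i j =>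
    (hp i j).mono (by linarith) hCN
  have hf : VecWiener (ρ - 3 * δ) (15 * E ^ 4 * ε) f := by
    refine ((hg.mono (by linarith) le_rfl).add (hpE.mulVec (ha.mono (by linarith) le_rfl)
      (by linarith)) (by linarith)).mono le_rfl ?_
    have h1 : C / δ ^ N * (3 * E ^ 2 * ε) ≤ E * (3 * E ^ 2 * ε) := by gcongr
    have h2 : E ^ 3 * ε ≤ E ^ 4 * ε := by gcongr
    nlinarith
  have hfi : ∀ s i, (fun θ => f s θ i) =
      fun θ => g s θ i + (a s 0 * p i 0 s θ + a s 1 * p i 1 s θ) := fun s i => by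
    funext θ
    simp only [hf_def, Pi.add_apply, Matrix.mulVec, dotProduct, Fin.sum_univ_two, Matrix.of_apply]
    ring
  have hfd : ∀ s i, Differentiable ℝ fun θ => f s θ i := fun s i => by
    rw [hfi]
    exact (hgd s i).fun_add (((hpd i 0 s).const_mul _).fun_add ((hpd i 1 s).const_mul _))
  refine ⟨fun s θ => -g₂ s θ, a, f, (hg₂.neg (by linarith)).mono le_rfl (by gcongr), hdg₂, ha, hf,
    fun i j => ?_, fun s θ => ?_, fun s θ => ?_, hfd, fun s h1 h2 => ?_⟩
  · have := (hf i).partials hδ (by linarith) j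
    refine this.mono (by linarith) ?_
    calc 15 * E ^ 4 * ε / δ = 15 * E ^ 4 * ε * (1 / δ) := by ring
      _ ≤ 15 * E ^ 4 * ε * E := by gcongr
      _ = _ := by ring
  · ext i
    rw [jacobian_mulVec, hfi, partials_add (hgd s i θ)
      (((hpd i 0 s θ).const_mul _).fun_add ((hpd i 1 s θ).const_mul _)),
      partials_add ((hpd i 0 s θ).const_mul _) ((hpd i 1 s θ).const_mul _),
      partials_const_mul _ (hpd i 0 s θ), partials_const_mul _ (hpd i 1 s θ), dotProduct_add,
      dotProduct_add, dotProduct_smul, dotProduct_smul, hgω, hpω, hpω, Matrix.mulVec_add]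
    have hPa : (Matrix.of fun i j => torusMean fun θ => P s θ i j) *ᵥ a s =
        -fun i => torusMean fun θ => r s θ i := by
      rw [ha_def, Matrix.mulVec_neg, Matrix.mulVec_mulVec, hPQ, Matrix.one_mulVec]
    have hPai := congrFun hPa i
    simp only [Matrix.mulVec, dotProduct, Fin.sum_univ_two, Matrix.of_apply, Pi.neg_apply] at hPai
    simp only [hr_def, Matrix.mulVec, dotProduct, Fin.sum_univ_two, Pi.add_apply,
      smul_eq_mul] at hPai ⊢
    linarith
  · rw [partials_neg, dotProduct_neg, hg₂ω]; ring
  · have hg : ∀ θ, g₂ s θ = 0 := hg₂0 s h2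
    have hr0 : ∀ θ, r s θ = 0 := fun θ => by
      simp [hr_def, h1 θ, hg, partials_zero]
    have ha0 : a s = 0 := by
      have : (fun i => torusMean fun θ => r s θ i) = 0 :=
        funext fun i => torusMean_eq_zero fun θ => by simp [hr0]
      rw [ha_def]
      simp only [this, Matrix.mulVec_zero, neg_zero]
    exact ⟨fun θ => by simp [hg θ], ha0, fun θ => by simp [hf_def, ha0, hg0 s hr0 θ]⟩

/-! ### Approximate invariant tori -/

/-- A candidate for a family of invariant tori: the torus `θ ↦ θ + v`, the closed form `dh + α` that
is added to the given one, the dual metric `P` in the coordinates of the torus, and the errors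
`e₁` in the frequency and `e₂` in the energy. -/
structure ApproxTorus where
  v : ℝ → Plane → Fin 2 → ℝ
  h : ℝ → Plane → ℝ
  α : ℝ → Fin 2 → ℝ
  P : ℝ → Plane → Matrix (Fin 2) (Fin 2) ℝ
  e₁ : ℝ → Plane → Fin 2 → ℝ
  e₂ : ℝ → Plane → ℝ

lemma partials_comp {g : Plane → ℝ} {f : Plane → Fin 2 → ℝ} {θ : Plane}
    (hg : DifferentiableAt ℝ g (θ + f θ)) (hf : ∀ i, DifferentiableAt ℝ (fun y => f y i) θ) :
    partials (fun y => g (y + f y)) θ = (1 + jacobian f θ)ᵀ *ᵥ partials g (θ + f θ) := by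
  have hf' : DifferentiableAt ℝ f θ := differentiableAt_pi.2 hf
  have h1 : HasFDerivAt (fun y => y + f y) (ContinuousLinearMap.id ℝ Plane + fderiv ℝ f θ) θ :=
    (hasFDerivAt_id θ).add hf'.hasFDerivAt
  have h2 := hg.hasFDerivAt.comp θ h1
  ext i
  have h3 : partials (fun y => g (y + f y)) θ i =
      fderiv ℝ g (θ + f θ) (Pi.single i 1 + fderiv ℝ f θ (Pi.single i 1)) := by
    simp only [partials]
    rw [show (fun y => g (y + f y)) = g ∘ fun y => y + f y from rfl, h2.fderiv]
    simp
  have h4 : ∀ l, fderiv ℝ f θ (Pi.single i 1) l = jacobian f θ l i := fun l => by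
    simp only [jacobian, Matrix.of_apply, partials]
    rw [(hasFDerivAt_pi'.1 hf'.hasFDerivAt l).fderiv]
    rfl
  rw [h3, ← dotProduct_partials, Matrix.mulVec]
  simp only [dotProduct, Fin.sum_univ_two, Pi.add_apply, h4, Matrix.transpose_apply,
    Matrix.add_apply, Matrix.one_apply, Pi.single_apply]

lemma partials_dot_const {f : Plane → Fin 2 → ℝ} {θ : Plane} (a : Fin 2 → ℝ)
    (hf : ∀ i, DifferentiableAt ℝ (fun y => f y i) θ) :
    partials (fun y => a ⬝ᵥ f y) θ = (jacobian f θ)ᵀ *ᵥ a := by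
  simp only [dotProduct, Fin.sum_univ_two]
  rw [partials_add ((hf 0).const_mul _) ((hf 1).const_mul _), partials_const_mul _ (hf 0),
    partials_const_mul _ (hf 1)]
  ext i
  simp [jacobian, Matrix.mulVec, dotProduct, Fin.sum_univ_two]
  ring

lemma one_add_jacobian_comp {f w : Plane → Fin 2 → ℝ} {θ : Plane}
    (hw : ∀ i, DifferentiableAt ℝ (fun y => w y i) (θ + f θ))
    (hf : ∀ i, DifferentiableAt ℝ (fun y => f y i) θ) :
    1 + jacobian (fun y => f y + w (y + f y)) θ =
      (1 + jacobian w (θ + f θ)) * (1 + jacobian f θ) := by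
  have hf' : DifferentiableAt ℝ f θ := differentiableAt_pi.2 hf
  ext i j
  have h1 : jacobian (fun y => f y + w (y + f y)) θ i =
      jacobian f θ i + (1 + jacobian f θ)ᵀ *ᵥ jacobian w (θ + f θ) i := by
    have h2 : DifferentiableAt ℝ (fun y => w (y + f y) i) θ :=
      (hw i).comp (f := fun y => y + f y) θ (differentiableAt_id.add hf')
    have : jacobian (fun y => f y + w (y + f y)) θ i =
        partials (fun y => f y i + w (y + f y) i) θ := rfl
    rw [this, partials_add (hf i) h2, partials_comp (hw i) hf]
    rfl
  rw [Matrix.add_apply, h1]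
  simp only [Matrix.mul_apply, Matrix.mulVec, dotProduct, Matrix.transpose_apply, Pi.add_apply,
    Matrix.add_apply, Fin.sum_univ_two, Matrix.one_apply]
  fin_cases i <;> fin_cases j <;> simp <;> ring

namespace ApproxTorus

variable {P₀ : Plane → Matrix (Fin 2) (Fin 2) ℝ} {Y : Plane → Fin 2 → ℝ} {U : ℝ → Plane → ℝ}
  {ω : Fin 2 → ℝ}

/-- The closed form of the candidate, in the coordinates of the torus. -/
def form (X : ApproxTorus) (Y : Plane → Fin 2 → ℝ) (s : ℝ) (θ : Plane) : Fin 2 → ℝ :=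
  (1 + jacobian (X.v s) θ)ᵀ *ᵥ Y (θ + X.v s θ) + partials (X.h s) θ + X.α s

/-- The equations of an invariant torus of frequency `ω` hold up to the errors. -/
structure Solves (X : ApproxTorus) (P₀ : Plane → Matrix (Fin 2) (Fin 2) ℝ)
    (Y : Plane → Fin 2 → ℝ) (U : ℝ → Plane → ℝ) (ω : Fin 2 → ℝ) : Prop where
  diff_v : ∀ s i, Differentiable ℝ fun θ => X.v s θ i
  diff_h : ∀ s, Differentiable ℝ (X.h s)
  symm : ∀ s θ, (X.P s θ)ᵀ = X.P s θ
  conj : ∀ s θ, (1 + jacobian (X.v s) θ) * X.P s θ * (1 + jacobian (X.v s) θ)ᵀ =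
    P₀ (θ + X.v s θ)
  freq : ∀ s θ, X.P s θ *ᵥ X.form Y s θ = ω + X.e₁ s θ
  energy : ∃ k : ℝ → ℝ, ∀ s θ, X.form Y s θ ⬝ᵥ (X.P s θ *ᵥ X.form Y s θ) =
    U s (θ + X.v s θ) + 2 * X.e₂ s θ + k s
  zero : X.v 0 = 0 ∧ X.h 0 = 0 ∧ X.α 0 = 0 ∧ X.e₁ 0 = 0 ∧ X.e₂ 0 = 0

/-- The increment of the frequency when the form changes by `dH + a`. -/
def shift (X : ApproxTorus) (H : ℝ → Plane → ℝ) (a : ℝ → Fin 2 → ℝ) (s : ℝ) (θ : Plane) :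
    Fin 2 → ℝ :=
  X.e₁ s θ + X.P s θ *ᵥ (partials (H s) θ + a s)

/-- The quadratic part of the change of the energy when the form changes by `dH + a`. -/
def energyShift (X : ApproxTorus) (H : ℝ → Plane → ℝ) (a : ℝ → Fin 2 → ℝ) (s : ℝ)
    (θ : Plane) : ℝ :=
  X.e₁ s θ ⬝ᵥ (partials (H s) θ + a s) +
    1 / 2 * ((partials (H s) θ + a s) ⬝ᵥ (X.P s θ *ᵥ (partials (H s) θ + a s)))

/-- The form is changed by `dH + a`, then the torus is reparametrized by `θ ↦ θ + f`. -/
def step (X : ApproxTorus) (H : ℝ → Plane → ℝ) (a : ℝ → Fin 2 → ℝ) (f : ℝ → Plane → Fin 2 → ℝ)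
    (Ai : ℝ → Plane → Matrix (Fin 2) (Fin 2) ℝ) : ApproxTorus where
  v s θ := f s θ + X.v s (θ + f s θ)
  h s θ := X.h s (θ + f s θ) + H s (θ + f s θ) + (X.α s + a s) ⬝ᵥ f s θ
  α s := X.α s + a s
  P s θ := Ai s θ * X.P s (θ + f s θ) * (Ai s θ)ᵀ
  e₁ s θ := Ai s θ *ᵥ (X.shift H a s (θ + f s θ) - X.shift H a s θ)
  e₂ s θ := X.energyShift H a s (θ + f s θ)

/-- Adding `dH + a` changes the frequency to `ω + z`, with `z` the `shift`, and leaves a quadratic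
`energyShift` besides a constant. Since `Df ω = z`, the reparametrization by `id + f` sends `ω` at
`θ` to `ω + z(θ)`, so only the difference `z(θ + f) - z(θ)` survives in the frequency error. These
are exact identities. Smallness is used only in the estimates. -/
lemma Solves.step {X : ApproxTorus} (hX : X.Solves P₀ Y U ω) {H : ℝ → Plane → ℝ}
    {a : ℝ → Fin 2 → ℝ} {f : ℝ → Plane → Fin 2 → ℝ}
    {Ai : ℝ → Plane → Matrix (Fin 2) (Fin 2) ℝ} (hH : ∀ s, Differentiable ℝ (H s))
    (hf : ∀ s i, Differentiable ℝ fun θ => f s θ i)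
    (hAi : ∀ s θ, Ai s θ * (1 + jacobian (f s) θ) = 1)
    (hfω : ∀ s θ, jacobian (f s) θ *ᵥ ω = X.shift H a s θ) {m : ℝ → ℝ}
    (hHω : ∀ s θ, ω ⬝ᵥ partials (H s) θ = m s - X.e₂ s θ)
    (hH0 : H 0 = 0) (ha0 : a 0 = 0) (hf0 : f 0 = 0) : (X.step H a f Ai).Solves P₀ Y U ω := by
  have hfd : ∀ s, Differentiable ℝ (f s) := fun s => differentiable_pi.2 (hf s)
  have hΦ : ∀ s, Differentiable ℝ fun θ => θ + f s θ := fun s => differentiable_id.add (hfd s)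
  have hJ : ∀ s θ, 1 + jacobian ((X.step H a f Ai).v s) θ =
      (1 + jacobian (X.v s) (θ + f s θ)) * (1 + jacobian (f s) θ) := fun s θ =>
    one_add_jacobian_comp (fun i => hX.diff_v s i _) (fun i => hf s i θ)
  have hx : ∀ s θ, θ + (X.step H a f Ai).v s θ = θ + f s θ + X.v s (θ + f s θ) := fun s θ => by
    simp [ApproxTorus.step, add_assoc]
  -- The new form is the pullback of the old one plus `dH + a` under `id + f`. A constant form `α +
  -- a` pulls back to itself plus `d((α + a) · f)`, which explains the last term of `h` in
  -- `ApproxTorus.step`.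
  have hform : ∀ s θ, (X.step H a f Ai).form Y s θ = (1 + jacobian (f s) θ)ᵀ *ᵥ
      (X.form Y s (θ + f s θ) + (partials (H s) (θ + f s θ) + a s)) := fun s θ => by
    have h1 : partials ((X.step H a f Ai).h s) θ =
        (1 + jacobian (f s) θ)ᵀ *ᵥ partials (X.h s) (θ + f s θ) +
        (1 + jacobian (f s) θ)ᵀ *ᵥ partials (H s) (θ + f s θ) +
        (jacobian (f s) θ)ᵀ *ᵥ (X.α s + a s) := by
      have c1 : DifferentiableAt ℝ (fun y => X.h s (y + f s y)) θ := ((hX.diff_h s).comp (hΦ s)) θ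
      have c2 : DifferentiableAt ℝ (fun y => H s (y + f s y)) θ := ((hH s).comp (hΦ s)) θ
      have c3 : DifferentiableAt ℝ (fun y => (X.α s + a s) ⬝ᵥ f s y) θ := by
        simp only [dotProduct, Fin.sum_univ_two]
        exact ((hf s 0 θ).const_mul _).fun_add ((hf s 1 θ).const_mul _)
      rw [← partials_comp (hX.diff_h s _) (fun i => hf s i θ),
        ← partials_comp (hH s _) (fun i => hf s i θ), ← partials_dot_const _ (fun i => hf s i θ),
        ← partials_add c1 c2, ← partials_add (c1.fun_add c2) c3]
      rfl
    have hα : (X.step H a f Ai).α s = X.α s + a s := rfl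
    rw [form, hJ, hx, h1, hα, Matrix.transpose_mul, form]
    simp only [Matrix.mulVec_add, Matrix.transpose_add, Matrix.add_mulVec, Matrix.transpose_one,
      Matrix.one_mulVec, ← Matrix.mulVec_mulVec]
    abel
  have hAi' : ∀ s θ, (Ai s θ)ᵀ * (1 + jacobian (f s) θ)ᵀ = 1 := fun s θ => by
    rw [← Matrix.transpose_mul, mul_eq_one_comm.1 (hAi s θ), Matrix.transpose_one]
  have hPform : ∀ s θ, (X.step H a f Ai).P s θ *ᵥ (X.step H a f Ai).form Y s θ =
      Ai s θ *ᵥ (ω + X.shift H a s (θ + f s θ)) := fun s θ => by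
    rw [hform, Matrix.mulVec_mulVec]
    have : (X.step H a f Ai).P s θ * (1 + jacobian (f s) θ)ᵀ = Ai s θ * X.P s (θ + f s θ) := by
      simp only [ApproxTorus.step]
      rw [Matrix.mul_assoc, hAi', Matrix.mul_one]
    rw [this, ← Matrix.mulVec_mulVec, Matrix.mulVec_add, hX.freq, shift, add_assoc]
  refine ⟨fun s i => ?_, fun s => ?_, fun s θ => ?_, fun s θ => ?_, fun s θ => ?_, ?_, ?_⟩
  · exact (hf s i).fun_add ((hX.diff_v s i).comp (hΦ s))
  · have h1 : Differentiable ℝ fun θ => (X.α s + a s) ⬝ᵥ f s θ := by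
      simp only [dotProduct, Fin.sum_univ_two]
      exact ((hf s 0).const_mul _).fun_add ((hf s 1).const_mul _)
    exact (((hX.diff_h s).comp (hΦ s)).fun_add ((hH s).comp (hΦ s))).fun_add h1
  · simp [ApproxTorus.step, Matrix.transpose_mul, hX.symm, Matrix.mul_assoc]
  · rw [hJ, hx, ← hX.conj, Matrix.transpose_mul]
    simp only [ApproxTorus.step]
    calc _ = (1 + jacobian (X.v s) (θ + f s θ)) * (((1 + jacobian (f s) θ) * Ai s θ) *
          X.P s (θ + f s θ) * ((Ai s θ)ᵀ * (1 + jacobian (f s) θ)ᵀ)) *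
          (1 + jacobian (X.v s) (θ + f s θ))ᵀ := by simp only [Matrix.mul_assoc]
      _ = _ := by
        rw [hAi', mul_eq_one_comm.1 (hAi s θ), Matrix.one_mul, Matrix.mul_one]
  · rw [hPform]
    -- The linearized frequency equation in the form `(1 + Df) ω = ω + z`.
    have h1 : Ai s θ *ᵥ (ω + X.shift H a s θ) = ω := by
      rw [← hfω]
      have : ω + jacobian (f s) θ *ᵥ ω = (1 + jacobian (f s) θ) *ᵥ ω := by
        rw [Matrix.add_mulVec, Matrix.one_mulVec]
      rw [this, Matrix.mulVec_mulVec, hAi, Matrix.one_mulVec]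
    simp only [ApproxTorus.step]
    conv_rhs => rw [← h1]
    rw [← Matrix.mulVec_add]
    congr 1
    abel
  · obtain ⟨k, hk⟩ := hX.energy
    -- The linear part of the change of energy is `2(ω + e₁) · (∂H + a)`. Its part `2ω · ∂H` cancels
    -- `2 e₂` up to `2m`, and `2ω · a` is independent of `θ`, so both constants go into `k`.
    refine ⟨fun s => k s + 2 * m s + 2 * (ω ⬝ᵥ a s), fun s θ => ?_⟩
    rw [hPform, hform, hx]
    set y := θ + f s θ
    set η := partials (H s) y + a s with hη
    -- The pairing of a form with a vector is unchanged when both are pulled back.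
    have h1 : ((1 + jacobian (f s) θ)ᵀ *ᵥ (X.form Y s y + η)) ⬝ᵥ
        (Ai s θ *ᵥ (ω + X.shift H a s y)) = (X.form Y s y + η) ⬝ᵥ (ω + X.shift H a s y) := by
      rw [Matrix.dotProduct_mulVec, ← Matrix.mulVec_transpose, Matrix.mulVec_mulVec, hAi',
        Matrix.one_mulVec]
    rw [h1]
    have h2 : X.form Y s y ⬝ᵥ (X.P s y *ᵥ η) = (ω + X.e₁ s y) ⬝ᵥ η := by
      rw [Matrix.dotProduct_mulVec, ← Matrix.mulVec_transpose, hX.symm, hX.freq]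
    have h3 : X.form Y s y ⬝ᵥ (ω + X.e₁ s y) = U s (y + X.v s y) + 2 * X.e₂ s y + k s := by
      rw [← hX.freq, hk]
    have h4 : ω ⬝ᵥ η = m s - X.e₂ s y + ω ⬝ᵥ a s := by
      rw [hη, dotProduct_add, hHω]
    have h5 : (X.step H a f Ai).e₂ s θ = X.e₁ s y ⬝ᵥ η + 1 / 2 * (η ⬝ᵥ (X.P s y *ᵥ η)) := rfl
    have h6 : X.shift H a s y = X.e₁ s y + X.P s y *ᵥ η := rfl
    rw [h5, h6, ← add_assoc ω, add_dotProduct _ η, dotProduct_add _ _ (X.P s y *ᵥ η),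
      dotProduct_add _ _ (X.P s y *ᵥ η), h2, h3, dotProduct_comm η (ω + _), add_dotProduct, h4]
    ring
  · obtain ⟨hv, hh, hα, h1, -⟩ := hX.zero
    have hp0 : ∀ θ, partials 0 θ = 0 := partials_zero
    refine ⟨?_, ?_, ?_, ?_, ?_⟩ <;> (try funext θ) <;>
      simp [ApproxTorus.step, shift, energyShift, hv, hh, hα, h1, hH0, ha0, hf0, hp0]

end ApproxTorus

namespace ApproxTorus

variable {P₀ : Plane → Matrix (Fin 2) (Fin 2) ℝ} {Y : Plane → Fin 2 → ℝ} {U : ℝ → Plane → ℝ}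
  {ω : Fin 2 → ℝ}

/-- All components of the difference of two candidates are bounded by `κ`. -/
structure DistLE (X X' : ApproxTorus) (ρ κ : ℝ) : Prop where
  v : VecWiener ρ κ fun s θ => X'.v s θ - X.v s θ
  h : RWiener ρ κ fun s θ => X'.h s θ - X.h s θ
  α : VecWiener ρ κ fun s _ => X'.α s - X.α s
  P : MatWiener ρ κ fun s θ => X'.P s θ - X.P s θ

/-- One step of the Newton scheme, with the quadratic bound of the error. -/
lemma Solves.exists_newton_step {X : ApproxTorus} (hX : X.Solves P₀ Y U ω) {N : ℕ}
    {C B ρ δ ε E κ : ℝ} {Q : ℝ → Matrix (Fin 2) (Fin 2) ℝ}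
    (hω : SmallDivisorBound ω N C) (hC : 1 ≤ C) (hB : 1 ≤ B) (hδ : 0 < δ) (hδ1 : δ ≤ 1)
    (hδρ : 4 * δ ≤ ρ) (hv : VecWiener ρ 1 X.v) (hh : RWiener ρ 1 X.h)
    (hα : VecWiener ρ 1 fun s _ => X.α s) (hP : MatWiener ρ B X.P)
    (hQ : MatWiener ρ B fun s _ => Q s)
    (hPQ : ∀ s, (Matrix.of fun i j => torusMean fun θ => X.P s θ i j) * Q s = 1)
    (he₁ : VecWiener ρ ε X.e₁) (he₂ : RWiener ρ ε X.e₂) (hE : E = C * B / δ ^ (N + 1))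
    (hκ : κ = 900 * E ^ 9 * ε) (hκ1 : κ ≤ 1) :
    ∃ X' : ApproxTorus, X'.Solves P₀ Y U ω ∧ X.DistLE X' (ρ - 4 * δ) κ ∧
      VecWiener (ρ - 4 * δ) (κ * ε) X'.e₁ ∧ RWiener (ρ - 4 * δ) (κ * ε) X'.e₂ := by
  obtain ⟨H, a, f, hH, hdH, ha, hf, hjf, hfω, hHω, hfd, hzero⟩ :=
    exists_newton_correction hω hC hB hδ hδ1 hδρ hP hQ hPQ he₁ he₂ hE
  have hε := he₂.nonneg
  have hBE : B ≤ E := by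
    rw [hE, mul_comm, mul_div_assoc]
    refine le_mul_of_one_le_right (by linarith) ?_
    rw [one_le_div (by positivity)]
    exact (pow_le_one₀ hδ.le hδ1).trans hC
  have hE1 : 1 ≤ E := hB.trans hBE
  have hE0 : 0 ≤ E := by linarith
  have hdE : 1 / δ ≤ E := by
    rw [hE, div_le_div_iff₀ hδ (by positivity), one_mul, pow_succ]
    have h1 : δ ^ N ≤ 1 := pow_le_one₀ hδ.le hδ1
    have h2 : 1 ≤ C * B := one_le_mul_of_one_le_of_one_le hC hB
    exact mul_le_mul (h1.trans h2) le_rfl hδ.le (by positivity)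
  have hpow : ∀ m n : ℕ, m ≤ n → E ^ m * ε ≤ E ^ n * ε := fun m n hmn => by gcongr
  have p39 := hpow 3 9 (by norm_num)
  have p49 := hpow 4 9 (by norm_num)
  have p59 := hpow 5 9 (by norm_num)
  have p69 := hpow 6 9 (by norm_num)
  have p19 := hpow 1 9 (by norm_num)
  have p34 := hpow 3 4 (by norm_num)
  have p13 := hpow 1 3 (by norm_num)
  have p45 := hpow 4 5 (by norm_num)
  rw [pow_one] at p19 p13
  set ρ' := ρ - 4 * δ with hρ'
  have hρ'0 : 0 ≤ ρ' := by linarith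
  -- the bound of the displacement is below the loss of domain
  have hfδ : 15 * E ^ 4 * ε ≤ δ := by
    have h1 : 1 ≤ E * δ := by rwa [div_le_iff₀ hδ] at hdE
    have h2 : 15 * E ^ 5 * ε ≤ 1 := by nlinarith
    nlinarith [mul_nonneg (pow_nonneg hE0 4) hε]
  have hf' : VecWiener ρ' (15 * E ^ 4 * ε) f := hf.mono (by linarith) le_rfl
  have hdiv : ∀ x, 0 ≤ x → x / δ ≤ x * E := fun x hx => by
    rw [div_eq_mul_one_div]; gcongr
  -- The condition `κ ≤ 1` gives `15 E⁵ ε ≤ 1/60`, which makes `1 + Df` invertible in the algebra.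
  obtain ⟨Ai, hAi, hAi1⟩ := hjf.exists_inv_one_add (A := fun s => jacobian (f s)) hρ'0
    (by nlinarith)
  have hone : MatWiener ρ' 1 fun _ _ => (1 : Matrix (Fin 2) (Fin 2) ℝ) := fun i j =>
    (RWiener.const ρ' _).mono le_rfl (by fin_cases i <;> fin_cases j <;> simp)
  have hAi2 : MatWiener ρ' 2 Ai := by
    have := (hAi1.add hone hρ'0).mono (le_refl _) (M' := 2) (by nlinarith)
    simpa using this
  have hη : VecWiener (ρ - 2 * δ) (7 * E ^ 3 * ε) fun s θ => partials (H s) θ + a s :=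
    (hdH.add ha (by linarith)).mono le_rfl (by nlinarith)
  have hz : VecWiener (ρ - 2 * δ) (15 * E ^ 4 * ε) (X.shift H a) := by
    refine ((he₁.mono (by linarith) le_rfl).add ((hP.mono (by linarith) hBE).mulVec hη
      (by linarith)) (by linarith)).mono le_rfl ?_
    have : ε ≤ E ^ 4 * ε := le_mul_of_one_le_left hε (one_le_pow₀ hE1)
    nlinarith
  have hq : RWiener (ρ - 2 * δ) (900 * E ^ 9 * ε * ε) (X.energyShift H a) := by
    refine (((he₁.mono (by linarith) le_rfl).dot hη (by linarith)).add
      ((hη.dot ((hP.mono (by linarith) hBE).mulVec hη (by linarith)) (by linarith)).const_mul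
        (by linarith) _) (by linarith)).mono le_rfl ?_
    rw [abs_of_pos (by norm_num : (0 : ℝ) < 1 / 2)]
    have h1 : E ^ 3 * ε * ε ≤ E ^ 9 * ε * ε := by gcongr
    have h2 : E ^ 7 * ε * ε ≤ E ^ 9 * ε * ε := by gcongr; norm_num
    have h3 : 0 ≤ E ^ 9 * ε * ε := by positivity
    linarith
  have hHd : ∀ s, Differentiable ℝ (H s) := fun s => hH.differentiable (by linarith) s
  obtain ⟨hv0, hh0, hα0, he10, he20⟩ := hX.zero
  -- At `s = 0` both errors vanish, so the corrections do too and the torus at `s = 0` is never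
  -- moved.
  obtain ⟨hH0, ha0, hf0⟩ := hzero 0 (fun θ => congrFun he10 θ) (fun θ => congrFun he20 θ)
  refine ⟨X.step H a f Ai, hX.step hHd hfd hAi hfω hHω (funext hH0) ha0 (funext hf0), ?_, ?_, ?_⟩
  · have hPf := (hP.mono (le_refl ρ) hBE).comp_sub hf' hρ'0 hδ (by linarith)
    have hPc := (hP.mono (le_refl ρ) hBE).comp hf' hρ'0 (by linarith)
    refine ⟨?_, ?_, ?_, ?_⟩
    · have := (hf'.add (hv.comp_sub hf' hρ'0 hδ (by linarith)) hρ'0).mono (le_refl _) (M' := κ) (by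
        have := hdiv (15 * E ^ 4 * ε) (by positivity)
        rw [one_mul]
        nlinarith)
      convert this using 3 with s θ
      simp [ApproxTorus.step, add_sub_assoc]
    · have hα' : VecWiener ρ' 2 fun s _ => X.α s + a s :=
        ((hα.mono (by linarith) le_rfl).add (ha.mono (by linarith) le_rfl) hρ'0).mono le_rfl
          (by nlinarith)
      have := (((hh.comp_sub hf' hρ'0 hδ (by linarith)).add (hH.comp hf' hρ'0 (by linarith))
        hρ'0).add (hα'.dot hf' hρ'0) hρ'0).mono (le_refl _) (M' := κ) (by
        have := hdiv (15 * E ^ 4 * ε) (by positivity)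
        rw [one_mul]
        nlinarith)
      convert this using 3 with s θ
      simp only [ApproxTorus.step]
      ring
    · have := (ha.mono (by linarith) le_rfl : VecWiener ρ' _ _).mono (le_refl _) (M' := κ)
        (by nlinarith)
      convert this using 3 with s θ
      simp [ApproxTorus.step]
    · have h1 := hAi1.mul hPc hρ'0
      have h2 := hPc.mul hAi1.transpose hρ'0
      have h3 := h1.mul hAi1.transpose hρ'0
      have := (((hPf.add h1 hρ'0).add h2 hρ'0).add h3 hρ'0).mono (le_refl _) (M' := κ) (by
        have h4 : E * (15 * E ^ 4 * ε) / δ ≤ 15 * E ^ 6 * ε := by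
          refine (hdiv _ (by positivity)).trans (le_of_eq (by ring))
        have h5 : 8 * (15 * E ^ 5 * ε) ≤ 1 / 2 := by nlinarith
        have h6 : 2 * (2 * (8 * (15 * E ^ 5 * ε)) * E) * (8 * (15 * E ^ 5 * ε)) ≤
            2 * (2 * (8 * (15 * E ^ 5 * ε)) * E) * (1 / 2) := by gcongr
        have h7 : 2 * (8 * (15 * E ^ 5 * ε)) * E = 240 * (E ^ 6 * ε) := by ring
        nlinarith)
      convert this using 3 with s θ
      simp only [ApproxTorus.step, Matrix.transpose_sub, Matrix.transpose_one]
      noncomm_ring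
  · have hzd := hz.comp_sub hf' hρ'0 hδ (by linarith)
    refine (hAi2.mulVec hzd hρ'0).mono le_rfl ?_
    -- Origin of `900 E⁹`: the displacement and the shift are each at most `15 E⁴ ε`, the mean value
    -- estimate costs `1/δ ≤ E`, and `Ai` together with the matrix product contributes `2 · 2`.
    have h1 := hdiv (15 * E ^ 4 * ε * (15 * E ^ 4 * ε)) (by positivity)
    rw [hκ]
    calc _ ≤ 2 * 2 * (15 * E ^ 4 * ε * (15 * E ^ 4 * ε) * E) := by gcongr
      _ = _ := by ring
  · rw [hκ]
    exact hq.comp hf' hρ'0 (by linarith)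

end ApproxTorus

/-! ### Convergence of the Newton scheme. -/

lemma exists_seq_of_step {α : Type} (I : ℕ → α → Prop) (R : ℕ → α → α → Prop) {x₀ : α}
    (h₀ : I 0 x₀) (hs : ∀ n x, I n x → ∃ y, I (n + 1) y ∧ R n x y) :
    ∃ x : ℕ → α, x 0 = x₀ ∧ (∀ n, I n (x n)) ∧ ∀ n, R n (x n) (x (n + 1)) := by
  choose! next hI hR using hs
  set x : ℕ → α := fun n => Nat.rec x₀ (fun n y => next n y) n with hx
  have hIx : ∀ n, I n (x n) := fun n => by
    induction n with
    | zero => exact h₀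
    | succ n ih => exact hI n _ ih
  exact ⟨x, rfl, hIx, fun n => hR n _ (hIx n)⟩

/-- A sequence whose increments decay geometrically converges. -/
lemma RWiener.exists_limit {r κ : ℝ} {u : ℕ → ℝ → Plane → ℝ} (hr : 0 ≤ r)
    (h : ∀ n, RWiener r (κ * (1 / 2) ^ n) fun s θ => u (n + 1) s θ - u n s θ) :
    ∃ v : ℝ → Plane → ℝ, ∀ n, RWiener r (2 * κ * (1 / 2) ^ n) fun s θ => v s θ - u n s θ := by
  have hgeo : HasSum (fun n : ℕ => κ * (1 / 2 : ℝ) ^ n) (κ * 2) :=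
    hasSum_geometric_two.mul_left κ
  have hsum : ∀ s θ, Summable fun n => u (n + 1) s θ - u n s θ := fun s θ =>
    Summable.of_norm_bounded hgeo.summable fun n => (h n).abs_le hr s θ
  refine ⟨fun s θ => u 0 s θ + ∑' n, (u (n + 1) s θ - u n s θ), fun n => ?_⟩
  have hgeo' : HasSum (fun m : ℕ => κ * (1 / 2 : ℝ) ^ (m + n)) (2 * κ * (1 / 2) ^ n) := by
    have h1 := hgeo.mul_right ((1 / 2 : ℝ) ^ n)
    rw [mul_comm κ 2] at h1
    refine h1.congr_fun fun m => ?_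
    rw [pow_add]; ring
  refine RWiener.tsum hr (fun m => h (m + n)) hgeo' le_rfl fun s θ => ?_
  have h1 := (hasSum_nat_add_iff' n).2 (hsum s θ).hasSum
  rw [Finset.sum_range_sub (fun n => u n s θ)] at h1
  rwa [show u 0 s θ + ∑' n, (u (n + 1) s θ - u n s θ) - u n s θ =
    ∑' n, (u (n + 1) s θ - u n s θ) - (u n s θ - u 0 s θ) by ring]

lemma tendsto_of_RWiener {r κ : ℝ} {u : ℕ → ℝ → Plane → ℝ} {v : ℝ → Plane → ℝ} (hr : 0 ≤ r)
    (h : ∀ n, RWiener r (κ * (1 / 2) ^ n) fun s θ => v s θ - u n s θ) (s : ℝ) (θ : Plane) :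
    Filter.Tendsto (fun n => u n s θ) Filter.atTop (𝓝 (v s θ)) := by
  rw [tendsto_iff_norm_sub_tendsto_zero]
  have h0 : Filter.Tendsto (fun n : ℕ => κ * (1 / 2 : ℝ) ^ n) Filter.atTop (𝓝 0) := by
    simpa using (tendsto_pow_atTop_nhds_zero_of_lt_one (r := (1 / 2 : ℝ)) (by norm_num)
      (by norm_num)).const_mul κ
  refine squeeze_zero (fun _ => norm_nonneg _) (fun n => ?_) h0
  rw [norm_sub_rev]
  exact (h n).abs_le hr s θ

/-- The Cauchy estimate with the whole rate `r` given up: what remains at rate `0` still controls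
the values. -/
lemma tendsto_partials_of_RWiener {r κ : ℝ} {u : ℕ → ℝ → Plane → ℝ} {v : ℝ → Plane → ℝ}
    (hr : 0 < r) (h : ∀ n, RWiener r (κ * (1 / 2) ^ n) fun s θ => v s θ - u n s θ)
    (hu : ∀ n s, Differentiable ℝ (u n s)) (hv : ∀ s, Differentiable ℝ (v s)) (s : ℝ) (θ : Plane)
    (i : Fin 2) :
    Filter.Tendsto (fun n => partials (u n s) θ i) Filter.atTop (𝓝 (partials (v s) θ i)) := by
  refine tendsto_of_RWiener (κ := κ / r) (u := fun n s θ => partials (u n s) θ i)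
    (v := fun s θ => partials (v s) θ i) le_rfl (fun n => ?_) s θ
  have := (h n).partials hr le_rfl i
  rw [sub_self] at this
  convert this using 3 with s θ
  · ring
  · simp [partials, fderiv_fun_sub (hv s θ) (hu n s θ)]

/-- Factor `Q₀ M = 1 + Q₀(M - M₀)` and invert the second expression. In the scheme this keeps the
mean of the current `P` invertible with the same bound at every step. -/
lemma MatWiener.exists_inverse_of_near {ρ b κ : ℝ} {M₀ Q₀ : Matrix (Fin 2) (Fin 2) ℝ}
    {M : ℝ → Matrix (Fin 2) (Fin 2) ℝ} (hρ : 0 ≤ ρ) (hQ₀ : M₀ * Q₀ = 1)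
    (hb : ∀ i j, |Q₀ i j| ≤ b) (hM : MatWiener ρ κ fun s _ => M s - M₀)
    (hκ : 2 * b * κ ≤ 1 / 16) :
    ∃ Q : ℝ → Matrix (Fin 2) (Fin 2) ℝ, (∀ s, M s * Q s = 1) ∧
      MatWiener ρ (4 * b) fun s _ => Q s := by
  have hb0 : 0 ≤ b := (abs_nonneg _).trans (hb 0 0)
  have hQW : MatWiener ρ b fun _ _ => Q₀ := fun i j => (RWiener.const ρ _).mono le_rfl (hb i j)
  have hA : MatWiener ρ (2 * b * κ) fun s _ => Q₀ * (M s - M₀) := hQW.mul hM hρ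
  obtain ⟨Ai, hAi, hAi1⟩ := hA.exists_inv_one_add hρ hκ
  have hone : MatWiener ρ 1 fun _ _ => (1 : Matrix (Fin 2) (Fin 2) ℝ) := fun i j =>
    (RWiener.const ρ _).mono le_rfl (by fin_cases i <;> fin_cases j <;> simp)
  have hAi2 : MatWiener ρ 2 Ai := by
    have := (hAi1.add hone hρ).mono (le_refl _) (M' := 2) (by linarith)
    simpa using this
  -- The inverse is produced as a function of `(s, θ)`. Uniqueness of inverses shows that it does
  -- not depend on `θ`.
  have hconst : ∀ s θ, Ai s θ = Ai s 0 := fun s θ => by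
    have h1 := hAi s θ
    have h2 := mul_eq_one_comm.1 (hAi s 0)
    calc Ai s θ = Ai s θ * ((1 + Q₀ * (M s - M₀)) * Ai s 0) := by rw [h2, mul_one]
      _ = _ := by rw [← mul_assoc, h1, one_mul]
  refine ⟨fun s => Ai s 0 * Q₀, fun s => ?_, ?_⟩
  · rw [mul_eq_one_comm]
    have : 1 + Q₀ * (M s - M₀) = Q₀ * M s := by
      rw [mul_sub, mul_eq_one_comm.1 hQ₀]; abel
    rw [mul_assoc, ← this, hAi]
  · have := (hAi2.mul hQW hρ).mono (le_refl ρ) (M' := 4 * b) (by linarith)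
    simpa only [hconst] using this

namespace ApproxTorus

variable {P₀ : Plane → Matrix (Fin 2) (Fin 2) ℝ} {Y : Plane → Fin 2 → ℝ} {U : ℝ → Plane → ℝ}
  {ω : Fin 2 → ℝ}

lemma torusMean_sub_of_RWiener {ρ : ℝ} {u v : ℝ → Plane → ℝ} (hρ : 0 < ρ) {M M' : ℝ}
    (hu : RWiener ρ M u) (hv : RWiener ρ M' v) (s : ℝ) :
    torusMean (fun θ => u s θ - v s θ) = torusMean (u s) - torusMean (v s) := by
  rw [torusMean, torusMean, torusMean, ← mul_sub, torusIntegral, torusIntegral, torusIntegral,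
    MeasureTheory.integral_sub]
  · exact ((hu.differentiable hρ s).continuous.continuousOn).integrableOn_compact isCompact_Icc
  · exact ((hv.differentiable hρ s).continuous.continuousOn).integrableOn_compact isCompact_Icc

/-- The Newton scheme can be iterated when the first error is small. -/
lemma exists_newton_sequence {N : ℕ} {C r b : ℝ} (hω : SmallDivisorBound ω N C) (hC : 1 ≤ C)
    (hr : 0 < r) (hr1 : r ≤ 1) {Q₀ : Matrix (Fin 2) (Fin 2) ℝ}
    (hQ₀ : (Matrix.of fun i j => torusMean fun θ => P₀ θ i j) * Q₀ = 1)
    (hP₀ : MatWiener (2 * r) b fun _ => P₀) {ν : ℝ} (hν : 0 < ν) :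
    ∃ ε > 0, ∃ κ > 0, κ ≤ ν ∧ ∀ (U : ℝ → Plane → ℝ) (X₀ : ApproxTorus), X₀.Solves P₀ Y U ω →
      X₀.v = 0 → X₀.h = 0 → X₀.α = 0 → (X₀.P = fun _ => P₀) → VecWiener (2 * r) ε X₀.e₁ →
      RWiener (2 * r) ε X₀.e₂ →
      ∃ X : ℕ → ApproxTorus, X 0 = X₀ ∧ (∀ n, (X n).Solves P₀ Y U ω) ∧
        (∀ n, (X n).DistLE (X (n + 1)) r (κ * (1 / 2) ^ n)) ∧
        ∀ n, VecWiener r (ε * (1 / 2) ^ n) (X n).e₁ ∧ RWiener r (ε * (1 / 2) ^ n) (X n).e₂ := by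
  classical
  have hb0 : 0 ≤ b := (hP₀ 0 0).nonneg
  set b' : ℝ := ∑ i, ∑ j, |Q₀ i j| with hb'
  have hb'0 : 0 ≤ b' := Finset.sum_nonneg fun i _ => Finset.sum_nonneg fun j _ => abs_nonneg _
  have hQb : ∀ i j, |Q₀ i j| ≤ b' := fun i j =>
    (Finset.single_le_sum (f := fun j => |Q₀ i j|) (fun j _ => abs_nonneg _)
      (Finset.mem_univ j)).trans (Finset.single_le_sum (f := fun i => ∑ j, |Q₀ i j|)
        (fun i _ => Finset.sum_nonneg fun j _ => abs_nonneg _) (Finset.mem_univ i))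
  -- One bound for all steps: `P` stays within `1` of `P₀`, and the inverse of its mean stays below
  -- `4b'`.
  set B : ℝ := 1 + b + 4 * b' with hBdef
  have hB1 : 1 ≤ B := by linarith
  set E₀ : ℝ := C * B / (r / 8) ^ (N + 1) with hE₀
  have hE₀pos : 0 < E₀ := by positivity
  -- The steps `δₙ = (r/8) 2⁻ⁿ` make `Eₙ⁹` grow like `2^(9(N+1)n)`. If the errors decay like `qⁿ`,
  -- this growth is cancelled and a factor `2⁻ⁿ` is left for `κₙ`. Geometric decay is enough, so the
  -- faster decay of the Newton method is not tracked.
  set q : ℝ := (1 / 2) ^ (9 * (N + 1) + 1) with hq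
  have hq0 : 0 < q := by positivity
  have hqhalf : q ≤ 1 / 2 :=
    (pow_le_pow_of_le_one (by norm_num : (0 : ℝ) ≤ 1 / 2) (by norm_num)
      (Nat.le_add_left 1 (9 * (N + 1)))).trans_eq (pow_one _)
  -- The bound `q` makes each step shrink the error by `q`. The last bound keeps the mean of `P`,
  -- which moves by at most `2κ`, in the range of `MatWiener.exists_inverse_of_near`.
  set κ : ℝ := min ν (min q (1 / (64 * (b' + 1)))) with hκ
  have hκ0 : 0 < κ := lt_min hν (lt_min hq0 (by positivity))
  have hκq : κ ≤ q := (min_le_right _ _).trans (min_le_left _ _)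
  have hκb : κ * (64 * (b' + 1)) ≤ 1 := by
    rw [← le_div_iff₀ (by positivity)]
    exact (min_le_right _ _).trans (min_le_right _ _)
  have hκb' : 2 * b' * (2 * κ) ≤ 1 / 16 := by nlinarith
  set ε : ℝ := κ / (900 * E₀ ^ 9) with hε
  have hε0 : 0 < ε := by positivity
  have hεκ : 900 * E₀ ^ 9 * ε = κ := by rw [hε]; field_simp
  refine ⟨ε, hε0, κ, hκ0, min_le_left _ _, fun U X₀ hX₀ hv hh hα hP he₁ he₂ => ?_⟩
  -- The rate falls from `2r` towards `r`, by exactly `4δₙ` at step `n`, and `μ n` is the sum of the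
  -- first `n` increments `κ 2⁻ᵏ`.
  set ρ : ℕ → ℝ := fun n => r + r * (1 / 2) ^ n with hρdef
  set μ : ℕ → ℝ := fun n => 2 * κ * (1 - (1 / 2) ^ n) with hμ
  have hhalf : ∀ n : ℕ, 0 < (1 / 2 : ℝ) ^ n ∧ (1 / 2 : ℝ) ^ n ≤ 1 := fun n =>
    ⟨by positivity, pow_le_one₀ (by norm_num) (by norm_num)⟩
  have hρr : ∀ n, r < ρ n := fun n => by
    have := mul_pos hr (hhalf n).1
    simp only [hρdef]; linarith
  have hμle : ∀ n, μ n ≤ 2 * κ := fun n => by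
    have := (hhalf n).1
    simp only [hμ]; nlinarith
  have hμ1 : ∀ n, μ n + κ * (1 / 2) ^ n = μ (n + 1) := fun n => by
    simp only [hμ, pow_succ]; ring
  have hρ1 : ∀ n, ρ n - 4 * (r / 8 * (1 / 2) ^ n) = ρ (n + 1) := fun n => by
    simp only [hρdef, pow_succ]; ring
  have hρle : ∀ n, ρ (n + 1) ≤ ρ n := fun n => by
    have := mul_pos hr (hhalf n).1
    rw [← hρ1]; linarith
  set I : ℕ → ApproxTorus → Prop := fun n X =>
    X.Solves P₀ Y U ω ∧ VecWiener (ρ n) (μ n) X.v ∧ RWiener (ρ n) (μ n) X.h ∧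
      VecWiener (ρ n) (μ n) (fun s _ => X.α s) ∧
      MatWiener (ρ n) (μ n) (fun s θ => X.P s θ - P₀ θ) ∧
      VecWiener (ρ n) (ε * q ^ n) X.e₁ ∧ RWiener (ρ n) (ε * q ^ n) X.e₂ with hIdef
  have hstart : I 0 X₀ := by
    have hμ0 : μ 0 = 0 := by simp [hμ]
    have hρ0 : ρ 0 = 2 * r := by simp only [hρdef]; ring
    simp only [hIdef]
    rw [hμ0, hρ0, pow_zero, mul_one, hv, hh, hα, hP]
    refine ⟨hX₀, fun i => RWiener.zero _ le_rfl, RWiener.zero _ le_rfl,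
      fun i => RWiener.zero _ le_rfl, fun i j => ?_, he₁, he₂⟩
    simpa using RWiener.zero (2 * r) le_rfl
  have hstep : ∀ n X, I n X → ∃ X', I (n + 1) X' ∧
      X.DistLE X' (ρ (n + 1)) (κ * (1 / 2) ^ n) := by
    rintro n X ⟨hX, hv, hh, hα, hP, he₁, he₂⟩
    have hρ0 : 0 < ρ n := hr.trans (hρr n)
    have hρ2 : ρ n ≤ 2 * r := by
      have := mul_le_mul_of_nonneg_left (hhalf n).2 hr.le
      simp only [hρdef]; linarith
    have hμ1' : μ n ≤ 1 := (hμle n).trans (by linarith)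
    have hPB : MatWiener (ρ n) B X.P := by
      have := (hP.add (hP₀.mono hρ2 le_rfl) hρ0.le).mono (le_refl _) (M' := B) (by linarith)
      simpa using this
    obtain ⟨Q, hQ1, hQ2⟩ := MatWiener.exists_inverse_of_near (ρ := ρ n) (κ := 2 * κ)
      (M := fun s => Matrix.of fun i j => torusMean fun θ => X.P s θ i j) hρ0.le hQ₀ hQb
      (fun i j => by
        obtain ⟨-, -, hm, -⟩ := (hP i j).exists_cohomological hω (by linarith) hρ0 le_rfl
        convert hm.mono le_rfl (hμle n) using 3 with s θ
        exact (torusMean_sub_of_RWiener hρ0 (hPB i j) (hP₀.mono hρ2 le_rfl i j) s).symm) hκb'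
    have hδ : 0 < r / 8 * (1 / 2) ^ n := by have := (hhalf n).1; positivity
    have hδr : 4 * (r / 8 * (1 / 2) ^ n) ≤ ρ n := by
      have := hρ1 n
      have := hρr (n + 1)
      linarith
    have hδ1 : r / 8 * (1 / 2) ^ n ≤ 1 := by
      have := (hhalf n).2
      nlinarith
    have hEn : C * B / (r / 8 * (1 / 2) ^ n) ^ (N + 1) = E₀ * 2 ^ (n * (N + 1)) := by
      rw [hE₀, mul_pow, ← pow_mul, one_div, inv_pow]
      field_simp
    have hκn : κ * (1 / 2) ^ n = 900 * (E₀ * 2 ^ (n * (N + 1))) ^ 9 * (ε * q ^ n) := by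
      rw [← hεκ, hq, ← pow_mul, mul_pow, ← pow_mul]
      have : (1 / 2 : ℝ) ^ ((9 * (N + 1) + 1) * n) * 2 ^ (n * (N + 1) * 9) = (1 / 2) ^ n := by
        rw [show (9 * (N + 1) + 1) * n = n * (N + 1) * 9 + n by ring, pow_add, mul_right_comm,
          ← mul_pow]
        norm_num
      rw [← this]; ring
    obtain ⟨X', hX', hd, h1, h2⟩ := hX.exists_newton_step hω hC hB1 hδ hδ1 hδr
      (hv.mono le_rfl hμ1') (hh.mono le_rfl hμ1') (hα.mono le_rfl hμ1') hPB
      (hQ2.mono le_rfl (by linarith)) hQ1 he₁ he₂ hEn.symm hκn (by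
        have := (hhalf n).2
        nlinarith)
    rw [hρ1] at hd h1 h2
    have hρ1' : 0 ≤ ρ (n + 1) := hr.le.trans (hρr _).le
    have herr : κ * (1 / 2) ^ n * (ε * q ^ n) ≤ ε * q ^ (n + 1) := by
      have h3 : κ * (1 / 2) ^ n ≤ q := by
        have := (hhalf n).2
        nlinarith
      calc _ ≤ q * (ε * q ^ n) := by gcongr
        _ = _ := by ring
    refine ⟨X', ⟨hX', ?_, ?_, ?_, ?_, h1.mono le_rfl herr, h2.mono le_rfl herr⟩, hd⟩
    · simpa [← hμ1] using (hv.mono (hρle n) le_rfl).add hd.v hρ1'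
    · simpa [← hμ1] using (hh.mono (hρle n) le_rfl).add hd.h hρ1'
    · simpa [← hμ1] using (hα.mono (hρle n) le_rfl).add hd.α hρ1'
    · have := (hP.mono (hρle n) le_rfl).add hd.P hρ1'
      rw [hμ1] at this
      convert this using 3
      abel
  obtain ⟨X, hX0, hI, hR⟩ := exists_seq_of_step (α := ApproxTorus)
    I
    (fun n X X' => X.DistLE X' (ρ (n + 1)) (κ * (1 / 2) ^ n)) (x₀ := X₀) hstart hstep
  refine ⟨X, hX0, fun n => (hI n).1, fun n => ?_, fun n => ?_⟩
  · obtain ⟨h1, h2, h3, h4⟩ := hR n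
    exact ⟨h1.mono (hρr _).le le_rfl, h2.mono (hρr _).le le_rfl, h3.mono (hρr _).le le_rfl,
      h4.mono (hρr _).le le_rfl⟩
  · have h1 : ε * q ^ n ≤ ε * (1 / 2) ^ n := by gcongr
    exact ⟨(hI n).2.2.2.2.2.1.mono (hρr _).le h1, (hI n).2.2.2.2.2.2.mono (hρr _).le h1⟩

end ApproxTorus

/-! ### Invariant tori of the perturbed energy. -/

open Filter in
/-- **Invariant tori of fixed Diophantine frequency.** The Lagrangian with metric `G` and potential
`(1 + β sin s) V`, where `V = ω · G ω`, has for each `s` an invariant torus `θ ↦ θ + v` of frequency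
`ω` that depends analytically on `s` and is trivial for `s = 0`. -/
theorem exists_invariant_tori {ω : Fin 2 → ℝ} {N : ℕ} {C ρ b c : ℝ}
    {P₀ G : Plane → Matrix (Fin 2) (Fin 2) ℝ} {Q₀ : Matrix (Fin 2) (Fin 2) ℝ}
    (hω : SmallDivisorBound ω N C) (hC : 1 ≤ C) (hsymm : ∀ θ, (P₀ θ)ᵀ = P₀ θ)
    (hGP : ∀ θ, G θ * P₀ θ = 1) (hG : Continuous G) (hρ : 0 < ρ) (hP₀ : MatWiener ρ b fun _ => P₀)
    (hV : RWiener ρ c fun _ θ => ω ⬝ᵥ (G θ *ᵥ ω))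
    (hQ₀ : (Matrix.of fun i j => torusMean fun θ => P₀ θ i j) * Q₀ = 1) :
    ∃ β > 0, ∃ r > 0, ∃ (v : ℝ → Plane → Fin 2 → ℝ) (h : ℝ → Plane → ℝ) (α : ℝ → Fin 2 → ℝ)
      (e : ℝ → ℝ), VecWiener r 1 v ∧ RWiener r 1 h ∧ VecWiener r 1 (fun s _ => α s) ∧
      (∀ s θ i j, |jacobian (v s) θ i j| ≤ 1 / 8) ∧
      (∀ s θ, (1 + jacobian (v s) θ)ᵀ *ᵥ (G (θ + v s θ) *ᵥ (jacobian (v s) θ *ᵥ ω)) =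
        partials (h s) θ + α s) ∧
      (∀ s θ, (ω + jacobian (v s) θ *ᵥ ω) ⬝ᵥ (G (θ + v s θ) *ᵥ (ω + jacobian (v s) θ *ᵥ ω)) =
        (1 + β * Real.sin s) * (ω ⬝ᵥ (G (θ + v s θ) *ᵥ ω)) + e s) ∧
      v 0 = 0 ∧ h 0 = 0 ∧ α 0 = 0 := by
  set r : ℝ := min (ρ / 2) 1 with hr_def
  have hr : 0 < r := lt_min (by linarith) one_pos
  have hr1 : r ≤ 1 := min_le_right _ _
  have h2r : 2 * r ≤ ρ := by have := min_le_left (ρ / 2) 1; linarith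
  set Y : Plane → Fin 2 → ℝ := fun θ => G θ *ᵥ ω with hY
  -- The bound `1/2` gives norms at most `1` in the limit, and `r/16` gives a Jacobian with entries
  -- at most `2κ/r ≤ 1/8`.
  obtain ⟨ε, hε, κ, hκ, hκν, hseq⟩ := ApproxTorus.exists_newton_sequence (Y := Y) hω hC hr hr1 hQ₀
    (hP₀.mono h2r le_rfl) (ν := min (1 / 2) (r / 16)) (lt_min (by norm_num) (by linarith))
  have hκ1 : 2 * κ ≤ 1 := by have := hκν.trans (min_le_left _ _); linarith
  have hκr : 2 * κ / r ≤ 1 / 8 := by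
    have := hκν.trans (min_le_right _ _)
    rw [div_le_iff₀ hr]; linarith
  have hc : 0 ≤ c := hV.nonneg
  -- Here `exp(2r) c` bounds the norm of `sin s · V`. This `β` makes the initial energy error at
  -- most `ε` for all `s` at once.
  set β : ℝ := ε / (Real.exp (2 * r) * c + 1) with hβ
  have hβ0 : 0 < β := by positivity
  -- The unperturbed torus has exactly the frequency `ω`. Its energy is `V`, so measured against `(1
  -- + β sin s) V` it has the error `2 e₂ = -β sin s · V`.
  set X₀ : ApproxTorus := ⟨0, 0, 0, fun _ => P₀, 0,
    fun s θ => -(1 / 2 * β) * (Real.sin s * (ω ⬝ᵥ (G θ *ᵥ ω)))⟩ with hX₀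
  have hPG : ∀ θ, P₀ θ * G θ = 1 := fun θ => mul_eq_one_comm.1 (hGP θ)
  have hp0 : ∀ θ, partials (0 : Plane → ℝ) θ = 0 := partials_zero
  have hj0 : ∀ θ, jacobian (0 : Plane → Fin 2 → ℝ) θ = 0 := fun θ => by
    ext i j; exact congrFun (partials_zero θ) j
  have hform : ∀ s θ, X₀.form Y s θ = Y θ := fun s θ => by
    simp [ApproxTorus.form, hX₀, hp0, hj0]
  have hS₀ : X₀.Solves P₀ Y (fun s θ => (1 + β * Real.sin s) * (ω ⬝ᵥ (G θ *ᵥ ω))) ω := by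
    have hPY : ∀ θ, P₀ θ *ᵥ Y θ = ω := fun θ => by
      rw [hY, Matrix.mulVec_mulVec, hPG, Matrix.one_mulVec]
    refine ⟨fun s i => differentiable_const _, fun s => differentiable_const _,
      fun s θ => hsymm θ, fun s θ => ?_, fun s θ => ?_, ⟨fun _ => 0, fun s θ => ?_⟩,
      rfl, rfl, rfl, rfl, ?_⟩
    · simp [hX₀, hj0]
    · rw [hform]; simp [hX₀, hPY]
    · rw [hform]
      simp only [hX₀, hPY, Pi.zero_apply, add_zero]
      rw [dotProduct_comm, hY]; ring
    · funext θ; simp [hX₀]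
  have he₂ : RWiener (2 * r) ε X₀.e₂ := by
    refine (((RWiener.sin (2 * r) (by linarith)).mul (hV.mono h2r le_rfl)
      (by linarith)).const_mul (by linarith) (-(1 / 2 * β))).mono le_rfl ?_
    rw [abs_neg, abs_of_pos (by positivity), hβ]
    have h1 : ε * (Real.exp (2 * r) * c) ≤ ε * (Real.exp (2 * r) * c + 1) := by
      gcongr; linarith
    have h2 : ε / (Real.exp (2 * r) * c + 1) * (Real.exp (2 * r) * c) ≤ ε := by
      rw [div_mul_eq_mul_div, div_le_iff₀ (by positivity)]
      exact h1
    linarith [mul_nonneg (div_nonneg hε.le (by positivity : 0 ≤ Real.exp (2 * r) * c + 1))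
      (by positivity : 0 ≤ Real.exp (2 * r) * c)]
  obtain ⟨X, hX0, hS, hD, hE⟩ := hseq _ X₀ hS₀ rfl rfl rfl rfl
    (fun i => RWiener.zero _ hε.le) he₂
  choose vi hvi using fun i =>
    RWiener.exists_limit (u := fun n s θ => (X n).v s θ i) hr.le fun n => (hD n).v i
  obtain ⟨h, hh⟩ := RWiener.exists_limit (u := fun n => (X n).h) hr.le fun n => (hD n).h
  choose αi hαi using fun i =>
    RWiener.exists_limit (u := fun n s _ => (X n).α s i) hr.le fun n => (hD n).α i
  set v : ℝ → Plane → Fin 2 → ℝ := fun s θ i => vi i s θ with hv_def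
  set α : ℝ → Fin 2 → ℝ := fun s i => αi i s 0 with hα_def
  have hαlim : ∀ i s θ, Tendsto (fun n => (X n).α s i) atTop (𝓝 (αi i s θ)) := fun i s θ =>
    tendsto_of_RWiener (u := fun n s _ => (X n).α s i) hr.le (hαi i) s θ
  have hαc : ∀ i s θ, αi i s θ = α s i := fun i s θ =>
    tendsto_nhds_unique (hαlim i s θ) (hαlim i s 0)
  have hvlim : ∀ s θ, Tendsto (fun n => (X n).v s θ) atTop (𝓝 (v s θ)) := fun s θ =>
    tendsto_pi_nhds.2 fun i => tendsto_of_RWiener (u := fun n s θ => (X n).v s θ i) hr.le (hvi i) s θ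
  have hhlim : ∀ s θ, Tendsto (fun n => (X n).h s θ) atTop (𝓝 (h s θ)) := fun s θ =>
    tendsto_of_RWiener (u := fun n => (X n).h) hr.le hh s θ
  have hvW : VecWiener r (2 * κ) v := fun i => by
    have := hvi i 0
    simpa [hX0, hX₀] using this
  have hhW : RWiener r (2 * κ) h := by
    have := hh 0
    simpa [hX0, hX₀] using this
  have hαW : VecWiener r (2 * κ) fun s _ => α s := fun i => by
    have := hαi i 0
    simpa [hX0, hX₀, hαc] using this
  have hjlim : ∀ s θ, Tendsto (fun n => jacobian ((X n).v s) θ) atTop (𝓝 (jacobian (v s) θ)) :=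
    fun s θ => tendsto_pi_nhds.2 fun i => tendsto_pi_nhds.2 fun j =>
      tendsto_partials_of_RWiener (u := fun n s θ => (X n).v s θ i) hr (hvi i)
        (fun n s => (hS n).diff_v s i) (fun s => (hvW i).differentiable hr s) s θ j
  have hplim : ∀ s θ, Tendsto (fun n => partials ((X n).h s) θ) atTop (𝓝 (partials (h s) θ)) :=
    fun s θ => tendsto_pi_nhds.2 fun j =>
      tendsto_partials_of_RWiener (u := fun n => (X n).h) hr hh
        (fun n s => (hS n).diff_h s) (fun s => hhW.differentiable hr s) s θ j
  have hgeo : Tendsto (fun n : ℕ => ε * (1 / 2 : ℝ) ^ n) atTop (𝓝 0) := by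
    simpa using (tendsto_pow_atTop_nhds_zero_of_lt_one (r := (1 / 2 : ℝ)) (by norm_num)
      (by norm_num)).const_mul ε
  have he₁lim : ∀ s θ, Tendsto (fun n => (X n).e₁ s θ) atTop (𝓝 0) := fun s θ =>
    tendsto_pi_nhds.2 fun i => squeeze_zero_norm (fun n => by
      simpa using ((hE n).1 i).abs_le hr.le s θ) hgeo
  have he₂lim : ∀ s θ, Tendsto (fun n => (X n).e₂ s θ) atTop (𝓝 0) := fun s θ =>
    squeeze_zero_norm (fun n => by simpa using (hE n).2.abs_le hr.le s θ) hgeo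
  have hGlim : ∀ s θ, Tendsto (fun n => G (θ + (X n).v s θ)) atTop (𝓝 (G (θ + v s θ))) :=
    fun s θ => (hG.tendsto _).comp ((hvlim s θ).const_add θ)
  -- The matrix `P` is eliminated with `Jᵀ G J = P⁻¹`, so its limit is never needed. Pointwise
  -- limits of `v`, `h`, `α` and of the first derivatives of `v` and `h` suffice.
  have hrel : ∀ n s θ, (1 + jacobian ((X n).v s) θ)ᵀ *ᵥ (G (θ + (X n).v s θ) *ᵥ
      ((1 + jacobian ((X n).v s) θ) *ᵥ (ω + (X n).e₁ s θ))) = (X n).form Y s θ := fun n s θ => by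
    set J := 1 + jacobian ((X n).v s) θ
    have h1 : G (θ + (X n).v s θ) * J * (X n).P s θ * Jᵀ = 1 := by
      rw [← hGP (θ + (X n).v s θ), ← (hS n).conj s θ]
      simp only [Matrix.mul_assoc, J]
    have h2 := mul_eq_one_comm.1 h1
    rw [← (hS n).freq s θ]
    simp only [Matrix.mulVec_mulVec, ← Matrix.mul_assoc] at h2 ⊢
    rw [h2, Matrix.one_mulVec]
  have hmv : ∀ {A : ℕ → Matrix (Fin 2) (Fin 2) ℝ} {A' : Matrix (Fin 2) (Fin 2) ℝ}
      {w : ℕ → Fin 2 → ℝ} {w' : Fin 2 → ℝ}, Tendsto A atTop (𝓝 A') → Tendsto w atTop (𝓝 w') →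
      Tendsto (fun n => A n *ᵥ w n) atTop (𝓝 (A' *ᵥ w')) := fun hA hw =>
    ((continuous_fst.matrix_mulVec continuous_snd).tendsto _).comp (hA.prodMk_nhds hw)
  have hdot : ∀ {w w₁ : ℕ → Fin 2 → ℝ} {w' w₁' : Fin 2 → ℝ}, Tendsto w atTop (𝓝 w') →
      Tendsto w₁ atTop (𝓝 w₁') → Tendsto (fun n => w n ⬝ᵥ w₁ n) atTop (𝓝 (w' ⬝ᵥ w₁')) :=
    fun hw hw₁ => ((continuous_fst.dotProduct continuous_snd).tendsto _).comp (hw.prodMk_nhds hw₁)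
  have hJlim : ∀ s θ, Tendsto (fun n => 1 + jacobian ((X n).v s) θ) atTop
      (𝓝 (1 + jacobian (v s) θ)) := fun s θ => (hjlim s θ).const_add 1
  have hJtlim : ∀ s θ, Tendsto (fun n => (1 + jacobian ((X n).v s) θ)ᵀ) atTop
      (𝓝 (1 + jacobian (v s) θ)ᵀ) := fun s θ =>
    ((continuous_id.matrix_transpose).tendsto _).comp (hJlim s θ)
  have hωlim : ∀ s θ, Tendsto (fun n => ω + (X n).e₁ s θ) atTop (𝓝 ω) := fun s θ => by
    simpa using (he₁lim s θ).const_add ω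
  have hzlim : ∀ s θ, Tendsto (fun n => G (θ + (X n).v s θ) *ᵥ
      ((1 + jacobian ((X n).v s) θ) *ᵥ (ω + (X n).e₁ s θ))) atTop
      (𝓝 (G (θ + v s θ) *ᵥ ((1 + jacobian (v s) θ) *ᵥ ω))) := fun s θ =>
    hmv (hGlim s θ) (hmv (hJlim s θ) (hωlim s θ))
  have hformlim : ∀ s θ, Tendsto (fun n => (X n).form Y s θ) atTop
      (𝓝 ((1 + jacobian (v s) θ)ᵀ *ᵥ (G (θ + v s θ) *ᵥ ω) + partials (h s) θ + α s)) :=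
    fun s θ => ((hmv (hJtlim s θ) (hmv (hGlim s θ) tendsto_const_nhds)).add (hplim s θ)).add
      (tendsto_pi_nhds.2 fun i => hαlim i s 0)
  have hA : ∀ s θ, (1 + jacobian (v s) θ)ᵀ *ᵥ (G (θ + v s θ) *ᵥ ((1 + jacobian (v s) θ) *ᵥ ω)) =
      (1 + jacobian (v s) θ)ᵀ *ᵥ (G (θ + v s θ) *ᵥ ω) + partials (h s) θ + α s := fun s θ => by
    refine tendsto_nhds_unique (hmv (hJtlim s θ) (hzlim s θ)) ?_
    simpa only [hrel] using hformlim s θ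
  have hVlim : ∀ s θ, Tendsto (fun n => ω ⬝ᵥ (G (θ + (X n).v s θ) *ᵥ ω)) atTop
      (𝓝 (ω ⬝ᵥ (G (θ + v s θ) *ᵥ ω))) := fun s θ =>
    hdot tendsto_const_nhds (hmv (hGlim s θ) tendsto_const_nhds)
  choose k hk using fun n => (hS n).energy
  -- The energy constants converge because every other term of the energy identity does. Comparing
  -- the limits at `θ` and at `0` shows that the energy of the limit is constant on the torus.
  have hklim : ∀ s θ, Tendsto (fun n => k n s) atTop
      (𝓝 (((1 + jacobian (v s) θ) *ᵥ ω) ⬝ᵥ (G (θ + v s θ) *ᵥ ((1 + jacobian (v s) θ) *ᵥ ω)) -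
        (1 + β * Real.sin s) * (ω ⬝ᵥ (G (θ + v s θ) *ᵥ ω)))) := fun s θ => by
    have h1 : ∀ n, k n s = ((1 + jacobian ((X n).v s) θ) *ᵥ (ω + (X n).e₁ s θ)) ⬝ᵥ
        (G (θ + (X n).v s θ) *ᵥ ((1 + jacobian ((X n).v s) θ) *ᵥ (ω + (X n).e₁ s θ))) -
        (1 + β * Real.sin s) * (ω ⬝ᵥ (G (θ + (X n).v s θ) *ᵥ ω)) - 2 * (X n).e₂ s θ := fun n => by
      have h2 := hk n s θ
      rw [(hS n).freq, ← hrel n s θ, dotProduct_comm, Matrix.dotProduct_mulVec,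
        ← Matrix.mulVec_transpose, Matrix.transpose_transpose] at h2
      linarith
    simp only [h1]
    have h3 := ((hdot (hmv (hJlim s θ) (hωlim s θ)) (hzlim s θ)).sub
      ((hVlim s θ).const_mul (1 + β * Real.sin s))).sub ((he₂lim s θ).const_mul 2)
    simpa using h3
  have hone : ∀ s θ, (1 + jacobian (v s) θ) *ᵥ ω = ω + jacobian (v s) θ *ᵥ ω := fun s θ => by
    rw [Matrix.add_mulVec, Matrix.one_mulVec]
  refine ⟨β, hβ0, r, hr, v, h, α, fun s =>
    ((1 + jacobian (v s) 0) *ᵥ ω) ⬝ᵥ (G (0 + v s 0) *ᵥ ((1 + jacobian (v s) 0) *ᵥ ω)) -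
        (1 + β * Real.sin s) * (ω ⬝ᵥ (G (0 + v s 0) *ᵥ ω)), hvW.mono le_rfl hκ1,
    hhW.mono le_rfl hκ1, hαW.mono le_rfl hκ1, fun s θ i j => ?_, fun s θ => ?_, fun s θ => ?_,
    ?_, ?_, ?_⟩
  · have := (hvW i).partials hr le_rfl j
    rw [sub_self] at this
    exact (this.abs_le le_rfl s θ).trans hκr
  -- Cancelling the term `(1 + Dv)ᵀ G ω`, common to both sides, leaves the equation for the added
  -- form alone.
  · have := hA s θ
    rw [hone, Matrix.mulVec_add, Matrix.mulVec_add, add_assoc] at this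
    exact add_left_cancel this
  · have := tendsto_nhds_unique (hklim s θ) (hklim s 0)
    rw [← hone]
    linarith
  · funext θ
    refine tendsto_nhds_unique (hvlim 0 θ) ?_
    simp only [(hS _).zero.1]
    exact tendsto_const_nhds
  · funext θ
    refine tendsto_nhds_unique (hhlim 0 θ) ?_
    simp only [(hS _).zero.2.1]
    exact tendsto_const_nhds
  · funext i
    refine tendsto_nhds_unique (hαlim i 0 0) ?_
    simp only [(hS _).zero.2.2.1]
    exact tendsto_const_nhds

/-! ### Fourier series of real analytic periodic functions -/

-- Re-expanding the power series at nearby centres gives Cauchy bounds that are uniform in the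
-- centre.
open scoped NNReal in
lemma exists_bound_iteratedFDeriv_nhds {f : Plane → ℝ} {x : Plane} (hf : AnalyticAt ℝ f x) :
    ∃ C a : ℝ, 0 ≤ C ∧ 0 < a ∧ ∀ᶠ y in 𝓝 x, ∀ (n : ℕ) (z : Plane), ‖z‖ ≤ 1 →
      |iteratedFDeriv ℝ n f y fun _ => z| ≤ C * a ^ n * n.factorial := by
  obtain ⟨p, R, hp⟩ := hf
  obtain ⟨t, ht0, htR⟩ := ENNReal.lt_iff_exists_nnreal_btwn.1 hp.r_pos
  have ht0' : 0 < t := by simpa using ht0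
  -- Half of an admissible radius: one copy of `r` is for the displacement of the centre, the other
  -- for the radius of the new expansion.
  set r : ℝ≥0 := t / 2
  have hr0 : 0 < r := by positivity
  have hrr : (r + r : ℝ≥0∞) < p.radius := by
    rw [← ENNReal.coe_add, add_halves]
    exact htR.trans_le hp.r_le
  have hrR : (r : ℝ≥0∞) < R := by
    refine lt_of_le_of_lt ?_ htR
    exact_mod_cast half_le_self (zero_le (a := t))
  have hsum := p.changeOriginSeries_summable_aux₁ hrr
  set S : ℝ≥0 := ∑' s : Σ k l : ℕ, { s : Finset (Fin (k + l)) // s.card = l },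
    ‖p (s.1 + s.2.1)‖₊ * r ^ s.2.1 * r ^ s.1 with hS
  have hb : ∀ y : Plane, ‖y‖₊ ≤ r → ∀ k, ‖p.changeOrigin y k‖₊ * r ^ k ≤ S := fun y hy k => by
    have hyr : (‖y‖₊ : ℝ≥0∞) < p.radius :=
      lt_of_le_of_lt (by exact_mod_cast hy) (hrR.trans_le hp.r_le)
    have hrrad : (r : ℝ≥0∞) < p.radius := hrR.trans_le hp.r_le
    have h1 := NNReal.summable_sigma.1 hsum
    calc ‖p.changeOrigin y k‖₊ * r ^ k
        ≤ (∑' s : Σ l : ℕ, { s : Finset (Fin (k + l)) // s.card = l },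
            ‖p (k + s.1)‖₊ * ‖y‖₊ ^ s.1) * r ^ k := by
          gcongr
          exact p.nnnorm_changeOrigin_le k hyr
      _ ≤ (∑' s : Σ l : ℕ, { s : Finset (Fin (k + l)) // s.card = l },
            ‖p (k + s.1)‖₊ * r ^ s.1) * r ^ k := by
          gcongr
          · exact p.changeOriginSeries_summable_aux₂ hyr k
          · exact p.changeOriginSeries_summable_aux₂ hrrad k
      _ = ∑' s : Σ l : ℕ, { s : Finset (Fin (k + l)) // s.card = l },
            ‖p (k + s.1)‖₊ * r ^ s.1 * r ^ k := by rw [NNReal.tsum_mul_right]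
      _ ≤ S := by
          rw [hS, hsum.tsum_sigma' h1.1]
          exact h1.2.le_tsum k fun _ _ => zero_le
  refine ⟨S, (r : ℝ)⁻¹, S.2, by positivity, ?_⟩
  have hball : Metric.ball x r ∈ 𝓝 x := Metric.ball_mem_nhds x hr0
  filter_upwards [hball] with y hy n z hz
  have hyr : ‖y - x‖₊ ≤ r := by
    rw [← NNReal.coe_le_coe, coe_nnnorm, ← dist_eq_norm]
    exact (Metric.mem_ball.1 hy).le
  have hps := hp.changeOrigin (y := y - x) (lt_of_le_of_lt (by exact_mod_cast hyr) hrR)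
  rw [add_sub_cancel] at hps
  rw [← hps.factorial_smul z n, nsmul_eq_mul, abs_mul, Nat.abs_cast, mul_comm]
  gcongr
  have h2 := hb (y - x) hyr n
  rw [← NNReal.coe_le_coe] at h2
  push_cast at h2
  calc |(p.changeOrigin (y - x) n) fun _ => z|
      ≤ ‖p.changeOrigin (y - x) n‖ * ∏ _i : Fin n, ‖z‖ :=
        (p.changeOrigin (y - x) n).le_opNorm _
    _ ≤ ‖p.changeOrigin (y - x) n‖ * 1 := by
        gcongr
        exact Finset.prod_le_one (fun _ _ => norm_nonneg _) fun _ _ => hz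
    _ ≤ S * (r : ℝ)⁻¹ ^ n := by
        rw [mul_one, inv_pow, ← div_eq_mul_inv, le_div_iff₀ (by positivity)]
        exact h2

lemma exists_bound_iteratedFDeriv {f : Plane → ℝ} (hf : AnalyticOnNhd ℝ f Set.univ) :
    ∃ C a : ℝ, 0 ≤ C ∧ 0 < a ∧ ∀ y ∈ cell, ∀ (n : ℕ) (z : Plane), ‖z‖ ≤ 1 →
      |iteratedFDeriv ℝ n f y fun _ => z| ≤ C * a ^ n * n.factorial := by
  refine isCompact_cell.induction_on (p := fun s => ∃ C a : ℝ, 0 ≤ C ∧ 0 < a ∧ ∀ y ∈ s,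
    ∀ (n : ℕ) (z : Plane), ‖z‖ ≤ 1 →
      |iteratedFDeriv ℝ n f y fun _ => z| ≤ C * a ^ n * n.factorial) ?_ ?_ ?_ ?_
  · exact ⟨0, 1, le_rfl, one_pos, fun y hy => hy.elim⟩
  · rintro s t hst ⟨C, a, hC, ha, h⟩
    exact ⟨C, a, hC, ha, fun y hy => h y (hst hy)⟩
  · rintro s t ⟨C, a, hC, ha, h⟩ ⟨C', a', hC', ha', h'⟩
    refine ⟨max C C', max a a', hC.trans (le_max_left _ _), ha.trans_le (le_max_left _ _), ?_⟩
    rintro y (hy | hy) n z hz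
    · refine (h y hy n z hz).trans ?_
      gcongr
      · exact le_max_left _ _
      · exact le_max_left _ _
    · refine (h' y hy n z hz).trans ?_
      gcongr
      · exact le_max_right _ _
      · exact le_max_right _ _
  · intro x _
    obtain ⟨C, a, hC, ha, h⟩ := exists_bound_iteratedFDeriv_nhds (hf x (Set.mem_univ x))
    exact ⟨_, mem_nhdsWithin_of_mem_nhds h, C, a, hC, ha, fun y hy => hy⟩

/-- The Fourier coefficient of a function on the torus. -/
def fourierCoef (u : Plane → ℝ) (k : Fin 2 → ℤ) : ℂ :=
  (4 * Real.pi ^ 2 : ℝ)⁻¹ * ∫ θ in cell, (u θ : ℂ) * chi (-k, 0) 0 θ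

/-- Integration by parts: the derivative of `u` times a character has integral zero over the cell.
-/
lemma fourierCoef_partial {u : Plane → ℝ} (hu : ContDiff ℝ 1 u) (hp : IsPeriodic u)
    (k : Fin 2 → ℤ) (i : Fin 2) :
    fourierCoef (fun θ => fderiv ℝ u θ (Pi.single i 1)) k =
      (Complex.I * k i) * fourierCoef u k := by
  have hd : ∀ θ, HasFDerivAt (fun θ => (u θ : ℂ) * chi (-k, 0) 0 θ)
      ((u θ : ℂ) • ((Complex.I * chi (-k, 0) 0 θ) • Complex.ofRealCLM.comp (phaseCLM (-k, 0))) +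
        chi (-k, 0) 0 θ • Complex.ofRealCLM.comp (fderiv ℝ u θ)) θ := fun θ =>
    (Complex.ofRealCLM.hasFDerivAt.comp θ (hu.differentiable one_ne_zero θ).hasFDerivAt).mul
      (hasFDerivAt_chi _ _ _)
  have h := integral_fderiv_eq_zero (u := fun θ => (u θ : ℂ) * chi (-k, 0) 0 θ)
    ((Complex.ofRealCLM.contDiff.comp hu).mul (contDiff_chi _ _))
    (fun x l => by simp only [hp x l, chi_periodic _ _ x l]) i
  have hc : ContinuousOn (fun θ => (u θ : ℂ) * chi (-k, 0) 0 θ) cell :=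
    ((Complex.continuous_ofReal.comp hu.continuous).mul (continuous_chi _ _)).continuousOn
  have hc2 : ContinuousOn (fun θ => (Complex.I * k i) * ((u θ : ℂ) * chi (-k, 0) 0 θ)) cell :=
    continuousOn_const.mul hc
  have hc' : ContinuousOn (fun θ => ((fderiv ℝ u θ (Pi.single i 1) : ℝ) : ℂ) * chi (-k, 0) 0 θ)
      cell := ((Complex.continuous_ofReal.comp ((hu.continuous_fderiv one_ne_zero).clm_apply
        continuous_const)).mul (continuous_chi _ _)).continuousOn
  have h1 : ∀ θ, fderiv ℝ (fun θ => (u θ : ℂ) * chi (-k, 0) 0 θ) θ (Pi.single i 1) =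
      ((fderiv ℝ u θ (Pi.single i 1) : ℝ) : ℂ) * chi (-k, 0) 0 θ -
        (Complex.I * k i) * ((u θ : ℂ) * chi (-k, 0) 0 θ) := fun θ => by
    rw [(hd θ).fderiv]
    simp [phaseCLM_single]
    ring
  simp only [h1] at h
  rw [MeasureTheory.integral_sub (hc'.integrableOn_compact isCompact_cell)
    (hc2.integrableOn_compact isCompact_cell),
    MeasureTheory.integral_const_mul, sub_eq_zero] at h
  rw [fourierCoef, fourierCoef, h]
  ring

lemma norm_fourierCoef_le {u : Plane → ℝ} {M : ℝ} (h : ∀ θ ∈ cell, |u θ| ≤ M)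
    (k : Fin 2 → ℤ) : ‖fourierCoef u k‖ ≤ M := by
  have h1 : ‖∫ θ in cell, (u θ : ℂ) * chi (-k, 0) 0 θ‖ ≤ M * (4 * Real.pi ^ 2) := by
    have := MeasureTheory.norm_setIntegral_le_of_norm_le_const (μ := MeasureTheory.volume)
      (s := cell) (f := fun θ => (u θ : ℂ) * chi (-k, 0) 0 θ) (C := M)
      isCompact_cell.measure_lt_top (fun θ hθ => by
        rw [norm_mul, norm_chi, mul_one, Complex.norm_real]; exact h θ hθ)
    rwa [volume_cell] at this
  rw [fourierCoef, norm_mul, Complex.norm_real, Real.norm_eq_abs, abs_of_pos (by positivity),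
    inv_mul_le_iff₀ (by positivity)]
  linarith

lemma iteratedFDeriv_periodic {u : Plane → ℝ} (hp : IsPeriodic u) (n : ℕ) (z : Plane) :
    IsPeriodic fun θ => iteratedFDeriv ℝ n u θ fun _ => z := fun x k => by
  have : (fun θ => u (θ + latticeVec k)) = u := funext fun θ => hp θ k
  have h := iteratedFDeriv_comp_add_right (𝕜 := ℝ) (f := u) n (latticeVec k) x
  rw [this] at h
  exact congrArg (fun A => A fun _ => z) h.symm

/-- The Fourier coefficients of a real analytic function decay exponentially. -/
lemma exists_fourierCoef_bound {u : Plane → ℝ} (hu : AnalyticOnNhd ℝ u Set.univ)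
    (hp : IsPeriodic u) : ∃ C ρ : ℝ, 0 ≤ C ∧ 0 < ρ ∧
      ∀ k, ‖fourierCoef u k‖ ≤ C * Real.exp (-(ρ * (|(k 0 : ℝ)| + |(k 1 : ℝ)|))) := by
  obtain ⟨C, a, hC, ha, hb⟩ := exists_bound_iteratedFDeriv hu
  have hsm : ∀ n : ℕ, ContDiff ℝ n u := fun n => hu.contDiff
  have hcoef : ∀ (n : ℕ) k i, fourierCoef (fun θ => iteratedFDeriv ℝ n u θ fun _ => Pi.single i 1) k
      = (Complex.I * k i) ^ n * fourierCoef u k := fun n k i => by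
    induction n with
    | zero => simp
    | succ n ih =>
      have hc : ContDiff ℝ 1 fun θ => iteratedFDeriv ℝ n u θ fun _ => (Pi.single i 1 : Plane) := by
        have h1 : ContDiff ℝ 1 (iteratedFDeriv ℝ n u) :=
          (hsm (1 + n)).iteratedFDeriv_right (m := 1) (by push_cast; exact le_rfl)
        exact (ContinuousMultilinearMap.apply ℝ (fun _ : Fin n => Plane) ℝ
          (fun _ => Pi.single i 1)).contDiff.comp h1
      have h2 := fourierCoef_partial hc (iteratedFDeriv_periodic hp n _) k i
      rw [pow_succ', mul_assoc, ← ih, ← h2]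
      congr 1
      funext θ
      rw [iteratedFDeriv_succ_apply_left]
      have hd : DifferentiableAt ℝ (iteratedFDeriv ℝ n u) θ :=
        ((hsm (1 + n)).iteratedFDeriv_right (m := 1)
          (by push_cast; exact le_rfl)).differentiable one_ne_zero θ
      have h3 := ((ContinuousMultilinearMap.apply ℝ (fun _ : Fin n => Plane) ℝ
          (fun _ => (Pi.single i 1 : Plane))).hasFDerivAt.comp θ hd.hasFDerivAt).fderiv
      exact (congrArg (fun L => L (Pi.single i 1)) h3).symm
  have hnorm1 : ∀ i, ‖(Pi.single i 1 : Plane)‖ ≤ 1 := fun i =>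
    (pi_norm_le_iff_of_nonneg zero_le_one).2 fun j => by
      by_cases h : j = i
      · subst h; simp
      · simp [h]
  have hki : ∀ (n : ℕ) k i, |(k i : ℝ)| ^ n * ‖fourierCoef u k‖ ≤ C * a ^ n * n.factorial :=
    fun n k i => by
    have := norm_fourierCoef_le (u := fun θ => iteratedFDeriv ℝ n u θ fun _ => Pi.single i 1)
      (fun θ hθ => hb θ hθ n _ (hnorm1 i)) k
    rw [hcoef, norm_mul, norm_pow, norm_mul, Complex.norm_I, one_mul, Complex.norm_intCast] at this
    exact this
  -- From `|kᵢ|ⁿ ‖û(k)‖ ≤ C aⁿ n!`, multiplication by `tⁿ/n!` and summation over `n` give a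
  -- geometric series of ratio `ta = 1/2`, hence exponential decay in `|kᵢ|`.
  set t : ℝ := 1 / (2 * a) with ht
  have ht0 : 0 < t := by positivity
  have hexp : ∀ k i, Real.exp (t * |(k i : ℝ)|) * ‖fourierCoef u k‖ ≤ C * 2 := fun k i => by
    have h1 := (NormedSpace.exp_series_hasSum_exp' (𝕂 := ℝ) (t * |(k i : ℝ)|)).mul_right
      ‖fourierCoef u k‖
    rw [← Real.exp_eq_exp_ℝ] at h1
    refine hasSum_le (fun n => ?_) h1 (hasSum_geometric_two.mul_left C)
    rw [smul_eq_mul, mul_pow]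
    have h2 := hki n k i
    have h3 : t ^ n * a ^ n = (1 / 2) ^ n := by
      rw [← mul_pow, ht]; congr 1; field_simp
    have hf : (0 : ℝ) < n.factorial := by positivity
    calc (n.factorial : ℝ)⁻¹ * (t ^ n * |(k i : ℝ)| ^ n) * ‖fourierCoef u k‖
        = (n.factorial : ℝ)⁻¹ * t ^ n * (|(k i : ℝ)| ^ n * ‖fourierCoef u k‖) := by ring
      _ ≤ (n.factorial : ℝ)⁻¹ * t ^ n * (C * a ^ n * n.factorial) := by gcongr
      _ = C * (t ^ n * a ^ n) := by field_simp
      _ = _ := by rw [h3]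
  refine ⟨C * 2, t / 2, by positivity, by positivity, fun k => ?_⟩
  rw [Real.exp_neg, ← div_eq_mul_inv, le_div_iff₀ (Real.exp_pos _), mul_comm]
  -- The larger of the two components is at least half of their sum, which halves the rate.
  rcases le_total |(k 0 : ℝ)| |(k 1 : ℝ)| with h | h
  · refine le_trans ?_ (hexp k 1)
    exact mul_le_mul_of_nonneg_right (Real.exp_le_exp.2 (by nlinarith)) (norm_nonneg _)
  · refine le_trans ?_ (hexp k 0)
    exact mul_le_mul_of_nonneg_right (Real.exp_le_exp.2 (by nlinarith)) (norm_nonneg _)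

lemma summable_exp_neg_int {a : ℝ} (ha : 0 < a) :
    Summable fun n : ℤ => Real.exp (-(a * |(n : ℝ)|)) := by
  have h : Summable fun n : ℕ => Real.exp (-(a * |(n : ℝ)|)) := by
    have := Real.summable_exp_nat_mul_iff.2 (neg_lt_zero.2 ha)
    refine this.congr fun n => ?_
    rw [Nat.abs_cast]; ring_nf
  refine Summable.of_nat_of_neg ?_ ?_
  · exact_mod_cast h
  · simpa using h

lemma summable_exp_neg_lattice {a : ℝ} (ha : 0 < a) :
    Summable fun k : Fin 2 → ℤ => Real.exp (-(a * (|(k 0 : ℝ)| + |(k 1 : ℝ)|))) := by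
  have h := (summable_exp_neg_int ha).mul_of_nonneg (summable_exp_neg_int ha)
    (fun _ => (Real.exp_pos _).le) (fun _ => (Real.exp_pos _).le)
  have h2 := (finTwoArrowEquiv ℤ).summable_iff.2 h
  refine h2.congr fun k => ?_
  simp only [Function.comp, finTwoArrowEquiv_apply, ← Real.exp_add]
  show _ = Real.exp (-(a * (|(k 0 : ℝ)| + |(k 1 : ℝ)|)))
  congr 1
  show -(a * |(k 0 : ℝ)|) + -(a * |(k 1 : ℝ)|) = _
  ring

/-- The projection of the plane to the torus of unit circumferences. -/
def torusProj (x : Plane) : UnitAddTorus (Fin 2) := fun i => (x i : UnitAddCircle)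

lemma isOpenQuotientMap_torusProj : IsOpenQuotientMap torusProj :=
  IsOpenQuotientMap.piMap (f := fun (_ : Fin 2) (t : ℝ) => (t : UnitAddCircle))
    fun _ => QuotientAddGroup.isOpenQuotientMap_mk

/-- A function on the torus of unit circumferences from a function on the plane. -/
def descend (u : Plane → ℝ) (z : UnitAddTorus (Fin 2)) : ℂ :=
  u ((2 * Real.pi) • Function.surjInv isOpenQuotientMap_torusProj.surjective z)

lemma descend_torusProj {u : Plane → ℝ} (hp : IsPeriodic u) (x : Plane) :
    descend u (torusProj x) = u ((2 * Real.pi) • x) := by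
  set y := Function.surjInv isOpenQuotientMap_torusProj.surjective (torusProj x) with hy
  have h : torusProj y = torusProj x := Function.surjInv_eq _ _
  have hk : ∀ i, ∃ n : ℤ, (n : ℝ) = -x i + y i := fun i => by
    have h1 : ((x i : ℝ) : UnitAddCircle) = (y i : ℝ) := (congrFun h i).symm
    obtain ⟨n, hn⟩ := AddSubgroup.mem_zmultiples_iff.1 (QuotientAddGroup.eq.1 h1)
    exact ⟨n, by simpa using hn⟩
  choose k hk using hk
  have hxy : (2 * Real.pi) • y = (2 * Real.pi) • x + latticeVec k := by
    ext i
    simp only [Pi.smul_apply, Pi.add_apply, latticeVec, smul_eq_mul, hk i]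
    ring
  simp only [descend, ← hy, hxy, hp _ k]

lemma mFourier_torusProj (n : Fin 2 → ℤ) (x : Plane) :
    UnitAddTorus.mFourier n (torusProj x) = chi (n, 0) 0 ((2 * Real.pi) • x) := by
  show ∏ i, fourier (n i) (torusProj x i) = _
  simp only [torusProj, fourier_coe_apply, Fin.prod_univ_two, ← Complex.exp_add, chi, phase]
  congr 1
  push_cast [Pi.smul_apply, smul_eq_mul]
  ring

/-- A change of scale by `2π`: its Jacobian is exactly the normalization `1/(4π²)`, and the
half-open and closed cells differ by a null set. -/
lemma mFourierCoeff_descend {u : Plane → ℝ} (hp : IsPeriodic u) (n : Fin 2 → ℤ) :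
    UnitAddTorus.mFourierCoeff (descend u) n = fourierCoef u n := by
  rw [UnitAddTorus.mFourierCoeff_eq_integral _ _ 0]
  have h1 : ∀ x : Plane, UnitAddTorus.mFourier (-n) (fun i => (x i : UnitAddCircle)) •
      descend u (fun i => (x i : UnitAddCircle)) =
      (fun θ => (u θ : ℂ) * chi (-n, 0) 0 θ) ((2 * Real.pi) • x) := fun x => by
    have e1 := mFourier_torusProj (-n) x
    have e2 := descend_torusProj hp x
    unfold torusProj at e1 e2
    rw [e1, e2, smul_eq_mul, mul_comm]
  simp only [h1]
  have hset : (2 * Real.pi) • {x : Plane | ∀ i, x i ∈ Set.Ioc ((0 : Plane) i) ((0 : Plane) i + 1)} =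
      Set.univ.pi fun i => Set.Ioc ((0 : Plane) i) (2 * Real.pi) := by
    have hpi : (0 : ℝ) < 2 * Real.pi := by positivity
    ext x
    rw [Set.mem_smul_set_iff_inv_smul_mem₀ hpi.ne']
    simp only [Set.mem_ofPred_eq, Set.mem_pi, Set.mem_univ, true_imp_iff, Set.mem_Ioc,
      Pi.smul_apply, smul_eq_mul, Pi.zero_apply, zero_add]
    refine forall_congr' fun i => and_congr ?_ ?_
    · exact mul_pos_iff_of_pos_left (inv_pos.2 hpi)
    · rw [inv_mul_le_iff₀ hpi, mul_one]
  have h2 := MeasureTheory.Measure.setIntegral_comp_smul MeasureTheory.volume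
    (fun θ => (u θ : ℂ) * chi (-n, 0) 0 θ) (R := 2 * Real.pi)
    {x : Plane | ∀ i, x i ∈ Set.Ioc ((0 : Plane) i) ((0 : Plane) i + 1)} (by positivity)
  refine h2.trans ?_
  have hae : (Set.univ.pi fun i : Fin 2 => Set.Ioc ((0 : Plane) i) (2 * Real.pi))
      =ᵐ[MeasureTheory.volume] cell :=
    MeasureTheory.Measure.univ_pi_Ioc_ae_eq_Icc (f := (0 : Plane)) (g := fun _ => 2 * Real.pi)
  rw [hset, MeasureTheory.setIntegral_congr_set hae]
  have h3 : |((2 * Real.pi) ^ Module.finrank ℝ Plane)⁻¹| = (4 * Real.pi ^ 2)⁻¹ := by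
    rw [Module.finrank_fin_fun, abs_of_pos (by positivity)]
    ring
  rw [h3, Complex.real_smul]
  rfl

/-- The Fourier series of a continuous function converges to the function if the coefficients are
summable. -/
lemma hasSum_fourierCoef {u : Plane → ℝ} (hcont : Continuous u) (hp : IsPeriodic u)
    (hs : Summable fun k => ‖fourierCoef u k‖) (s : ℝ) (θ : Plane) :
    HasSum (fun k => fourierCoef u k * chi (k, 0) s θ) (u θ) := by
  have hcd : Continuous (descend u) := by
    rw [isOpenQuotientMap_torusProj.isQuotientMap.continuous_iff]
    have : descend u ∘ torusProj = fun x => ((u ((2 * Real.pi) • x) : ℝ) : ℂ) :=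
      funext fun x => descend_torusProj hp x
    rw [this]
    exact Complex.continuous_ofReal.comp (hcont.comp (continuous_const_smul _))
  have hs2 : Summable (UnitAddTorus.mFourierCoeff (⟨descend u, hcd⟩ : C(UnitAddTorus (Fin 2), ℂ))) :=
    hs.of_norm.congr fun k => (mFourierCoeff_descend hp k).symm
  have h := UnitAddTorus.hasSum_mFourier_series_apply_of_summable hs2
    (torusProj ((2 * Real.pi)⁻¹ • θ))
  have hθ : (2 * Real.pi) • ((2 * Real.pi)⁻¹ • θ) = θ := smul_inv_smul₀ (by positivity) θ
  simp only [mFourier_torusProj, hθ, smul_eq_mul, ContinuousMap.coe_mk, mFourierCoeff_descend hp,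
    descend_torusProj hp] at h
  convert h using 2 with k
  simp [chi, phase]

/-- A real analytic function on the torus has an absolutely convergent Fourier series with
exponential weights. -/
lemma exists_RWiener_of_analytic {u : Plane → ℝ} (hu : AnalyticOnNhd ℝ u Set.univ)
    (hp : IsPeriodic u) : ∃ ρ M : ℝ, 0 < ρ ∧ RWiener ρ M fun _ => u := by
  obtain ⟨C, ρ, hC, hρ, hb⟩ := exists_fourierCoef_bound hu hp
  have hterm : ∀ k : Fin 2 → ℤ, ‖fourierCoef u k‖ * Real.exp (ρ / 2 * wt (k, 0)) ≤
      C * Real.exp (-(ρ / 2 * (|(k 0 : ℝ)| + |(k 1 : ℝ)|))) := fun k => by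
    calc ‖fourierCoef u k‖ * Real.exp (ρ / 2 * wt (k, 0))
        ≤ C * Real.exp (-(ρ * (|(k 0 : ℝ)| + |(k 1 : ℝ)|))) * Real.exp (ρ / 2 * wt (k, 0)) := by
          gcongr
          exact hb k
      _ = _ := by
          rw [mul_assoc, ← Real.exp_add]
          simp only [wt, Int.cast_zero, abs_zero, add_zero]
          congr 2
          ring
  have hs : Summable fun k : Fin 2 → ℤ => ‖fourierCoef u k‖ * Real.exp (ρ / 2 * wt (k, 0)) :=
    Summable.of_nonneg_of_le (fun k => by positivity) hterm
      ((summable_exp_neg_lattice (half_pos hρ)).mul_left C)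
  have hs1 : Summable fun k : Fin 2 → ℤ => ‖fourierCoef u k‖ :=
    Summable.of_nonneg_of_le (fun k => norm_nonneg _)
      (fun k => le_mul_exp_wt (half_pos hρ).le _ (norm_nonneg _) _) hs
  exact ⟨ρ / 2, _, half_pos hρ, Fin 2 → ℤ, inferInstance, fourierCoef u, fun k => (k, 0), _,
    hs.hasSum, le_rfl, fun s θ => hasSum_fourierCoef (continuousOn_univ.1 hu.continuousOn) hp hs1 s θ⟩

/-! ### Joint analyticity -/

/-- The phase of a character as a linear function of the angles and the parameter. -/
def jointPhase (j : Freq) : Plane × ℝ →L[ℝ] ℝ :=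
  (phaseCLM j).comp (ContinuousLinearMap.fst ℝ Plane ℝ) +
    (j.2 : ℝ) • ContinuousLinearMap.snd ℝ Plane ℝ

lemma jointPhase_apply (j : Freq) (q : Plane × ℝ) : jointPhase j q = phase j q.2 q.1 := by
  simp [jointPhase, phase, phaseCLM_apply]

lemma norm_jointPhase_le (j : Freq) : ‖jointPhase j‖ ≤ wt j := by
  refine ContinuousLinearMap.opNorm_le_bound _ (wt_nonneg j) fun q => ?_
  rw [jointPhase_apply, Real.norm_eq_abs, wt, phase]
  have h0 := (norm_le_pi_norm q.1 0).trans (norm_fst_le q)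
  have h1 := (norm_le_pi_norm q.1 1).trans (norm_fst_le q)
  have h2 := norm_snd_le q
  rw [Real.norm_eq_abs] at h0 h1 h2
  calc _ ≤ |(j.1 0 : ℝ)| * |q.1 0| + |(j.1 1 : ℝ)| * |q.1 1| + |(j.2 : ℝ)| * |q.2| := by
        rw [← abs_mul, ← abs_mul, ← abs_mul]; exact abs_add_three _ _ _
    _ ≤ |(j.1 0 : ℝ)| * ‖q‖ + |(j.1 1 : ℝ)| * ‖q‖ + |(j.2 : ℝ)| * ‖q‖ := by gcongr
    _ = _ := by ring

lemma chi_add_joint (j : Freq) (q y : Plane × ℝ) :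
    chi j (q + y).2 (q + y).1 = chi j q.2 q.1 * Complex.exp (jointPhase j y * Complex.I) := by
  rw [chi, ← jointPhase_apply, map_add, chi, ← jointPhase_apply, ← Complex.exp_add]
  push_cast
  ring_nf

/-- Each character is the exponential of a linear function of `(θ, s)`, with Taylor coefficients at
most `wtⁿ/n!`. Summed against `ρⁿ` they give `exp(ρ wt)`, which is the weight in the norm. So the
rearranged series converges on the ball of radius `ρ` about every point. -/
lemma Wiener.analyticOnNhd {ρ M : ℝ} {u : ℝ → Plane → ℂ} (hρ : 0 < ρ) (h : Wiener ρ M u) :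
    AnalyticOnNhd ℝ (fun q : Plane × ℝ => u q.2 q.1) Set.univ := by
  obtain ⟨T, hT, c, j, B, hB, hBM, hu⟩ := h
  intro q _
  set L : T → (Plane × ℝ →L[ℝ] ℂ) := fun t =>
    (ContinuousLinearMap.smulRight (jointPhase (j t)) Complex.I) with hL
  have hLn : ∀ t, ‖L t‖ ≤ wt (j t) := fun t => by
    rw [hL]
    simp only [ContinuousLinearMap.norm_smulRight_apply, Complex.norm_I, mul_one]
    exact norm_jointPhase_le _
  have hLa : ∀ t y, L t y = jointPhase (j t) y * Complex.I := fun t y => by simp [hL]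
  set P : T → FormalMultilinearSeries ℝ (Plane × ℝ) ℂ := fun t n =>
    (c t * chi (j t) q.2 q.1 * (n.factorial : ℂ)⁻¹) •
      (ContinuousMultilinearMap.mkPiAlgebraFin ℝ n ℂ).compContinuousLinearMap fun _ => L t with hP
  have hPn : ∀ t n, ‖P t n‖ ≤ ‖c t‖ * (n.factorial : ℝ)⁻¹ * wt (j t) ^ n := fun t n => by
    rw [hP]
    simp only [norm_smul, norm_mul, norm_chi, mul_one, norm_inv, Complex.norm_natCast]
    gcongr
    refine (ContinuousMultilinearMap.norm_compContinuousLinearMap_le _ _).trans ?_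
    rw [ContinuousMultilinearMap.norm_mkPiAlgebraFin, one_mul, Finset.prod_const, Finset.card_fin]
    exact pow_le_pow_left₀ (norm_nonneg _) (hLn t) _
  have hPa : ∀ t n y, P t n (fun _ => y) =
      c t * chi (j t) q.2 q.1 * ((n.factorial : ℝ)⁻¹ • L t y ^ n) := fun t n y => by
    simp [hP, mul_assoc, ContinuousMultilinearMap.mkPiAlgebraFin_apply, List.ofFn_const]
  have hexp : ∀ t, HasSum (fun n : ℕ => ‖c t‖ * (n.factorial : ℝ)⁻¹ * wt (j t) ^ n * ρ ^ n)
      (‖c t‖ * Real.exp (ρ * wt (j t))) := fun t => by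
    have h1 := (NormedSpace.exp_series_hasSum_exp' (𝕂 := ℝ) (ρ * wt (j t))).mul_left ‖c t‖
    rw [← Real.exp_eq_exp_ℝ] at h1
    have h2 : (fun n : ℕ => ‖c t‖ * (n.factorial : ℝ)⁻¹ * wt (j t) ^ n * ρ ^ n) =
        fun n : ℕ => ‖c t‖ * ((n.factorial : ℝ)⁻¹ • (ρ * wt (j t)) ^ n) := funext fun n => by
      rw [smul_eq_mul, mul_pow]
      ring
    rw [h2]
    exact h1
  -- Absolute summability over characters and orders justifies exchanging the two sums.
  have hdouble : Summable fun p : T × ℕ =>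
      ‖c p.1‖ * (p.2.factorial : ℝ)⁻¹ * wt (j p.1) ^ p.2 * ρ ^ p.2 := by
    rw [summable_prod_of_nonneg (fun p => by have := wt_nonneg (j p.1); positivity)]
    refine ⟨fun t => (hexp t).summable, ?_⟩
    simp only [(hexp _).tsum_eq]
    exact hB.summable
  have hle : ∀ n t, ‖P t n‖ * ρ ^ n ≤ ‖c t‖ * Real.exp (ρ * wt (j t)) := fun n t =>
    (mul_le_mul_of_nonneg_right (hPn t n) (by positivity)).trans
      (le_hasSum (hexp t) n fun m _ => by have := wt_nonneg (j t); positivity)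
  have hsP : ∀ n, Summable fun t => ‖P t n‖ := fun n => by
    have : Summable fun t => ‖P t n‖ * ρ ^ n :=
      Summable.of_nonneg_of_le (fun t => by positivity) (hle n) hB.summable
    exact (summable_mul_right_iff (by positivity)).1 this
  refine ⟨fun n => ∑' t, P t n, ENNReal.ofReal ρ, ?_, by simpa using hρ, fun {y} hy => ?_⟩
  · refine FormalMultilinearSeries.le_radius_of_bound _ B (r := ρ.toNNReal) fun n => ?_
    rw [Real.coe_toNNReal _ hρ.le]
    calc ‖∑' t, P t n‖ * ρ ^ n ≤ (∑' t, ‖P t n‖) * ρ ^ n := by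
          gcongr; exact norm_tsum_le_tsum_norm (hsP n)
      _ = ∑' t, ‖P t n‖ * ρ ^ n := by rw [tsum_mul_right]
      _ ≤ B := by
          rw [← hB.tsum_eq]
          exact ((hsP n).mul_right _).tsum_le_tsum (hle n) hB.summable
  · have hyn : ‖y‖ < ρ := by
      simpa [Metric.mem_eball, edist_zero_right, ← ofReal_norm, ENNReal.ofReal_lt_ofReal_iff hρ] using hy
    have hF : Summable fun p : T × ℕ => P p.1 p.2 fun _ => y := by
      refine Summable.of_norm_bounded hdouble fun p => ?_
      refine ((P p.1 p.2).le_opNorm _).trans ?_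
      rw [Finset.prod_const, Finset.card_fin]
      have := wt_nonneg (j p.1)
      have := hPn p.1 p.2
      gcongr
    have h1 : ∀ t, HasSum (fun n => P t n fun _ => y) (c t * chi (j t) (q + y).2 (q + y).1) :=
      fun t => by
      rw [chi_add_joint, ← mul_assoc, ← hLa]
      simp only [hPa]
      have h2 := NormedSpace.exp_series_hasSum_exp' (𝕂 := ℝ) (L t y)
      rw [← Complex.exp_eq_exp_ℂ] at h2
      exact h2.mul_left _
    have h2 : HasSum (fun p : T × ℕ => P p.1 p.2 fun _ => y) (u (q + y).2 (q + y).1) := by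
      have h3 := hF.hasSum.prod_fiberwise h1
      rw [(hu _ _).unique h3]
      exact hF.hasSum
    have h4 : ∀ n, HasSum (fun t => P t n fun _ => y) ((∑' t, P t n) fun _ => y) := fun n =>
      (hsP n).of_norm.hasSum.mapL
        (ContinuousMultilinearMap.apply ℝ (fun _ : Fin n => Plane × ℝ) ℂ (fun _ => y))
    exact ((Equiv.prodComm ℕ T).hasSum_iff.2 h2).prod_fiberwise h4

lemma RWiener.analyticOnNhd {ρ M : ℝ} {u : ℝ → Plane → ℝ} (hρ : 0 < ρ) (h : RWiener ρ M u) :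
    AnalyticOnNhd ℝ (fun q : Plane × ℝ => u q.2 q.1) Set.univ := fun q hq => by
  simpa [Function.comp_def] using (Complex.reCLM.analyticAt _).comp (Wiener.analyticOnNhd hρ h q hq)

lemma RWiener.periodic {ρ M : ℝ} {u : ℝ → Plane → ℝ} (h : RWiener ρ M u) (s : ℝ) :
    IsPeriodic (u s) := fun θ k => by
  obtain ⟨T, hT, c, j, B, hB, hBM, hu⟩ := h
  have h1 := hu s (θ + latticeVec k)
  simp only [chi_periodic _ _ θ k] at h1
  exact Complex.ofReal_injective (h1.unique (hu s θ))

/-! ### Analytic families of torus diffeomorphisms -/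

/-- The analytic local inverse of `f` agrees with `g` near `y` because `f` is injective. No
continuity of `g` is assumed. -/
lemma analyticAt_of_rightInverse {E F : Type*} [NormedAddCommGroup E] [NormedSpace ℝ E]
    [CompleteSpace E] [NormedAddCommGroup F] [NormedSpace ℝ F] [CompleteSpace F] {f : E → F}
    {g : F → E} {y : F} (hinj : Function.Injective f) (hg : ∀ y, f (g y) = y)
    (hf : AnalyticAt ℝ f (g y)) (hb : Function.Bijective (fderiv ℝ f (g y))) :
    AnalyticAt ℝ g y := by
  let i : E ≃L[ℝ] F := ContinuousLinearEquiv.ofBijective (fderiv ℝ f (g y))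
    (LinearMap.ker_eq_bot.2 hb.1) (LinearMap.range_eq_top.2 hb.2)
  have hi : fderiv ℝ f (g y) = i := rfl
  have hs : HasStrictFDerivAt f (i : E →L[ℝ] F) (g y) := hi ▸ hf.hasStrictFDerivAt
  have h1 := (hs.toOpenPartialHomeomorph f).analyticAt_symm' (a := g y) (i := i)
    hs.mem_toOpenPartialHomeomorph_source hf hi
  have h2 : f (g y) ∈ (hs.toOpenPartialHomeomorph f).target :=
    hs.image_mem_toOpenPartialHomeomorph_target
  rw [hs.toOpenPartialHomeomorph_coe, hg] at h1
  rw [hg] at h2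
  refine h1.congr ?_
  filter_upwards [(hs.toOpenPartialHomeomorph f).open_target.mem_nhds h2] with z hz
  apply hinj
  rw [hg]
  exact (hs.toOpenPartialHomeomorph f).right_inv hz

lemma fderiv_apply_eq_jacobian {f : Plane → Plane} {θ : Plane} (hf : DifferentiableAt ℝ f θ)
    (z : Plane) : fderiv ℝ f θ z = jacobian f θ *ᵥ z := by
  ext i
  rw [jacobian_mulVec, dotProduct_partials, fderiv_apply hf]
  rfl

lemma norm_mulVec_le {J : Matrix (Fin 2) (Fin 2) ℝ} (hJ : ∀ i j, |J i j| ≤ 1 / 8) (z : Plane) :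
    ‖J *ᵥ z‖ ≤ 1 / 4 * ‖z‖ := by
  refine (pi_norm_le_iff_of_nonneg (by positivity)).2 fun i => ?_
  simp only [Matrix.mulVec, dotProduct, Fin.sum_univ_two, Real.norm_eq_abs]
  have h0 := norm_le_pi_norm z 0
  have h1 := norm_le_pi_norm z 1
  rw [Real.norm_eq_abs] at h0 h1
  calc |J i 0 * z 0 + J i 1 * z 1| ≤ |J i 0| * |z 0| + |J i 1| * |z 1| := by
        rw [← abs_mul, ← abs_mul]; exact abs_add_le _ _
    _ ≤ 1 / 8 * ‖z‖ + 1 / 8 * ‖z‖ := by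
        gcongr <;> exact hJ _ _
    _ = _ := by ring

lemma eq_zero_of_add_mulVec {J : Matrix (Fin 2) (Fin 2) ℝ} (hJ : ∀ i j, |J i j| ≤ 1 / 8)
    {z : Plane} (h : z + J *ᵥ z = 0) : z = 0 := by
  have h1 := norm_mulVec_le hJ z
  rw [show J *ᵥ z = -z from eq_neg_of_add_eq_zero_right h, norm_neg] at h1
  exact norm_eq_zero.1 (by linarith [norm_nonneg z])

/-- The map is a perturbation of the identity with Lipschitz constant `1/4`, which is less than `1`,
so it is globally injective and surjective. -/
lemma bijective_add_of_jacobian {f : Plane → Plane} (hf : Differentiable ℝ f)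
    (hJ : ∀ θ i j, |jacobian f θ i j| ≤ 1 / 8) : Function.Bijective fun θ => θ + f θ := by
  have hb : ∀ θ, ‖fderiv ℝ f θ‖ ≤ 1 / 4 := fun θ =>
    ContinuousLinearMap.opNorm_le_bound _ (by norm_num) fun z => by
      rw [fderiv_apply_eq_jacobian (hf θ)]
      exact norm_mulVec_le (hJ θ) z
  have hA : ApproximatesLinearOn (fun θ => θ + f θ)
      ((ContinuousLinearEquiv.refl ℝ Plane : Plane ≃L[ℝ] Plane) : Plane →L[ℝ] Plane) Set.univ
      (1 / 4) := fun x _ y _ => by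
    have := convex_univ.norm_image_sub_le_of_norm_fderiv_le (𝕜 := ℝ) (fun x _ => hf x)
      (fun x _ => hb x) (Set.mem_univ y) (Set.mem_univ x)
    have e : x + f x - (y + f y) - (x - y) = f x - f y := by abel
    simpa [e] using this
  have hN : ‖((ContinuousLinearEquiv.refl ℝ Plane).symm : Plane →L[ℝ] Plane)‖₊ = 1 :=
    ContinuousLinearMap.nnnorm_id
  have hc : Subsingleton Plane ∨
      (1 / 4 : NNReal) < ‖((ContinuousLinearEquiv.refl ℝ Plane).symm : Plane →L[ℝ] Plane)‖₊⁻¹ := by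
    right
    rw [hN, inv_one, ← NNReal.coe_lt_coe]
    norm_num
  exact ⟨Set.injOn_univ.1 (hA.injOn hc), hA.surjective hc⟩

section Family

variable {v : ℝ → Plane → Plane}

lemma bijective_fderiv_id_add {f : Plane → Plane} {θ : Plane} (hf : DifferentiableAt ℝ f θ)
    (hJ : ∀ i j, |jacobian f θ i j| ≤ 1 / 8) :
    Function.Bijective (fderiv ℝ (fun θ => θ + f θ) θ) := by
  have h : ∀ z, fderiv ℝ (fun θ => θ + f θ) θ z = z + jacobian f θ *ᵥ z := fun z => by
    rw [fderiv_fun_add differentiableAt_fun_id hf, ← fderiv_apply_eq_jacobian hf]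
    simp
  have hi : Function.Injective (fderiv ℝ (fun θ => θ + f θ) θ) := by
    rw [injective_iff_map_eq_zero]
    intro z hz
    rw [h] at hz
    exact eq_zero_of_add_mulVec hJ hz
  exact ⟨hi, LinearMap.injective_iff_surjective.1 hi⟩

/-- The inverses of the maps `θ ↦ θ + v s θ` form an analytic family. -/
lemma exists_analytic_inverse (hv : AnalyticOnNhd ℝ (fun q : Plane × ℝ => v q.2 q.1) Set.univ)
    (hJ : ∀ s θ i j, |jacobian (v s) θ i j| ≤ 1 / 8) :
    ∃ g : Plane × ℝ → Plane, AnalyticOnNhd ℝ g Set.univ ∧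
      (∀ φ s, g (φ, s) + v s (g (φ, s)) = φ) ∧ ∀ θ s, g (θ + v s θ, s) = θ := by
  have hsl : ∀ s, AnalyticOnNhd ℝ (v s) Set.univ := fun s θ _ =>
    AnalyticAt.fun_comp (g := fun q : Plane × ℝ => v q.2 q.1) (f := fun θ => (θ, s))
      (hv (θ, s) (Set.mem_univ _)) (analyticAt_id.prod analyticAt_const)
  have hd : ∀ s, Differentiable ℝ (v s) := fun s θ => (hsl s θ (Set.mem_univ θ)).differentiableAt
  have hbij := fun s => bijective_add_of_jacobian (hd s) (hJ s)
  choose g' hg' using fun s => (hbij s).2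
  simp only at hg'
  set Ξ : Plane × ℝ → Plane × ℝ := fun q => (q.1 + v q.2 q.1, q.2) with hΞ
  have hinj : Function.Injective Ξ := by
    rintro ⟨θ, s⟩ ⟨θ', s'⟩ h
    simp only [hΞ, Prod.mk.injEq] at h
    obtain ⟨h1, rfl⟩ := h
    rw [(hbij s).1 h1]
  have hΞa : AnalyticOnNhd ℝ Ξ Set.univ := fun q hq =>
    (analyticAt_fst.add (hv q hq)).prod analyticAt_snd
  have hΞb : ∀ q, Function.Bijective (fderiv ℝ Ξ q) := fun q => by
    obtain ⟨θ, s⟩ := q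
    have hdq : DifferentiableAt ℝ Ξ (θ, s) := (hΞa _ (Set.mem_univ _)).differentiableAt
    have h2 : ∀ z, (fderiv ℝ Ξ (θ, s) z).2 = z.2 := fun z => by
      have := (hasFDerivAt_snd (𝕜 := ℝ) (p := Ξ (θ, s))).comp (θ, s) hdq.hasFDerivAt
      have h3 : HasFDerivAt (Prod.snd ∘ Ξ) (ContinuousLinearMap.snd ℝ Plane ℝ) (θ, s) :=
        hasFDerivAt_snd
      exact congrArg (fun L => L z) (this.unique h3)
    have h1 : ∀ z, (fderiv ℝ Ξ (θ, s) (z, 0)).1 = fderiv ℝ (fun θ => θ + v s θ) θ z := fun z => by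
      have h4 := (hasFDerivAt_fst (𝕜 := ℝ) (p := Ξ (θ, s))).comp (θ, s) hdq.hasFDerivAt
      have h5 : HasFDerivAt (fun θ : Plane => (θ, s)) (ContinuousLinearMap.inl ℝ Plane ℝ) θ :=
        hasFDerivAt_prodMk_left θ s
      have h6 := h4.comp θ h5
      have h7 : (Prod.fst ∘ Ξ) ∘ (fun θ : Plane => (θ, s)) = fun θ => θ + v s θ := rfl
      rw [h7] at h6
      rw [h6.fderiv]
      simp
    have hi : Function.Injective (fderiv ℝ Ξ (θ, s)) := by
      rw [injective_iff_map_eq_zero]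
      rintro ⟨z, t⟩ hz
      have ht : t = 0 := by have := h2 (z, t); rw [hz] at this; exact this.symm
      subst ht
      have hz0 : fderiv ℝ (fun θ => θ + v s θ) θ z = 0 := by rw [← h1, hz]; rfl
      rw [(map_eq_zero_iff _ (bijective_fderiv_id_add (hd s θ) (hJ s θ)).1).1 hz0]
      rfl
    exact ⟨hi, LinearMap.injective_iff_surjective.1 hi⟩
  have hG : ∀ p : Plane × ℝ, Ξ (g' p.2 p.1, p.2) = p := fun p => by
    simp only [hΞ, hg']
  refine ⟨fun p => g' p.2 p.1, fun p _ => ?_, fun φ s => hg' s φ, fun θ s => (hbij s).1 (hg' s _)⟩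
  have := analyticAt_of_rightInverse (f := Ξ) (g := fun p => (g' p.2 p.1, p.2)) (y := p) hinj hG
    (hΞa _ (Set.mem_univ _)) (hΞb _)
  exact analyticAt_fst.fun_comp this

end Family

lemma periodic_vec {v : Plane → Plane} (h : ∀ i, IsPeriodic fun θ => v θ i) : IsPeriodic v :=
  fun x k => funext fun i => h i x k

lemma isAnalyticTorusDiffeo_id_add {f : Plane → Plane} (hf : AnalyticOnNhd ℝ f Set.univ)
    (hp : IsPeriodic f) (hJ : ∀ θ i j, |jacobian f θ i j| ≤ 1 / 8) :
    IsAnalyticTorusDiffeo fun θ => θ + f θ := by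
  have hd : Differentiable ℝ f := fun θ => (hf θ (Set.mem_univ θ)).differentiableAt
  refine ⟨analyticOnNhd_id.add hf, bijective_add_of_jacobian hd hJ,
    fun θ => bijective_fderiv_id_add (hd θ) (hJ θ), 1, by simp, fun x k => ?_⟩
  show x + latticeVec k + f (x + latticeVec k) = x + f x + latticeVec (1 *ᵥ k)
  rw [Matrix.one_mulVec, hp x k]
  abel

lemma analyticOnNhd_left {F : Type*} [NormedAddCommGroup F] [NormedSpace ℝ F] {f : Plane × ℝ → F}
    (hf : AnalyticOnNhd ℝ f Set.univ) (s : ℝ) : AnalyticOnNhd ℝ (fun φ => f (φ, s)) Set.univ :=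
  fun φ _ => AnalyticAt.fun_comp (g := f) (f := fun φ => (φ, s)) (hf (φ, s) (Set.mem_univ _))
    (analyticAt_id.prod analyticAt_const)

lemma analyticOnNhd_right {F : Type*} [NormedAddCommGroup F] [NormedSpace ℝ F] {f : Plane × ℝ → F}
    (hf : AnalyticOnNhd ℝ f Set.univ) (φ : Plane) : AnalyticOnNhd ℝ (fun s => f (φ, s)) Set.univ :=
  fun s _ => AnalyticAt.fun_comp (g := f) (f := fun s => (φ, s)) (hf (φ, s) (Set.mem_univ _))
    (analyticAt_const.prod analyticAt_id)

lemma analyticAt_dotProduct {E : Type*} [NormedAddCommGroup E] [NormedSpace ℝ E]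
    {f g : E → Fin 2 → ℝ} {x : E} (hf : ∀ i, AnalyticAt ℝ (fun x => f x i) x)
    (hg : ∀ i, AnalyticAt ℝ (fun x => g x i) x) : AnalyticAt ℝ (fun x => f x ⬝ᵥ g x) x := by
  simp only [dotProduct, Fin.sum_univ_two]
  exact ((hf 0).fun_mul (hg 0)).fun_add ((hf 1).fun_mul (hg 1))

lemma analyticAt_mulVec {E : Type*} [NormedAddCommGroup E] [NormedSpace ℝ E]
    {A : E → Matrix (Fin 2) (Fin 2) ℝ} {g : E → Fin 2 → ℝ} {x : E}
    (hA : ∀ i j, AnalyticAt ℝ (fun x => A x i j) x)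
    (hg : ∀ i, AnalyticAt ℝ (fun x => g x i) x) (i : Fin 2) :
    AnalyticAt ℝ (fun x => (A x *ᵥ g x) i) x :=
  analyticAt_dotProduct (fun j => hA i j) hg

lemma fderiv_left {F : Type*} [NormedAddCommGroup F] [NormedSpace ℝ F] {f : Plane × ℝ → F}
    {θ : Plane} {s : ℝ} (hf : DifferentiableAt ℝ f (θ, s)) (z : Plane) :
    fderiv ℝ (fun φ => f (φ, s)) θ z = fderiv ℝ f (θ, s) (z, 0) := by
  have h2 := hf.hasFDerivAt.comp θ (hasFDerivAt_prodMk_left (𝕜 := ℝ) θ s)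
  have h3 : f ∘ (fun θ : Plane => (θ, s)) = fun φ => f (φ, s) := rfl
  rw [h3] at h2
  rw [h2.fderiv]
  simp

lemma analyticOnNhd_partials {f : Plane × ℝ → ℝ} (hf : AnalyticOnNhd ℝ f Set.univ) (i : Fin 2) :
    AnalyticOnNhd ℝ (fun q : Plane × ℝ => partials (fun φ => f (φ, q.2)) q.1 i) Set.univ := by
  have h : (fun q : Plane × ℝ => partials (fun φ => f (φ, q.2)) q.1 i) = fun q =>
      ContinuousLinearMap.apply ℝ ℝ ((Pi.single i 1, 0) : Plane × ℝ) (fderiv ℝ f q) :=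
    funext fun q => fderiv_left (hf q (Set.mem_univ _)).differentiableAt _
  rw [h]
  exact fun q hq => (ContinuousLinearMap.analyticAt _ _).fun_comp (hf.fderiv q hq)

/-! ### From invariant tori to vector fields on the surface. -/

/-- The closed form and the field are carried from the torus coordinates `θ` to the surface
coordinates `φ = θ + v`. In these the field is `ω + P₀(∂H + α)`, the push-forward of `ω` by `θ ↦ θ +
v`. -/
lemma exists_invariant_fields {ω : Fin 2 → ℝ} {N : ℕ} {C ρ b c : ℝ}
    {P₀ G : Plane → Matrix (Fin 2) (Fin 2) ℝ} {Q₀ : Matrix (Fin 2) (Fin 2) ℝ}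
    (hω : SmallDivisorBound ω N C) (hC : 1 ≤ C) (hsymm : ∀ θ, (P₀ θ)ᵀ = P₀ θ)
    (hGP : ∀ θ, G θ * P₀ θ = 1)
    (hG : ∀ i j, AnalyticOnNhd ℝ (fun θ => G θ i j) Set.univ) (hρ : 0 < ρ)
    (hP₀ : MatWiener ρ b fun _ => P₀) (hV : RWiener ρ c fun _ θ => ω ⬝ᵥ (G θ *ᵥ ω))
    (hQ₀ : (Matrix.of fun i j => torusMean fun θ => P₀ θ i j) * Q₀ = 1) :
    ∃ β > 0, ∃ (H : Plane × ℝ → ℝ) (α : ℝ → Fin 2 → ℝ) (e : ℝ → ℝ) (v : ℝ → Plane → Plane),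
      AnalyticOnNhd ℝ H Set.univ ∧ AnalyticOnNhd ℝ α Set.univ ∧ AnalyticOnNhd ℝ e Set.univ ∧
      AnalyticOnNhd ℝ (fun q : Plane × ℝ => v q.2 q.1) Set.univ ∧
      (∀ s, IsPeriodic (v s)) ∧ (∀ s, IsPeriodic fun φ => H (φ, s)) ∧
      (∀ s, IsAnalyticTorusDiffeo fun θ => θ + v s θ) ∧
      (∀ s θ, P₀ (θ + v s θ) *ᵥ (partials (fun φ => H (φ, s)) (θ + v s θ) + α s) =
        jacobian (v s) θ *ᵥ ω) ∧
      (∀ s φ, (ω + P₀ φ *ᵥ (partials (fun φ => H (φ, s)) φ + α s)) ⬝ᵥ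
        (G φ *ᵥ (ω + P₀ φ *ᵥ (partials (fun φ => H (φ, s)) φ + α s))) =
          (1 + β * Real.sin s) * (ω ⬝ᵥ (G φ *ᵥ ω)) + e s) ∧
      v 0 = 0 ∧ (∀ φ, H (φ, 0) = 0) ∧ α 0 = 0 ∧ e 0 = 0 := by
  have hGc : Continuous G := continuous_matrix fun i j => continuousOn_univ.1 (hG i j).continuousOn
  obtain ⟨β, hβ, r, hr, v, h, α, e, hv, hh, hα, hJ, hform, hnorm, hv0, hh0, hα0⟩ :=
    exists_invariant_tori hω hC hsymm hGP hGc hρ hP₀ hV hQ₀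
  have hva : AnalyticOnNhd ℝ (fun q : Plane × ℝ => v q.2 q.1) Set.univ :=
    AnalyticOnNhd.pi fun i => (hv i).analyticOnNhd hr
  have hha := hh.analyticOnNhd hr
  have hαa : AnalyticOnNhd ℝ α Set.univ := AnalyticOnNhd.pi fun i =>
    analyticOnNhd_right ((hα i).analyticOnNhd hr) 0
  have hsl : ∀ s, AnalyticOnNhd ℝ (v s) Set.univ := analyticOnNhd_left hva
  have hvp : ∀ s, IsPeriodic (v s) := fun s => periodic_vec fun i => (hv i).periodic s
  have hvd : ∀ s, Differentiable ℝ (v s) := fun s θ => (hsl s θ (Set.mem_univ θ)).differentiableAt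
  obtain ⟨g, hga, hgr, hgl⟩ := exists_analytic_inverse hva hJ
  have hgp : ∀ s φ k, g (φ + latticeVec k, s) = g (φ, s) + latticeVec k := fun s φ k => by
    have h1 := hgl (g (φ, s) + latticeVec k) s
    rw [hvp s _ k, add_right_comm, hgr] at h1
    exact h1
  -- The inverse `g` is the identity plus a periodic function, so the form `dh + α` becomes `dH + α`
  -- with the same constant part. The correction `α · (g - φ)` is periodic and carries the change of
  -- the primitive.
  set H : Plane × ℝ → ℝ := fun q => h q.2 (g q) + α q.2 ⬝ᵥ (g q - q.1) with hH
  have hHa : AnalyticOnNhd ℝ H Set.univ := by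
    intro q _
    have h1 : AnalyticAt ℝ (fun q : Plane × ℝ => h q.2 (g q)) q :=
      AnalyticAt.fun_comp (g := fun q : Plane × ℝ => h q.2 q.1) (f := fun q => (g q, q.2))
        (hha _ (Set.mem_univ _)) ((hga q (Set.mem_univ q)).prod analyticAt_snd)
    have h2 : AnalyticAt ℝ (fun q : Plane × ℝ => α q.2) q :=
      (hαa _ (Set.mem_univ _)).fun_comp analyticAt_snd
    have h3 : AnalyticAt ℝ (fun q : Plane × ℝ => g q - q.1) q :=
      (hga q (Set.mem_univ q)).sub analyticAt_fst
    rw [analyticAt_pi_iff] at h2 h3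
    simp only [hH, dotProduct, Fin.sum_univ_two]
    exact h1.add (((h2 0).mul (h3 0)).add ((h2 1).mul (h3 1)))
  have hHs : ∀ s, AnalyticOnNhd ℝ (fun φ => H (φ, s)) Set.univ := analyticOnNhd_left hHa
  have hHd : ∀ s φ, DifferentiableAt ℝ (fun φ => H (φ, s)) φ := fun s φ =>
    (hHs s φ (Set.mem_univ _)).differentiableAt
  have hhd : ∀ s θ, DifferentiableAt ℝ (h s) θ := fun s θ =>
    (analyticOnNhd_left hha s θ (Set.mem_univ _)).differentiableAt
  have hvd' : ∀ s θ i, DifferentiableAt ℝ (fun y => v s y i) θ := fun s θ i =>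
    differentiableAt_pi.1 (hvd s θ) i
  have hHx : ∀ s θ, H (θ + v s θ, s) = h s θ + -(α s ⬝ᵥ v s θ) := fun s θ => by
    simp only [hH, hgl, ← dotProduct_neg]
    congr 2
    abel
  have hd1 : ∀ s θ, (1 + jacobian (v s) θ)ᵀ *ᵥ (partials (fun φ => H (φ, s)) (θ + v s θ) + α s) =
      (1 + jacobian (v s) θ)ᵀ *ᵥ (G (θ + v s θ) *ᵥ (jacobian (v s) θ *ᵥ ω)) := fun s θ => by
    have hdot : DifferentiableAt ℝ (fun y => α s ⬝ᵥ v s y) θ := by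
      simp only [dotProduct, Fin.sum_univ_two]
      exact ((hvd' s θ 0).const_mul _).add ((hvd' s θ 1).const_mul _)
    rw [hform, Matrix.mulVec_add, ← partials_comp (hHd s _) (hvd' s θ)]
    simp only [hHx]
    rw [partials_add (hhd s θ) hdot.fun_neg, partials_neg, partials_dot_const _ (hvd' s θ)]
    simp only [Matrix.transpose_add, Matrix.add_mulVec, Matrix.transpose_one, Matrix.one_mulVec]
    abel
  have hinjT : ∀ s θ, Function.Injective ((1 + jacobian (v s) θ)ᵀ *ᵥ ·) := fun s θ => by
    have h1 : Function.Injective (1 + jacobian (v s) θ).mulVec := by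
      intro x y hxy
      have : (1 + jacobian (v s) θ) *ᵥ (x - y) = 0 := by rw [Matrix.mulVec_sub, sub_eq_zero]; exact hxy
      rw [Matrix.add_mulVec, Matrix.one_mulVec] at this
      exact sub_eq_zero.1 (eq_zero_of_add_mulVec (hJ s θ) this)
    have h2 := Matrix.mulVec_injective_iff_isUnit.1 h1
    exact Matrix.mulVec_injective_iff_isUnit.2 ((Matrix.isUnit_transpose _).2 h2)
  have hP : ∀ θ, P₀ θ * G θ = 1 := fun θ => mul_eq_one_comm.1 (hGP θ)
  have hZ : ∀ s θ, P₀ (θ + v s θ) *ᵥ (partials (fun φ => H (φ, s)) (θ + v s θ) + α s) =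
        jacobian (v s) θ *ᵥ ω := fun s θ => by
    rw [hinjT s θ (hd1 s θ), Matrix.mulVec_mulVec, hP, Matrix.one_mulVec]
  have hN : ∀ s φ, (ω + P₀ φ *ᵥ (partials (fun φ => H (φ, s)) φ + α s)) ⬝ᵥ
        (G φ *ᵥ (ω + P₀ φ *ᵥ (partials (fun φ => H (φ, s)) φ + α s))) =
          (1 + β * Real.sin s) * (ω ⬝ᵥ (G φ *ᵥ ω)) + e s := fun s φ => by
    have h1 := hnorm s (g (φ, s))
    rw [← hZ s (g (φ, s)), hgr] at h1
    exact h1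
  have hg0 : ∀ φ, g (φ, 0) = φ := fun φ => by
    have := hgr φ 0
    rwa [hv0, Pi.zero_apply, add_zero] at this
  have hH0 : ∀ φ, H (φ, 0) = 0 := fun φ => by
    simp only [hH, hh0, hα0, Pi.zero_apply, zero_dotProduct, add_zero]
  have he0 : e 0 = 0 := by
    have h1 := hN 0 0
    simp only [hH0, hα0, partials_zero, add_zero, Matrix.mulVec_zero, Real.sin_zero, mul_zero,
      one_mul] at h1
    linarith
  have hea : AnalyticOnNhd ℝ e Set.univ := by
    intro s _
    have hs : ∀ i j, AnalyticAt ℝ (fun s => G (v s 0) i j) s := fun i j =>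
      (hG i j _ (Set.mem_univ _)).fun_comp
        (analyticOnNhd_right hva 0 s (Set.mem_univ _))
    have hj : ∀ i j, AnalyticAt ℝ (fun s => jacobian (v s) 0 i j) s := fun i j =>
      analyticOnNhd_right (analyticOnNhd_partials (f := fun q => v q.2 q.1 i)
        (fun q hq => analyticAt_pi_iff.1 (hva q hq) i) j) 0 s (Set.mem_univ _)
    -- The energy does not depend on `θ`, so it can be read off at `θ = 0`, where all the terms are
    -- analytic in `s`.
    have he : e = fun s => (ω + jacobian (v s) 0 *ᵥ ω) ⬝ᵥ (G (v s 0) *ᵥ (ω + jacobian (v s) 0 *ᵥ ω))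
        - (1 + β * Real.sin s) * (ω ⬝ᵥ (G (v s 0) *ᵥ ω)) := funext fun s => by
      have := hnorm s 0
      rw [zero_add] at this
      rw [this]
      ring
    have hsin : AnalyticAt ℝ Real.sin s := Real.analyticAt_sin
    rw [he]
    have hc : ∀ i, AnalyticAt ℝ (fun _ : ℝ => ω i) s := fun _ => analyticAt_const
    have hJω : ∀ i, AnalyticAt ℝ (fun s => (ω + jacobian (v s) 0 *ᵥ ω) i) s := fun i =>
      (hc i).fun_add (analyticAt_mulVec hj hc i)
    exact (analyticAt_dotProduct hJω (analyticAt_mulVec hs hJω)).fun_sub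
      ((analyticAt_const.fun_add (analyticAt_const.fun_mul hsin)).fun_mul
        (analyticAt_dotProduct hc (analyticAt_mulVec hs hc)))
  refine ⟨β, hβ, H, α, e, v, hHa, hαa, hea, hva, hvp, fun s φ k => ?_,
    fun s => isAnalyticTorusDiffeo_id_add (hsl s) (hvp s) (hJ s), hZ, hN, hv0, hH0, hα0, he0⟩
  simp only [hH, hgp, hh.periodic s _ k]
  congr 2
  abel

/-! ### Transversality of the family -/

lemma torusIntegral_add {f g : Plane → ℝ} (hf : Continuous f) (hg : Continuous g) :
    torusIntegral (fun x => f x + g x) = torusIntegral f + torusIntegral g :=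
  MeasureTheory.integral_add (hf.continuousOn.integrableOn_compact isCompact_Icc)
    (hg.continuousOn.integrableOn_compact isCompact_Icc)

lemma torusIntegral_const_mul (a : ℝ) (f : Plane → ℝ) :
    torusIntegral (fun x => a * f x) = a * torusIntegral f :=
  MeasureTheory.integral_const_mul _ _

lemma torusMean_const (a : ℝ) : torusMean (fun _ => a) = a := by
  have h : torusIntegral (fun _ => a) = 4 * Real.pi ^ 2 * a := by
    have := MeasureTheory.setIntegral_const (μ := MeasureTheory.volume) (s := cell) a
    rw [volume_cell, smul_eq_mul] at this
    exact this
  rw [torusMean, h, inv_mul_cancel_left₀ (by positivity)]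

lemma torusMean_add {f g : Plane → ℝ} (hf : Continuous f) (hg : Continuous g) :
    torusMean (fun x => f x + g x) = torusMean f + torusMean g := by
  rw [torusMean, torusIntegral_add hf hg, mul_add]; rfl

lemma torusMean_const_mul (a : ℝ) (f : Plane → ℝ) :
    torusMean (fun x => a * f x) = a * torusMean f := by
  rw [torusMean, torusIntegral_const_mul, mul_left_comm]; rfl

lemma torusIntegral_mulVec {A : Plane → Matrix (Fin 2) (Fin 2) ℝ}
    (hA : ∀ i j, Continuous fun x => A x i j) (a : Fin 2 → ℝ) (i : Fin 2) :
    ((Matrix.of fun i j => torusIntegral fun x => A x i j) *ᵥ a) i =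
      torusIntegral fun x => (A x *ᵥ a) i := by
  simp only [Matrix.mulVec, dotProduct, Fin.sum_univ_two, Matrix.of_apply]
  rw [torusIntegral_add ((hA i 0).fun_mul continuous_const) ((hA i 1).fun_mul continuous_const)]
  simp only [mul_comm _ (a _), torusIntegral_const_mul]

lemma continuous_partials {u : Plane → ℝ} (hu : ContDiff ℝ 1 u) (i : Fin 2) :
    Continuous fun x => partials u x i :=
  (hu.continuous_fderiv one_ne_zero).clm_apply continuous_const

lemma torusIntegral_dotProduct_partials (ω : Fin 2 → ℝ) {u : Plane → ℝ} (hu : ContDiff ℝ 1 u)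
    (hp : IsPeriodic u) : torusIntegral (fun x => ω ⬝ᵥ partials u x) = 0 := by
  simp only [dotProduct, Fin.sum_univ_two]
  rw [torusIntegral_add (continuous_const.fun_mul (continuous_partials hu 0))
    (continuous_const.fun_mul (continuous_partials hu 1)), torusIntegral_const_mul,
    torusIntegral_const_mul]
  have h0 : ∀ i, torusIntegral (fun x => partials u x i) = 0 := integral_fderiv_eq_zero hu hp
  rw [h0, h0, mul_zero, mul_zero, add_zero]

lemma fourierCoef_dotProduct_partials (ω : Fin 2 → ℝ) {u : Plane → ℝ} (hu : ContDiff ℝ 1 u)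
    (hp : IsPeriodic u) (k : Fin 2 → ℤ) :
    fourierCoef (fun x => ω ⬝ᵥ partials u x) k =
      (Complex.I * (k 0 * ω 0 + k 1 * ω 1 : ℝ)) * fourierCoef u k := by
  have hc : ∀ i, ContinuousOn (fun θ => ((partials u θ i : ℝ) : ℂ) * chi (-k, 0) 0 θ) cell :=
    fun i => ((Complex.continuous_ofReal.comp (continuous_partials hu i)).mul
      (continuous_chi _ _)).continuousOn
  have hi : ∀ i, MeasureTheory.IntegrableOn
      (fun θ => (ω i : ℂ) * (((partials u θ i : ℝ) : ℂ) * chi (-k, 0) 0 θ)) cell := fun i =>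
    ((hc i).integrableOn_compact isCompact_cell).const_mul _
  have h1 : ∀ θ, ((ω ⬝ᵥ partials u θ : ℝ) : ℂ) * chi (-k, 0) 0 θ =
      (ω 0 : ℂ) * (((partials u θ 0 : ℝ) : ℂ) * chi (-k, 0) 0 θ) +
      (ω 1 : ℂ) * (((partials u θ 1 : ℝ) : ℂ) * chi (-k, 0) 0 θ) := fun θ => by
    simp only [dotProduct, Fin.sum_univ_two]
    push_cast
    ring
  have h2 : ∀ i, fourierCoef (fun x => partials u x i) k = _ := fourierCoef_partial hu hp k
  have h3 : fourierCoef (fun x => ω ⬝ᵥ partials u x) k =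
      ω 0 * fourierCoef (fun x => partials u x 0) k +
        ω 1 * fourierCoef (fun x => partials u x 1) k := by
    simp only [fourierCoef, h1]
    rw [MeasureTheory.integral_add (hi 0) (hi 1), MeasureTheory.integral_const_mul,
      MeasureTheory.integral_const_mul]
    ring
  rw [h3, h2, h2]
  push_cast
  ring

/-- A function that is invariant under a nonresonant translation flow is constant. -/
lemma partials_eq_zero_of_invariant {ω : Fin 2 → ℝ}
    (hω : ∀ k : Fin 2 → ℤ, k ≠ 0 → (k 0 * ω 0 + k 1 * ω 1 : ℝ) ≠ 0) {u : Plane → ℝ}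
    (hu : ContDiff ℝ 1 u) (hp : IsPeriodic u) (h : ∀ x, ω ⬝ᵥ partials u x = 0) (x : Plane) :
    partials u x = 0 := by
  have hz : ∀ k : Fin 2 → ℤ, k ≠ 0 → fourierCoef u k = 0 := fun k hk => by
    have h1 := fourierCoef_dotProduct_partials ω hu hp k
    simp only [h] at h1
    have h2 : fourierCoef (fun _ => (0 : ℝ)) k = 0 := by simp [fourierCoef]
    rw [h2] at h1
    refine (mul_eq_zero.1 h1.symm).resolve_left ?_
    exact mul_ne_zero Complex.I_ne_zero (Complex.ofReal_ne_zero.2 (hω k hk))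
  have hs : Summable fun k => ‖fourierCoef u k‖ :=
    summable_of_ne_finset_zero (s := {0}) fun k hk => by
      rw [hz k (by simpa using hk), norm_zero]
  have hconst : ∀ y, (u y : ℂ) = fourierCoef u 0 := fun y => by
    have h1 := hasSum_fourierCoef hu.continuous hp hs 0 y
    have h2 : HasSum (fun k => fourierCoef u k * chi (k, 0) 0 y)
        (fourierCoef u 0 * chi (0, 0) 0 y) :=
      hasSum_single 0 fun k hk => by rw [hz k hk, zero_mul]
    rw [h1.unique h2]
    simp [chi, phase]
  have : u = fun _ => u 0 := funext fun y => Complex.ofReal_injective ((hconst y).trans (hconst 0).symm)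
  ext i
  rw [this]
  simp [partials]

/-- Derivatives in the angles and in the parameter commute. -/
lemma hasDerivAt_partials {F : Plane × ℝ → ℝ} (hF : AnalyticOnNhd ℝ F Set.univ) (φ : Plane) (s : ℝ)
    (i : Fin 2) : HasDerivAt (fun s => partials (fun φ => F (φ, s)) φ i)
      (partials (fun φ => fderiv ℝ F (φ, s) (0, 1)) φ i) s := by
  have hd : ∀ q, DifferentiableAt ℝ F q := fun q => (hF q (Set.mem_univ _)).differentiableAt
  have hd2 : ∀ q, DifferentiableAt ℝ (fderiv ℝ F) q := fun q =>
    (hF.fderiv q (Set.mem_univ _)).differentiableAt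
  have h1 : ∀ s, partials (fun φ => F (φ, s)) φ i = fderiv ℝ F (φ, s) (Pi.single i 1, 0) := fun s =>
    fderiv_left (hd _) _
  have h2 : partials (fun φ => fderiv ℝ F (φ, s) (0, 1)) φ i =
      fderiv ℝ (fderiv ℝ F) (φ, s) (Pi.single i 1, 0) (0, 1) := by
    have h3 : DifferentiableAt ℝ (fun q => fderiv ℝ F q (0, 1)) (φ, s) :=
      (hd2 _).clm_apply (differentiableAt_const _)
    rw [partials, fderiv_left (f := fun q => fderiv ℝ F q (0, 1)) h3,
      fderiv_clm_apply (hd2 _) (differentiableAt_const _)]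
    simp
  have hsymm : IsSymmSndFDerivAt ℝ F (φ, s) :=
    (hF (φ, s) (Set.mem_univ _)).contDiffAt.isSymmSndFDerivAt (n := 2) (by simp)
  rw [h2, hsymm]
  simp only [h1]
  have h4 := (hd2 (φ, s)).hasFDerivAt.comp_hasDerivAt s
    ((hasDerivAt_const s φ).prodMk (hasDerivAt_id s))
  exact ((ContinuousLinearMap.apply ℝ ℝ ((Pi.single i 1, 0) : Plane × ℝ)).hasFDerivAt).comp_hasDerivAt
    s h4

lemma periodic_partials {u : Plane → ℝ} (hp : IsPeriodic u) (i : Fin 2) :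
    IsPeriodic fun x => partials u x i := fun x k => by
  have : (fun θ => u (θ + latticeVec k)) = u := funext fun θ => hp θ k
  have h := fderiv_comp_add_right (𝕜 := ℝ) (f := u) (x := x) (latticeVec k)
  rw [this] at h
  exact congrArg (fun A => A (Pi.single i 1)) h.symm

/-- The energy of the fields of the family moves with nonzero speed at the unperturbed field, if the
latter is nondegenerate. -/
lemma deriv_energy_ne_zero {ω : Fin 2 → ℝ} {β m : ℝ} {P G : Plane → Matrix (Fin 2) (Fin 2) ℝ}
    {H : Plane × ℝ → ℝ} {α : ℝ → Fin 2 → ℝ} {e : ℝ → ℝ} {v : ℝ → Plane → Plane} {R : Plane → ℝ}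
    (hω : ∀ k : Fin 2 → ℤ, k ≠ 0 → (k 0 * ω 0 + k 1 * ω 1 : ℝ) ≠ 0)
    (hsymm : ∀ θ, (P θ)ᵀ = P θ) (hGP : ∀ θ, G θ * P θ = 1)
    (hP : ∀ i j, AnalyticOnNhd ℝ (fun θ => P θ i j) Set.univ)
    (hm : torusMean (fun θ => ω ⬝ᵥ (G θ *ᵥ ω)) = m) (hm0 : 0 < m) (hβ : 0 < β)
    (hHa : AnalyticOnNhd ℝ H Set.univ) (hαa : AnalyticOnNhd ℝ α Set.univ)
    (hea : AnalyticOnNhd ℝ e Set.univ)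
    (hva : AnalyticOnNhd ℝ (fun q : Plane × ℝ => v q.2 q.1) Set.univ)
    (hvp : ∀ s, IsPeriodic (v s)) (hHp : ∀ s, IsPeriodic fun φ => H (φ, s))
    (hZ : ∀ s θ, P (θ + v s θ) *ᵥ (partials (fun φ => H (φ, s)) (θ + v s θ) + α s) =
      jacobian (v s) θ *ᵥ ω)
    (hN : ∀ s φ, (ω + P φ *ᵥ (partials (fun φ => H (φ, s)) φ + α s)) ⬝ᵥ
      (G φ *ᵥ (ω + P φ *ᵥ (partials (fun φ => H (φ, s)) φ + α s))) =
        (1 + β * Real.sin s) * (ω ⬝ᵥ (G φ *ᵥ ω)) + e s)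
    (hv0 : v 0 = 0) (hH0 : ∀ φ, H (φ, 0) = 0) (hα0 : α 0 = 0)
    (hR : ContDiff ℝ 1 R) (hRp : IsPeriodic R)
    (hRe : ∀ x, ω ⬝ᵥ partials R x = Real.sqrt m * (1 - m⁻¹ * (ω ⬝ᵥ (G x *ᵥ ω))))
    (hdet : (Matrix.of fun i j => torusIntegral fun x => (P x *
      (1 - Matrix.of fun i' j' => ((Real.sqrt m)⁻¹ • ω) j' * partials R x i')) i j).det ≠ 0) :
    deriv e 0 ≠ 0 := by
  intro he
  -- Throughout, `h1` and `a` are the `s`-derivatives at `0` of `H` and `α`, and the contradiction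
  -- hypothesis is that the energy has zero derivative.
  set h1 : Plane → ℝ := fun φ => fderiv ℝ H (φ, 0) (0, 1) with hh1
  set a : Fin 2 → ℝ := fun i => deriv (fun s => α s i) 0 with ha
  have hHd : ∀ q, DifferentiableAt ℝ H q := fun q => (hHa q (Set.mem_univ _)).differentiableAt
  have hh1a : AnalyticOnNhd ℝ h1 Set.univ := by
    have : AnalyticOnNhd ℝ (fun q => ContinuousLinearMap.apply ℝ ℝ ((0, 1) : Plane × ℝ)
        (fderiv ℝ H q)) Set.univ := fun q hq =>
      (ContinuousLinearMap.analyticAt _ _).fun_comp (hHa.fderiv q hq)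
    exact analyticOnNhd_left this 0
  have hh1p : IsPeriodic h1 := fun φ k => by
    have hk : (fun q : Plane × ℝ => H (q + (latticeVec k, 0))) = H := funext fun q => by
      show H (q.1 + latticeVec k, q.2 + 0) = H q
      rw [add_zero]
      exact hHp q.2 q.1 k
    have h := fderiv_comp_add_right (𝕜 := ℝ) (f := H) (x := ((φ, 0) : Plane × ℝ)) (latticeVec k, 0)
    rw [hk] at h
    have h2 := congrArg (fun A => A ((0, 1) : Plane × ℝ)) h.symm
    simpa [hh1] using h2
  -- the dual form and its derivative
  set A : Plane → ℝ → Fin 2 → ℝ := fun φ s => partials (fun φ => H (φ, s)) φ + α s with hA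
  have hA0 : ∀ φ, A φ 0 = 0 := fun φ => by simp only [hA, hH0, partials_zero, hα0, add_zero]
  have hαd : ∀ i, HasDerivAt (fun s => α s i) (a i) 0 := fun i =>
    (analyticAt_pi_iff.1 (hαa 0 (Set.mem_univ _)) i).differentiableAt.hasDerivAt
  have hAd : ∀ φ i, HasDerivAt (fun s => A φ s i) (partials h1 φ i + a i) 0 := fun φ i =>
    (hasDerivAt_partials hHa φ 0 i).add (hαd i)
  have hPG : ∀ θ, P θ * G θ = 1 := fun θ => mul_eq_one_comm.1 (hGP θ)
  -- The energy identity with the square expanded and the common term `ω · Gω` removed.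
  have hquad : ∀ φ s, (2 * (ω ⬝ᵥ A φ s) + A φ s ⬝ᵥ (P φ *ᵥ A φ s)) =
      β * Real.sin s * (ω ⬝ᵥ (G φ *ᵥ ω)) + e s := fun φ s => by
    have h2 := hN s φ
    have e1 : G φ *ᵥ (P φ *ᵥ A φ s) = A φ s := by
      rw [Matrix.mulVec_mulVec, hGP, Matrix.one_mulVec]
    have e2 : (P φ *ᵥ A φ s) ⬝ᵥ (G φ *ᵥ ω) = A φ s ⬝ᵥ ω := by
      rw [dotProduct_comm, Matrix.dotProduct_mulVec, ← Matrix.mulVec_transpose, hsymm,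
        Matrix.mulVec_mulVec, hPG, Matrix.one_mulVec, dotProduct_comm]
    change (ω + P φ *ᵥ A φ s) ⬝ᵥ (G φ *ᵥ (ω + P φ *ᵥ A φ s)) = _ at h2
    generalize A φ s = z at e1 e2 h2 ⊢
    rw [Matrix.mulVec_add (G φ) ω, e1, add_dotProduct, dotProduct_add, dotProduct_add, e2,
      dotProduct_comm z ω, dotProduct_comm (P φ *ᵥ z)] at h2
    linarith
  -- Differentiate at `s = 0`. The quadratic term drops out because `A` vanishes there, and the
  -- energy contributes nothing by the assumption `he`.
  have hfirst : ∀ φ, 2 * (ω ⬝ᵥ (partials h1 φ + a)) = β * (ω ⬝ᵥ (G φ *ᵥ ω)) := fun φ => by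
    have h2 : HasDerivAt (fun s => β * Real.sin s * (ω ⬝ᵥ (G φ *ᵥ ω)) + e s)
        (β * Real.cos 0 * (ω ⬝ᵥ (G φ *ᵥ ω)) + deriv e 0) 0 :=
      (((Real.hasDerivAt_sin 0).const_mul β).mul_const _).add
        (hea 0 (Set.mem_univ _)).differentiableAt.hasDerivAt
    have d0 := hAd φ 0
    have d1 := hAd φ 1
    have h3 := (((d0.const_mul (ω 0)).fun_add (d1.const_mul (ω 1))).const_mul 2).fun_add
      ((d0.fun_mul ((d0.const_mul (P φ 0 0)).fun_add (d1.const_mul (P φ 0 1)))).fun_add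
      (d1.fun_mul ((d0.const_mul (P φ 1 0)).fun_add (d1.const_mul (P φ 1 1)))))
    have h4 := h3.unique (h2.congr_of_eventuallyEq (Filter.Eventually.of_forall fun s => by
      beta_reduce
      rw [← hquad φ s]
      simp [dotProduct, Matrix.mulVec, Fin.sum_univ_two]))
    simp only [hA0, he, Real.cos_zero, Pi.zero_apply] at h4
    simp only [dotProduct, Fin.sum_univ_two, Pi.add_apply] at h4 ⊢
    linarith
  -- the mean of the first order change of the field
  have hmean : ∀ i, torusIntegral (fun θ => (P θ *ᵥ (partials h1 θ + a)) i) = 0 := fun i => by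
    -- With `w` the `s`-derivative of `vᵢ` at `0`, differentiating the conjugacy equation gives
    -- `(P(∂h1 + a))ᵢ = ω · ∂w`. The right side has zero integral.
    set w : Plane → ℝ := fun φ => fderiv ℝ (fun q : Plane × ℝ => v q.2 q.1 i) (φ, 0) (0, 1) with hw
    have hvi : AnalyticOnNhd ℝ (fun q : Plane × ℝ => v q.2 q.1 i) Set.univ := fun q hq =>
      analyticAt_pi_iff.1 (hva q hq) i
    have hwa : AnalyticOnNhd ℝ w Set.univ := by
      have : AnalyticOnNhd ℝ (fun q => ContinuousLinearMap.apply ℝ ℝ ((0, 1) : Plane × ℝ)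
          (fderiv ℝ (fun q : Plane × ℝ => v q.2 q.1 i) q)) Set.univ := fun q hq =>
        (ContinuousLinearMap.analyticAt _ _).fun_comp (hvi.fderiv q hq)
      exact analyticOnNhd_left this 0
    have hwp : IsPeriodic w := fun φ k => by
      have hk : (fun q : Plane × ℝ => (fun q : Plane × ℝ => v q.2 q.1 i) (q + (latticeVec k, 0))) =
          fun q : Plane × ℝ => v q.2 q.1 i := funext fun q => by
        simp [hvp q.2 q.1 k]
      have h := fderiv_comp_add_right (𝕜 := ℝ) (f := fun q : Plane × ℝ => v q.2 q.1 i)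
        (x := ((φ, 0) : Plane × ℝ)) (latticeVec k, 0)
      rw [hk] at h
      have h2 := congrArg (fun A => A ((0, 1) : Plane × ℝ)) h.symm
      simpa [hw] using h2
    rw [← torusIntegral_dotProduct_partials ω hwa.contDiff hwp]
    congr 1
    funext θ
    have hγ : HasDerivAt (fun s : ℝ => (θ + v s θ, s)) (deriv (fun s => v s θ) 0, 1) 0 :=
      ((analyticOnNhd_right hva θ 0 (Set.mem_univ _)).differentiableAt.hasDerivAt.const_add
        θ).prodMk (hasDerivAt_id 0)
    have hγ0 : (θ + v 0 θ, (0 : ℝ)) = (θ, 0) := by rw [hv0, Pi.zero_apply, add_zero]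
    have hFa : ∀ j, AnalyticOnNhd ℝ (fun q : Plane × ℝ => A q.1 q.2 j) Set.univ := fun j q hq =>
      (analyticOnNhd_partials hHa j q hq).fun_add
        ((analyticAt_pi_iff.1 (hαa q.2 (Set.mem_univ _)) j).fun_comp analyticAt_snd)
    have hFd : ∀ j, HasDerivAt (fun s => A (θ + v s θ) s j) (partials h1 θ j + a j) 0 := fun j => by
      have d1 : DifferentiableAt ℝ (fun q : Plane × ℝ => A q.1 q.2 j) (θ, 0) :=
        (hFa j _ (Set.mem_univ _)).differentiableAt
      have h2 := HasFDerivAt.comp_hasDerivAt (l := fun q : Plane × ℝ => A q.1 q.2 j) 0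
        (hγ0 ▸ d1.hasFDerivAt) hγ
      -- Moving the base point `θ + v` has no first order effect, since `A` is identically zero at
      -- `s = 0`.
      have h3 : fderiv ℝ (fun q : Plane × ℝ => A q.1 q.2 j) (θ, 0) (deriv (fun s => v s θ) 0, 0) = 0 := by
        rw [← fderiv_left d1]
        simp [hA0]
      have h4 : fderiv ℝ (fun q : Plane × ℝ => A q.1 q.2 j) (θ, 0) (0, 1) = partials h1 θ j + a j := by
        have h5 := d1.hasFDerivAt.comp_hasDerivAt (0 : ℝ)
          ((hasDerivAt_const (0 : ℝ) θ).prodMk (hasDerivAt_id (0 : ℝ)))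
        exact h5.unique (hAd θ j)
      have h6 : ((deriv (fun s => v s θ) 0, 1) : Plane × ℝ) =
          (deriv (fun s => v s θ) 0, 0) + (0, 1) := by simp
      rw [hγ0, h6, map_add, h3, h4, zero_add] at h2
      exact h2
    have hPd : ∀ j, ∃ d, HasDerivAt (fun s => P (θ + v s θ) i j) d 0 := fun j =>
      ⟨_, (HasFDerivAt.comp_hasDerivAt (l := fun φ => P φ i j) (0 : ℝ)
        (hP i j _ (Set.mem_univ _)).differentiableAt.hasFDerivAt
        ((analyticOnNhd_right hva θ 0 (Set.mem_univ _)).differentiableAt.hasDerivAt.const_add θ))⟩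
    obtain ⟨d0, hd0⟩ := hPd 0
    obtain ⟨d1, hd1⟩ := hPd 1
    have h7 := (hd0.fun_mul (hFd 0)).fun_add (hd1.fun_mul (hFd 1))
    have h8 : HasDerivAt (fun s => ω ⬝ᵥ partials (fun y => v s y i) θ) (ω ⬝ᵥ partials w θ) 0 := by
      simp only [dotProduct, Fin.sum_univ_two]
      exact ((hasDerivAt_partials hvi θ 0 0).const_mul _).add
        ((hasDerivAt_partials hvi θ 0 1).const_mul _)
    have h9 := h7.unique (h8.congr_of_eventuallyEq (Filter.Eventually.of_forall fun s => by
      have h10 := congrFun (hZ s θ) i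
      rw [jacobian_mulVec] at h10
      beta_reduce
      rw [← h10]
      simp [Matrix.mulVec, dotProduct, Fin.sum_univ_two, hA]))
    simp only [hv0, Pi.zero_apply, add_zero, hA0, mul_zero, zero_add] at h9
    rw [← h9]
    simp [Matrix.mulVec, dotProduct, Fin.sum_univ_two]
  have hsm : 0 < Real.sqrt m := Real.sqrt_pos.2 hm0
  have hss : Real.sqrt m * Real.sqrt m = m := Real.mul_self_sqrt hm0.le
  have hh1c : ContDiff ℝ 1 h1 := hh1a.contDiff
  -- The mean of `hfirst`.
  have hωa : 2 * (ω ⬝ᵥ a) = β * m := by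
    have h2 : torusMean (fun φ => ω ⬝ᵥ partials h1 φ + ω ⬝ᵥ a) =
        torusMean (fun φ => β / 2 * (ω ⬝ᵥ (G φ *ᵥ ω))) := by
      congr 1
      funext φ
      have := hfirst φ
      rw [dotProduct_add] at this
      linarith
    have hc : Continuous fun φ => ω ⬝ᵥ partials h1 φ := by
      simp only [dotProduct, Fin.sum_univ_two]
      exact (continuous_const.fun_mul (continuous_partials hh1c 0)).fun_add
        (continuous_const.fun_mul (continuous_partials hh1c 1))
    rw [torusMean_add hc continuous_const, torusMean_const, torusMean_const_mul, hm, torusMean,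
      torusIntegral_dotProduct_partials ω hh1c hh1p] at h2
    linarith
  -- By `hfirst` and `hωa`, `ω · ∂h1 = (β/2)(V - m)` with `V = ω · Gω`, which is `-(β/2)√m` times
  -- the equation for `R`. Nonresonance makes the solution unique up to a constant.
  have hpar : ∀ x, partials h1 x = -(β / 2 * Real.sqrt m) • partials R x := fun x => by
    have hd1 : ∀ y, DifferentiableAt ℝ h1 y := fun y => hh1c.differentiable one_ne_zero y
    have hd2 : ∀ y, DifferentiableAt ℝ R y := fun y => hR.differentiable one_ne_zero y
    have h2 : ∀ y, partials (fun y => h1 y + β / 2 * Real.sqrt m * R y) y =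
        partials h1 y + (β / 2 * Real.sqrt m) • partials R y := fun y => by
      rw [partials_add (hd1 y) ((hd2 y).const_mul _), partials_const_mul _ (hd2 y)]
    have h3 := partials_eq_zero_of_invariant (u := fun y => h1 y + β / 2 * Real.sqrt m * R y) hω
      (hh1c.add (contDiff_const.mul hR)) (fun y k => by simp only [hh1p y k, hRp y k])
      (fun y => by
        rw [h2, dotProduct_add, dotProduct_smul, hRe, smul_eq_mul]
        have h4 := hfirst y
        rw [dotProduct_add] at h4
        have h5 : β / 2 * Real.sqrt m * (Real.sqrt m * (1 - m⁻¹ * (ω ⬝ᵥ (G y *ᵥ ω)))) =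
            β / 2 * m - β / 2 * (ω ⬝ᵥ (G y *ᵥ ω)) := by
          have : β / 2 * Real.sqrt m * (Real.sqrt m * (1 - m⁻¹ * (ω ⬝ᵥ (G y *ᵥ ω)))) =
            β / 2 * (Real.sqrt m * Real.sqrt m) * (1 - m⁻¹ * (ω ⬝ᵥ (G y *ᵥ ω))) := by ring
          rw [this, hss]
          field_simp
        rw [h5]
        linarith) x
    rw [h2] at h3
    rw [neg_smul]
    exact eq_neg_of_add_eq_zero_left h3
  have hPc : ∀ i j, Continuous fun x => P x i j := fun i j =>
    continuousOn_univ.1 (hP i j).continuousOn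
  -- Substituting `∂h1 = -(β/2)√m ∂R` and `(β/2)√m = w · a`, with `w = ω/√m`, turns the vanishing
  -- mean of `P(∂h1 + a)` into the type I matrix applied to `a`.
  have hzero : (Matrix.of fun i j => torusIntegral fun x => (P x *
      (1 - Matrix.of fun i' j' => ((Real.sqrt m)⁻¹ • ω) j' * partials R x i')) i j) *ᵥ a = 0 := by
    ext i
    rw [torusIntegral_mulVec, Pi.zero_apply, ← hmean i]
    · congr 1
      funext x
      rw [← Matrix.mulVec_mulVec, hpar x]
      congr 2
      rw [Matrix.sub_mulVec, Matrix.one_mulVec, add_comm, sub_eq_add_neg, neg_smul]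
      congr 2
      ext l
      have h6 : (Real.sqrt m)⁻¹ * (ω ⬝ᵥ a) = β / 2 * Real.sqrt m := by
        rw [inv_mul_eq_iff_eq_mul₀ hsm.ne']
        linear_combination hωa / 2 - β / 2 * hss
      rw [Pi.smul_apply, smul_eq_mul, ← h6]
      simp only [Matrix.mulVec, dotProduct, Fin.sum_univ_two, Matrix.of_apply, Pi.smul_apply,
        smul_eq_mul]
      ring
    · intro i j
      simp only [Matrix.mul_apply, Fin.sum_univ_two, Matrix.sub_apply, Matrix.of_apply]
      exact ((hPc i 0).fun_mul (continuous_const.sub (continuous_const.fun_mul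
        (continuous_partials hR 0)))).fun_add ((hPc i 1).fun_mul (continuous_const.sub
        (continuous_const.fun_mul (continuous_partials hR 1))))
  have ha0 : a = 0 := Matrix.eq_zero_of_mulVec_eq_zero hdet hzero
  rw [ha0, dotProduct_zero, mul_zero] at hωa
  exact (mul_pos hβ hm0).ne hωa

/-! ### Smooth families in the `C^r` norm -/

lemma exists_add_latticeVec_mem_cell (x : Plane) : ∃ k, x + latticeVec k ∈ cell := by
  have hpi : (0 : ℝ) < 2 * Real.pi := by positivity
  refine ⟨fun i => -⌊x i / (2 * Real.pi)⌋, fun i => ?_, fun i => ?_⟩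
  · have := Int.floor_le (x i / (2 * Real.pi))
    rw [le_div_iff₀ hpi] at this
    simp only [Pi.zero_apply, Pi.add_apply, latticeVec]
    push_cast
    linarith
  · have := (Int.lt_floor_add_one (x i / (2 * Real.pi))).le
    rw [div_le_iff₀ hpi] at this
    simp only [Pi.add_apply, latticeVec]
    push_cast
    linarith

section Parameter

variable {E F : Type} [NormedAddCommGroup E] [NormedSpace ℝ E]
  [NormedAddCommGroup F] [NormedSpace ℝ F]

lemma ContDiff.exists_lipschitz_bound {D : E → F} (hD : ContDiff ℝ 1 D) {S : Set E}
    (hS : IsCompact S) (hc : Convex ℝ S) :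
    ∃ C : ℝ, 0 ≤ C ∧ ∀ p ∈ S, ∀ q ∈ S, ‖D p - D q‖ ≤ C * ‖p - q‖ := by
  obtain ⟨C, hC⟩ := hS.exists_bound_of_continuousOn (hD.continuous_fderiv one_ne_zero).continuousOn
  refine ⟨max C 0, le_max_right _ _, fun p hp q hq => ?_⟩
  exact hc.norm_image_sub_le_of_norm_fderiv_le (𝕜 := ℝ)
    (fun x _ => hD.differentiable one_ne_zero x) (fun x hx => (hC x hx).trans (le_max_left _ _)) hq hp

/-- A smooth family of functions on the torus is locally Lipschitz in the `C^r` norm. -/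
lemma exists_crNorm_sub_le {U : Plane × E → F} (hU : ContDiff ℝ (⊤ : ℕ∞) U)
    (hp : ∀ p, IsPeriodic fun x => U (x, p)) {S : Set E} (hS : IsCompact S) (hc : Convex ℝ S)
    (r : ℕ) : ∃ C : ℝ, 0 ≤ C ∧ ∀ p ∈ S, ∀ q ∈ S,
      crNorm r ((fun x => U (x, p)) - fun x => U (x, q)) ≤ ENNReal.ofReal (C * ‖p - q‖) := by
  have hD : ∀ j : ℕ, ContDiff ℝ 1 (iteratedFDeriv ℝ j U) := fun j =>
    (hU.of_le (m := ((1 + j : ℕ) : WithTop ℕ∞)) (by exact_mod_cast le_top)).iteratedFDeriv_right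
      (m := 1) (by push_cast; exact le_rfl)
  choose C hC0 hC using fun j => ContDiff.exists_lipschitz_bound (hD j) (isCompact_cell.prod hS)
    ((convex_Icc _ _).prod hc)
  refine ⟨∑ j ∈ Finset.range (r + 1), C j, Finset.sum_nonneg fun j _ => hC0 j,
    fun p hpS q hqS => iSup_le fun j => iSup_le fun hj => iSup_le fun x => ?_⟩
  have hslice : ∀ p, ContDiff ℝ (⊤ : ℕ∞) fun x => U (x, p) := fun p =>
    hU.comp (contDiff_id.prodMk contDiff_const)
  -- Derivatives of a slice are restrictions of the joint derivatives to the directions of the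
  -- angles, so Lipschitz bounds for the latter on the compact set `cell × S` are enough.
  have hit : ∀ p x, iteratedFDeriv ℝ j (fun x => U (x, p)) x =
      (iteratedFDeriv ℝ j U (x, p)).compContinuousLinearMap
        fun _ => ContinuousLinearMap.inl ℝ Plane E := fun p x => by
    have h1 : (fun x => U (x, p)) = (fun z => U (z + (0, p))) ∘ ContinuousLinearMap.inl ℝ Plane E :=
      funext fun x => by simp
    have h2 : ContDiff ℝ (⊤ : ℕ∞) fun z => U (z + (0, p)) := hU.comp (contDiff_id.add contDiff_const)
    rw [h1, ContinuousLinearMap.iteratedFDeriv_comp_right _ h2 x (i := j) (by exact_mod_cast le_top),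
      iteratedFDeriv_comp_add_right]
    simp
  have hmain : ∀ y ∈ cell, ‖iteratedFDeriv ℝ j ((fun x => U (x, p)) - fun x => U (x, q)) y‖ ≤
      C j * ‖p - q‖ := fun y hy => by
    rw [iteratedFDeriv_sub_apply ((hslice p).contDiffAt.of_le (by exact_mod_cast le_top))
      ((hslice q).contDiffAt.of_le (by exact_mod_cast le_top)), hit, hit]
    have h3 := hC j (y, p) ⟨hy, hpS⟩ (y, q) ⟨hy, hqS⟩
    have h4 : ‖((y, p) : Plane × E) - (y, q)‖ = ‖p - q‖ := by
      rw [Prod.mk_sub_mk, sub_self, Prod.norm_mk, norm_zero, max_eq_right (norm_nonneg _)]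
    rw [h4] at h3
    refine le_trans ?_ h3
    have h5 : (iteratedFDeriv ℝ j U (y, p)).compContinuousLinearMap
        (fun _ => ContinuousLinearMap.inl ℝ Plane E) -
        (iteratedFDeriv ℝ j U (y, q)).compContinuousLinearMap
        (fun _ => ContinuousLinearMap.inl ℝ Plane E) =
        (iteratedFDeriv ℝ j U (y, p) - iteratedFDeriv ℝ j U (y, q)).compContinuousLinearMap
        (fun _ => ContinuousLinearMap.inl ℝ Plane E) := by
      ext; rfl
    rw [h5]
    refine (ContinuousMultilinearMap.norm_compContinuousLinearMap_le _ _).trans ?_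
    refine mul_le_of_le_one_right (norm_nonneg _) (Finset.prod_le_one (fun _ _ => norm_nonneg _)
      fun _ _ => ContinuousLinearMap.norm_inl_le_one ℝ Plane E)
  obtain ⟨k, hk⟩ := exists_add_latticeVec_mem_cell x
  have hper : (fun z => ((fun x => U (x, p)) - fun x => U (x, q)) (z + latticeVec k)) =
      (fun x => U (x, p)) - fun x => U (x, q) := funext fun z => by
    show U (z + latticeVec k, p) - U (z + latticeVec k, q) = U (z, p) - U (z, q)
    have h6 := hp p z k
    have h7 := hp q z k
    simp only at h6 h7
    rw [h6, h7]
  have h8 := iteratedFDeriv_comp_add_right (𝕜 := ℝ)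
    (f := (fun x => U (x, p)) - fun x => U (x, q)) j (latticeVec k) x
  rw [hper] at h8
  rw [h8, ← ofReal_norm]
  refine ENNReal.ofReal_le_ofReal ((hmain _ hk).trans ?_)
  gcongr
  exact Finset.single_le_sum (fun i _ => hC0 i) (Finset.mem_range.2 (by omega))

end Parameter

/-! ### Diophantine vectors -/

/-- The real exponent is rounded up to an integer, legitimate since `|k| ≥ 1`, and the factorial is
absorbed in the constant. -/
lemma IsDiophantine.exists_smallDivisorBound {ω : Fin 2 → ℝ} (h : IsDiophantine ω) :
    ∃ (N : ℕ) (C : ℝ), 1 ≤ C ∧ SmallDivisorBound ω N C := by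
  obtain ⟨γ, τ, hγ, hτ, hk⟩ := h
  set N := ⌈τ⌉₊
  refine ⟨N, max 1 (γ⁻¹ * N.factorial), le_max_left _ _, fun k hk0 => ?_⟩
  have h1 := hk k hk0
  rw [Fin.sum_univ_two] at h1
  set l := Real.sqrt ((k 0 : ℝ) ^ 2 + (k 1 : ℝ) ^ 2) with hl
  have hsq : (1 : ℝ) ≤ (k 0 : ℝ) ^ 2 + (k 1 : ℝ) ^ 2 := by
    have h2 : (1 : ℤ) ≤ k 0 ^ 2 + k 1 ^ 2 := by
      by_contra hlt
      have h3 : k 0 ^ 2 + k 1 ^ 2 ≤ 0 := by omega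
      have h4 : k 0 = 0 := by nlinarith [sq_nonneg (k 0), sq_nonneg (k 1)]
      have h5 : k 1 = 0 := by nlinarith [sq_nonneg (k 0), sq_nonneg (k 1)]
      exact hk0 (by ext i; fin_cases i <;> simp [h4, h5])
    exact_mod_cast h2
  have hl1 : 1 ≤ l := Real.one_le_sqrt.2 hsq
  have hl0 : 0 < l := one_pos.trans_le hl1
  have hln : l ≤ |(k 0 : ℝ)| + |(k 1 : ℝ)| := by
    rw [hl, Real.sqrt_le_left (by positivity)]
    nlinarith [sq_abs (k 0 : ℝ), sq_abs (k 1 : ℝ), mul_nonneg (abs_nonneg (k 0 : ℝ))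
      (abs_nonneg (k 1 : ℝ))]
  have hpos : 0 < γ * l ^ (-τ) := mul_pos hγ (Real.rpow_pos_of_pos hl0 _)
  have habs : 0 < |(k 0 * ω 0 + k 1 * ω 1 : ℝ)| := hpos.trans_le h1
  refine ⟨abs_pos.1 habs, ?_⟩
  have hpow : l ^ τ ≤ (|(k 0 : ℝ)| + |(k 1 : ℝ)|) ^ N :=
    calc l ^ τ ≤ l ^ (N : ℝ) := Real.rpow_le_rpow_of_exponent_le hl1 (Nat.le_ceil τ)
      _ = l ^ N := Real.rpow_natCast _ _
      _ ≤ _ := pow_le_pow_left₀ hl0.le hln N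
  calc |(k 0 * ω 0 + k 1 * ω 1 : ℝ)|⁻¹ ≤ (γ * l ^ (-τ))⁻¹ := inv_anti₀ hpos h1
    _ = γ⁻¹ * l ^ τ := by rw [mul_inv, Real.rpow_neg hl0.le, inv_inv]
    _ ≤ γ⁻¹ * (|(k 0 : ℝ)| + |(k 1 : ℝ)|) ^ N := by gcongr
    _ = (γ⁻¹ * N.factorial) * (|(k 0 : ℝ)| + |(k 1 : ℝ)|) ^ N / N.factorial := by
        field_simp
    _ ≤ _ := by
        gcongr
        exact le_max_right _ _

lemma IsDiophantine.smul {ω : Fin 2 → ℝ} (h : IsDiophantine ω) {t : ℝ} (ht : 0 < t) :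
    IsDiophantine (t • ω) := by
  obtain ⟨γ, τ, hγ, hτ, hk⟩ := h
  refine ⟨t * γ, τ, mul_pos ht hγ, hτ, fun k hk0 => ?_⟩
  have h1 : ∑ i, (k i : ℝ) * (t • ω) i = t * ∑ i, (k i : ℝ) * ω i := by
    simp only [Fin.sum_univ_two, Pi.smul_apply, smul_eq_mul]
    ring
  rw [h1, abs_mul, abs_of_pos ht, mul_assoc]
  exact mul_le_mul_of_nonneg_left (hk k hk0) ht.le

/-! ### The induced metric -/

section Metric

variable {K : Plane → E3}

lemma metricMatrix_transpose (x : Plane) : (metricMatrix K x)ᵀ = metricMatrix K x := by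
  ext i j
  exact real_inner_comm (fderiv ℝ K x (Pi.single i 1)) (fderiv ℝ K x (Pi.single j 1))

lemma fderiv_apply_eq_sum {F : Type*} [NormedAddCommGroup F] [NormedSpace ℝ F] (L : Plane →L[ℝ] F)
    (z : Plane) : L z = z 0 • L (Pi.single 0 1) + z 1 • L (Pi.single 1 1) := by
  have : z = z 0 • Pi.single 0 1 + z 1 • Pi.single 1 1 := by
    ext i; fin_cases i <;> simp
  conv_lhs => rw [this, map_add, map_smul, map_smul]

lemma dotProduct_metricMatrix (x y z : Plane) :
    y ⬝ᵥ (metricMatrix K x *ᵥ z) = inner ℝ (fderiv ℝ K x y) (fderiv ℝ K x z) := by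
  rw [fderiv_apply_eq_sum _ y, fderiv_apply_eq_sum _ z]
  simp only [inner_add_left, inner_add_right, real_inner_smul_left, real_inner_smul_right,
    dotProduct, Matrix.mulVec, Fin.sum_univ_two, metricMatrix, Matrix.of_apply]
  ring

lemma dotProduct_metricMatrix_pos (hK : ∀ x, Function.Injective (fderiv ℝ K x)) (x : Plane)
    {z : Plane} (hz : z ≠ 0) : 0 < z ⬝ᵥ (metricMatrix K x *ᵥ z) := by
  rw [dotProduct_metricMatrix, real_inner_self_eq_norm_sq]
  have : fderiv ℝ K x z ≠ 0 := fun h => hz ((map_eq_zero_iff _ (hK x)).1 h)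
  positivity

lemma det_metricMatrix_ne_zero (hK : ∀ x, Function.Injective (fderiv ℝ K x)) (x : Plane) :
    (metricMatrix K x).det ≠ 0 := fun h => by
  obtain ⟨z, hz, h0⟩ := Matrix.exists_mulVec_eq_zero_iff.2 h
  have := dotProduct_metricMatrix_pos hK x hz
  rw [h0, dotProduct_zero] at this
  exact this.false

lemma metricMatrix_mul_inv (hK : ∀ x, Function.Injective (fderiv ℝ K x)) (x : Plane) :
    metricMatrix K x * (metricMatrix K x)⁻¹ = 1 :=
  Matrix.mul_nonsing_inv _ (isUnit_iff_ne_zero.2 (det_metricMatrix_ne_zero hK x))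

lemma dotProduct_inv_metricMatrix_pos (hK : ∀ x, Function.Injective (fderiv ℝ K x)) (x : Plane)
    {z : Plane} (hz : z ≠ 0) : 0 < z ⬝ᵥ ((metricMatrix K x)⁻¹ *ᵥ z) := by
  have h1 : metricMatrix K x *ᵥ ((metricMatrix K x)⁻¹ *ᵥ z) = z := by
    rw [Matrix.mulVec_mulVec, metricMatrix_mul_inv hK, Matrix.one_mulVec]
  have h2 : (metricMatrix K x)⁻¹ *ᵥ z ≠ 0 := fun h => by
    rw [h, Matrix.mulVec_zero] at h1
    exact hz h1.symm
  have := dotProduct_metricMatrix_pos hK x h2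
  rwa [h1, dotProduct_comm] at this

lemma metricMatrix_periodic (hp : IsPeriodic K) : IsPeriodic (metricMatrix K) := fun x k => by
  have : (fun θ => K (θ + latticeVec k)) = K := funext fun θ => hp θ k
  have h := fderiv_comp_add_right (𝕜 := ℝ) (f := K) (x := x) (latticeVec k)
  rw [this] at h
  simp only [metricMatrix, h]

lemma analyticOnNhd_metricMatrix (hK : AnalyticOnNhd ℝ K Set.univ) (i j : Fin 2) :
    AnalyticOnNhd ℝ (fun x => metricMatrix K x i j) Set.univ := fun x hx => by
  have h1 : ∀ i, AnalyticAt ℝ (fun x => fderiv ℝ K x (Pi.single i 1)) x := fun i =>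
    ((ContinuousLinearMap.apply ℝ E3 (Pi.single i 1 : Plane)).analyticAt _).fun_comp
      (hK.fderiv x hx)
  exact ((innerSL ℝ (E := E3)).analyticAt_bilinear _).fun_comp ((h1 i).prod (h1 j))

lemma analyticOnNhd_inv_metricMatrix (hK : AnalyticOnNhd ℝ K Set.univ)
    (hK' : ∀ x, Function.Injective (fderiv ℝ K x)) (i j : Fin 2) :
    AnalyticOnNhd ℝ (fun x => (metricMatrix K x)⁻¹ i j) Set.univ := fun x hx => by
  have hG := fun i j => analyticOnNhd_metricMatrix hK i j x hx
  have hdet : AnalyticAt ℝ (fun x => (metricMatrix K x).det⁻¹) x := by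
    refine AnalyticAt.fun_inv ?_ (det_metricMatrix_ne_zero hK' x)
    simp only [Matrix.det_fin_two]
    exact ((hG 0 0).fun_mul (hG 1 1)).fun_sub ((hG 0 1).fun_mul (hG 1 0))
  have h1 : ∀ x, (metricMatrix K x)⁻¹ i j =
      (metricMatrix K x).det⁻¹ * (metricMatrix K x).adjugate i j := fun x => by
    rw [Matrix.inv_def, Ring.inverse_eq_inv', Matrix.smul_apply, smul_eq_mul]
  simp only [h1]
  refine hdet.fun_mul ?_
  simp only [Matrix.adjugate_fin_two]
  fin_cases i <;> fin_cases j
  · exact hG 1 1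
  · exact (hG 0 1).fun_neg
  · exact (hG 1 0).fun_neg
  · exact hG 0 0

end Metric

/-! ### Positivity of means and inversion of the energy function. -/

lemma torusMean_pos {f : Plane → ℝ} (hf : Continuous f) (h : ∀ x, 0 < f x) : 0 < torusMean f := by
  obtain ⟨x₀, -, hmin⟩ := isCompact_cell.exists_isMinOn ⟨0, Set.left_mem_Icc.2 two_pi_nonneg⟩
    hf.continuousOn
  refine (h x₀).trans_le ?_
  rw [← torusMean_const (f x₀), torusMean, torusMean]
  refine mul_le_mul_of_nonneg_left ?_ (by positivity)
  exact MeasureTheory.setIntegral_mono_on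
    (continuous_const.continuousOn.integrableOn_compact isCompact_cell)
    (hf.continuousOn.integrableOn_compact isCompact_cell) measurableSet_Icc fun x hx => hmin hx

/-- The mean of a positive definite matrix function is invertible. -/
lemma det_mean_ne_zero {P : Plane → Matrix (Fin 2) (Fin 2) ℝ}
    (hP : ∀ i j, Continuous fun x => P x i j) (hpos : ∀ x z, z ≠ 0 → 0 < z ⬝ᵥ (P x *ᵥ z)) :
    (Matrix.of fun i j => torusMean fun θ => P θ i j).det ≠ 0 := fun h => by
  obtain ⟨z, hz, h0⟩ := Matrix.exists_mulVec_eq_zero_iff.2 h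
  have hc : Continuous fun x => z ⬝ᵥ (P x *ᵥ z) := by
    simp only [dotProduct, Matrix.mulVec, Fin.sum_univ_two]
    have := hP 0 0; have := hP 0 1; have := hP 1 0; have := hP 1 1
    fun_prop
  have h1 := torusMean_pos hc fun x => hpos x z hz
  have hci : ∀ i, Continuous fun x => (P x *ᵥ z) i := fun i => by
    simp only [dotProduct, Matrix.mulVec, Fin.sum_univ_two]
    exact ((hP i 0).fun_mul continuous_const).fun_add ((hP i 1).fun_mul continuous_const)
  have h2 : ∀ i, torusMean (fun x => (P x *ᵥ z) i) = 0 := fun i => by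
    rw [torusMean, ← torusIntegral_mulVec hP]
    have h3 := congrFun h0 i
    simp only [Matrix.mulVec, dotProduct, Fin.sum_univ_two, Matrix.of_apply, torusMean,
      Pi.zero_apply] at h3 ⊢
    linarith
  simp only [dotProduct, Fin.sum_univ_two] at h1
  rw [torusMean_add (continuous_const.fun_mul (hci 0)) (continuous_const.fun_mul (hci 1)),
    torusMean_const_mul, torusMean_const_mul, h2, h2] at h1
  simp at h1

/-- A change of the parameter that prescribes an analytic function with nonzero derivative. -/
lemma exists_reparametrization {e : ℝ → ℝ} (he : AnalyticAt ℝ e 0) (he0 : e 0 = 0)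
    (hd : deriv e 0 ≠ 0) : ∃ σ : ℝ → ℝ, AnalyticAt ℝ σ 0 ∧ σ 0 = 0 ∧
      ∀ᶠ c in 𝓝 0, e (σ c) = c / (1 + c) := by
  set g := he.hasStrictDerivAt.localInverse _ _ _ hd
  have hg : AnalyticAt ℝ g 0 := he0 ▸ he.analyticAt_localInverse hd
  have hr : ∀ᶠ x in 𝓝 0, e (g x) = x :=
    he0 ▸ HasStrictDerivAt.eventually_right_inverse he.hasStrictDerivAt hd
  have hg0 : g 0 = 0 := by
    have := HasStrictFDerivAt.localInverse_apply_image (he.hasStrictDerivAt.hasStrictFDerivAt_equiv hd)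
    rw [he0] at this
    exact this
  have hf : AnalyticAt ℝ (fun c : ℝ => c / (1 + c)) 0 :=
    analyticAt_id.fun_div (analyticAt_const.fun_add analyticAt_id) (by simp)
  refine ⟨fun c => g (c / (1 + c)), ?_, by simp [hg0], ?_⟩
  · exact AnalyticAt.fun_comp (g := g) (f := fun c : ℝ => c / (1 + c)) (by simpa using hg) hf
  · have : Filter.Tendsto (fun c : ℝ => c / (1 + c)) (𝓝 0) (𝓝 0) := by
      simpa using hf.continuousAt.tendsto
    exact this.eventually hr

/-! ### The form dual to a Beltrami field on the boundary is closed -/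

lemma isOpen_of_hasAnalyticBoundary {Ω : Set E3} (hΩ : HasAnalyticBoundary Ω) : IsOpen Ω := by
  rw [← disjoint_frontier_iff_isOpen]
  rw [Set.disjoint_left]
  intro p hp hpΩ
  obtain ⟨f, ⟨-, h0, -, hf⟩, -⟩ := hΩ p hp
  exact absurd (hf.self_of_nhds.1 hpΩ) (by rw [h0]; exact lt_irrefl _)

/-- At a boundary point, a Beltrami field has a one-sided derivative with the same curl. -/
lemma exists_boundary_derivative {Ω : Set E3} {B : E3 → E3} {lam : ℝ} (hΩ : IsOpen Ω)
    (hB : ContDiffOn ℝ 1 B (closure Ω)) (hc : ∀ x ∈ Ω, curl B x = lam • B x) {p : E3}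
    (hp : p ∈ closure Ω) : ∃ L : E3 →L[ℝ] E3, HasFDerivWithinAt B L (closure Ω) p ∧
      L (EuclideanSpace.single 1 1) 2 - L (EuclideanSpace.single 2 1) 1 = lam * B p 0 ∧
      L (EuclideanSpace.single 2 1) 0 - L (EuclideanSpace.single 0 1) 2 = lam * B p 1 ∧
      L (EuclideanSpace.single 0 1) 1 - L (EuclideanSpace.single 1 1) 0 = lam * B p 2 := by
  have h1 : ContDiffWithinAt ℝ (0 + 1) B (closure Ω) p := by simpa using hB p hp
  rw [contDiffWithinAt_succ_iff_hasFDerivWithinAt (by simp)] at h1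
  obtain ⟨u, hu, -, f', hf', hcont⟩ := h1
  rw [Set.insert_eq_of_mem hp] at hu
  have hfc : ContinuousWithinAt f' u p := hcont.continuousWithinAt
  have hpu : p ∈ u := mem_of_mem_nhdsWithin hp hu
  have huΩ : u ∈ 𝓝[Ω] p := nhdsWithin_mono p subset_closure hu
  have hne : (𝓝[Ω] p).NeBot := mem_closure_iff_nhdsWithin_neBot.1 hp
  have hlim : Filter.Tendsto f' (𝓝[Ω] p) (𝓝 (f' p)) :=
    hfc.mono_left (nhdsWithin_le_of_mem huΩ)
  have hBlim : Filter.Tendsto B (𝓝[Ω] p) (𝓝 (B p)) :=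
    ((hB p hp).continuousWithinAt).mono_left (nhdsWithin_mono p subset_closure)
  -- Inside the domain the continuous one-sided derivative `f'` is the ordinary one, so the curl
  -- equation holds there and passes to the limit at `p`.
  have hev : ∀ᶠ y in 𝓝[Ω] p, fderiv ℝ B y = f' y ∧ y ∈ Ω := by
    obtain ⟨V, hV, hpV, hVu⟩ := mem_nhdsWithin.1 huΩ
    filter_upwards [mem_nhdsWithin_of_mem_nhds (hV.mem_nhds hpV), self_mem_nhdsWithin] with y hyV hyΩ
    have hyu : u ∈ 𝓝 y := Filter.mem_of_superset ((hV.inter hΩ).mem_nhds ⟨hyV, hyΩ⟩) hVu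
    exact ⟨((hf' y (mem_of_mem_nhds hyu)).hasFDerivAt hyu).fderiv, hyΩ⟩
  have hL : ∀ i j : Fin 3, Filter.Tendsto (fun y => f' y (EuclideanSpace.single i 1) j) (𝓝[Ω] p)
      (𝓝 (f' p (EuclideanSpace.single i 1) j)) := fun i j =>
    ((EuclideanSpace.proj j : E3 →L[ℝ] ℝ).continuous.tendsto _).comp
      (((ContinuousLinearMap.apply ℝ E3 (EuclideanSpace.single i 1 : E3)).continuous.tendsto _).comp
        hlim)
  have hBl : ∀ j : Fin 3, Filter.Tendsto (fun y => lam * B y j) (𝓝[Ω] p) (𝓝 (lam * B p j)) :=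
    fun j => (((EuclideanSpace.proj j : E3 →L[ℝ] ℝ).continuous.tendsto _).comp hBlim).const_mul lam
  refine ⟨f' p, (hf' p hpu).mono_of_mem_nhdsWithin hu, ?_, ?_, ?_⟩
  · refine tendsto_nhds_unique ((hL 1 2).sub (hL 2 1)) ((hBl 0).congr' ?_)
    filter_upwards [hev] with y hy
    have := congrArg (fun w : E3 => w 0) (hc y hy.2)
    simp only [curl, spacePartial, hy.1] at this
    simpa using this.symm
  · refine tendsto_nhds_unique ((hL 2 0).sub (hL 0 2)) ((hBl 1).congr' ?_)
    filter_upwards [hev] with y hy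
    have := congrArg (fun w : E3 => w 1) (hc y hy.2)
    simp only [curl, spacePartial, hy.1] at this
    simpa using this.symm
  · refine tendsto_nhds_unique ((hL 0 1).sub (hL 1 0)) ((hBl 2).congr' ?_)
    filter_upwards [hev] with y hy
    have := congrArg (fun w : E3 => w 2) (hc y hy.2)
    simp only [curl, spacePartial, hy.1] at this
    simpa using this.symm

/-- The difference of the two sides is the curl of `L` paired with `u × w`, that is `lam b · (u ×
w)`, which vanishes when `b` is in the span of `u` and `w`. -/
lemma inner_clm_sub_inner_clm {L : E3 →L[ℝ] E3} {b u w : E3} {lam s t : ℝ}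
    (h0 : L (EuclideanSpace.single 1 1) 2 - L (EuclideanSpace.single 2 1) 1 = lam * b 0)
    (h1 : L (EuclideanSpace.single 2 1) 0 - L (EuclideanSpace.single 0 1) 2 = lam * b 1)
    (h2 : L (EuclideanSpace.single 0 1) 1 - L (EuclideanSpace.single 1 1) 0 = lam * b 2)
    (hb : b = s • u + t • w) : inner ℝ w (L u) = inner ℝ u (L w) := by
  have hL : ∀ (v : E3) j, L v j = v 0 * L (EuclideanSpace.single 0 1) j +
      v 1 * L (EuclideanSpace.single 1 1) j + v 2 * L (EuclideanSpace.single 2 1) j := fun v j => by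
    have hv : v = v 0 • EuclideanSpace.single 0 1 + v 1 • EuclideanSpace.single 1 1 +
        v 2 • EuclideanSpace.single 2 1 := by
      ext i; fin_cases i <;> simp
    conv_lhs => rw [hv]
    simp
  have hb' : ∀ i, b i = s * u i + t * w i := fun i => by rw [hb]; simp
  rw [hb'] at h0 h1 h2
  simp only [PiLp.inner_apply, Fin.sum_univ_three, hL u, hL w, RCLike.inner_apply, conj_trivial]
  linear_combination (u 1 * w 2 - u 2 * w 1) * h0 + (u 2 * w 0 - u 0 * w 2) * h1 +
    (u 0 * w 1 - u 1 * w 0) * h2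

/-- The exterior derivative of the restricted dual form is the flux of `curl B = lam B` through the
surface, and this is zero because `B` is tangent. In coordinates the second derivatives of `K`
cancel by symmetry. -/
lemma isClosedForm_flat_of_beltrami {Ω : Set E3} {B : E3 → E3} {K : Plane → E3} {ω : Fin 2 → ℝ}
    (hΩ : HasAnalyticBoundary Ω) (hB : IsBeltramiField Ω B)
    (hK : IsAnalyticCoordinates (frontier Ω) K) (hY : ∀ x, B (K x) = fderiv ℝ K x ω) :
    IsClosedForm (flat K fun _ => ω) := by
  intro x
  obtain ⟨hB1, ⟨lam, -, hcurl⟩, -⟩ := hB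
  obtain ⟨hKa, -, -, -, hKr⟩ := hK
  have hmem : ∀ y, K y ∈ closure Ω := fun y =>
    frontier_subset_closure (hKr ▸ Set.mem_range_self y)
  obtain ⟨L, hL, h0, h1, h2⟩ := exists_boundary_derivative (isOpen_of_hasAnalyticBoundary hΩ) hB1
    hcurl (hmem x)
  have hKd : HasFDerivAt K (fderiv ℝ K x) x := (hKa x (Set.mem_univ _)).differentiableAt.hasFDerivAt
  have hBK : HasFDerivAt (fun y => B (K y)) (L.comp (fderiv ℝ K x)) x :=
    hL.comp_hasFDerivAt x hKd (Filter.Eventually.of_forall hmem)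
  have hflat : ∀ i y, flat K (fun _ => ω) y i =
      inner ℝ (fderiv ℝ K y (Pi.single i 1)) (B (K y)) := fun i y => by
    rw [hY, ← dotProduct_metricMatrix, flat, single_one_dotProduct]
  have hK2 : DifferentiableAt ℝ (fderiv ℝ K) x := (hKa.fderiv x (Set.mem_univ _)).differentiableAt
  have hKi : ∀ i : Fin 2, HasFDerivAt (fun y => fderiv ℝ K y (Pi.single i 1))
      ((fderiv ℝ (fderiv ℝ K) x).flip (Pi.single i 1)) x := fun i => by
    simpa using hK2.hasFDerivAt.clm_apply (hasFDerivAt_const (Pi.single i 1 : Plane) x)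
  have hsymm : IsSymmSndFDerivAt ℝ K x :=
    (hKa x (Set.mem_univ _)).contDiffAt.isSymmSndFDerivAt (n := 2) (by simp)
  have hpart : ∀ i j : Fin 2, partials (fun y => flat K (fun _ => ω) y i) x j =
      inner ℝ (fderiv ℝ K x (Pi.single i 1)) (L (fderiv ℝ K x (Pi.single j 1))) +
      inner ℝ (fderiv ℝ (fderiv ℝ K) x (Pi.single j 1) (Pi.single i 1)) (B (K x)) := fun i j => by
    simp only [hflat, partials]
    rw [((hKi i).inner ℝ hBK).fderiv]
    simp
  rw [hpart, hpart, hsymm (Pi.single 0 1)]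
  congr 1
  refine inner_clm_sub_inner_clm (s := ω 0) (t := ω 1) h0 h1 h2 ?_
  rw [hY, fderiv_apply_eq_sum _ ω]

/-! ### Families of perturbed fields -/

lemma isClosedForm_partials {f : Plane → ℝ} (hf : AnalyticOnNhd ℝ f Set.univ) :
    IsClosedForm (partials f) := fun x => by
  have hd : DifferentiableAt ℝ (fderiv ℝ f) x := (hf.fderiv x (Set.mem_univ _)).differentiableAt
  have hsymm : IsSymmSndFDerivAt ℝ f x :=
    (hf x (Set.mem_univ _)).contDiffAt.isSymmSndFDerivAt (n := 2) (by simp)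
  have h : ∀ i j : Fin 2, partials (fun y => partials f y i) x j =
      fderiv ℝ (fderiv ℝ f) x (Pi.single j 1) (Pi.single i 1) := fun i j => by
    simp only [partials]
    rw [fderiv_clm_apply hd (differentiableAt_const _)]
    simp
  rw [h, h, hsymm]

lemma IsClosedForm.add {θ η : Plane → Fin 2 → ℝ} (hθ : IsClosedForm θ) (hη : IsClosedForm η)
    (hθd : ∀ i, Differentiable ℝ fun y => θ y i) (hηd : ∀ i, Differentiable ℝ fun y => η y i) :
    IsClosedForm fun y => θ y + η y := fun x => by
  have h : ∀ i, partials (fun y => (θ y + η y) i) x =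
      partials (fun y => θ y i) x + partials (fun y => η y i) x := fun i =>
    partials_add (hθd i x) (hηd i x)
  rw [h, h, Pi.add_apply, Pi.add_apply, hθ x, hη x]

lemma IsClosedForm.const_smul {θ : Plane → Fin 2 → ℝ} (hθ : IsClosedForm θ)
    (hθd : ∀ i, Differentiable ℝ fun y => θ y i) (t : ℝ) : IsClosedForm fun y => t • θ y :=
  fun x => by
  have h : ∀ i, partials (fun y => (t • θ y) i) x = t • partials (fun y => θ y i) x := fun i =>
    partials_const_mul t (hθd i x)
  rw [h, h, Pi.smul_apply, Pi.smul_apply, hθ x]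

lemma isClosedForm_const (a : Fin 2 → ℝ) : IsClosedForm fun _ => a := fun x => by
  simp [partials]

lemma partials_coord (i : Fin 2) (x : Plane) : partials (fun y => y i) x = Pi.single i 1 := by
  have h : fderiv ℝ (fun y : Plane => y i) x = ContinuousLinearMap.proj i :=
    (ContinuousLinearMap.proj (R := ℝ) (φ := fun _ : Fin 2 => ℝ) i).fderiv
  ext j
  rw [partials, h, ContinuousLinearMap.proj_apply]
  by_cases hij : i = j
  · subst hij; simp
  · simp [hij, Ne.symm hij]

/-- Scaling by `√(1+c)` the field `ω + G⁻¹(∂H + a)` of the family gives exactly the shape required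
in the theorem, with `H` and `a` scaled too. -/
lemma perturbedField_const_mul {K : Plane → E3} (ω : Fin 2 → ℝ) (c : ℝ) {H : Plane → ℝ}
    (hH : Differentiable ℝ H) (a : Fin 2 → ℝ) (x : Plane) :
    perturbedField K ω c (fun x => Real.sqrt (1 + c) * H x) (Real.sqrt (1 + c) • a) x =
      Real.sqrt (1 + c) • (ω + (metricMatrix K x)⁻¹ *ᵥ (partials H x + a)) := by
  have h : ∑ i, (Real.sqrt (1 + c) • a) i • surfGrad K (fun y => y i) x =
      Real.sqrt (1 + c) • ((metricMatrix K x)⁻¹ *ᵥ a) := by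
    simp only [surfGrad, partials_coord]
    ext j
    fin_cases j <;> simp <;> ring
  rw [perturbedField, h, surfGrad, partials_const_mul _ (hH x), Matrix.mulVec_smul, Matrix.mulVec_add,
    smul_add, smul_add, add_assoc]

lemma exists_uniform_RWiener {P : Plane → Matrix (Fin 2) (Fin 2) ℝ} {V : Plane → ℝ}
    (hP : ∀ i j, AnalyticOnNhd ℝ (fun x => P x i j) Set.univ) (hPp : IsPeriodic P)
    (hV : AnalyticOnNhd ℝ V Set.univ) (hVp : IsPeriodic V) :
    ∃ ρ b c, 0 < ρ ∧ MatWiener ρ b (fun _ => P) ∧ RWiener ρ c fun _ => V := by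
  have h : ∀ i j, ∃ ρ M : ℝ, 0 < ρ ∧ RWiener ρ M fun _ x => P x i j := fun i j =>
    exists_RWiener_of_analytic (hP i j) fun x k => by rw [hPp x k]
  choose ρ M hρ hM using h
  obtain ⟨ρ', c, hρ', hc⟩ := exists_RWiener_of_analytic hV hVp
  refine ⟨min (min (min (ρ 0 0) (ρ 0 1)) (min (ρ 1 0) (ρ 1 1))) ρ',
    max (max (M 0 0) (M 0 1)) (max (M 1 0) (M 1 1)), c, ?_, fun i j => ?_,
    hc.mono (min_le_right _ _) le_rfl⟩
  · simp only [lt_min_iff]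
    exact ⟨⟨⟨hρ _ _, hρ _ _⟩, hρ _ _, hρ _ _⟩, hρ'⟩
  · refine (hM i j).mono ?_ ?_ <;> fin_cases i <;> fin_cases j <;> simp

/-- The Lipschitz dependence on the parameter of the families of the theorem. -/
lemma exists_parameter {e : ℝ → ℝ} (he : AnalyticAt ℝ e 0) (he0 : e 0 = 0) (hd : deriv e 0 ≠ 0) :
    ∃ ε > 0, ε ≤ 1 / 2 ∧ ∃ (σ : ℝ → ℝ) (C : ℝ), 0 ≤ C ∧ σ 0 = 0 ∧
      (∀ c, |c| < ε → e (σ c) = c / (1 + c)) ∧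
      ∀ c c', |c| < ε → |c'| < ε →
        ‖((σ c, Real.sqrt (1 + c)) : ℝ × ℝ) - (σ c', Real.sqrt (1 + c'))‖ ≤ C * |c - c'| := by
  obtain ⟨σ, hσ, hσ0, hev⟩ := exists_reparametrization he he0 hd
  have hs : ContDiffAt ℝ 1 (fun c : ℝ => Real.sqrt (1 + c)) 0 :=
    (contDiffAt_const.add contDiffAt_id).sqrt (by simp)
  obtain ⟨C, t, ht, hC⟩ := (hσ.contDiffAt.prodMk hs).exists_lipschitzOnWith
  obtain ⟨ε, hε, hball⟩ := Metric.mem_nhds_iff.1 (Filter.inter_mem hev ht)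
  have hmem : ∀ c, |c| < min ε (1 / 2) → c ∈ Metric.ball (0 : ℝ) ε := fun c hc => by
    rw [mem_ball_zero_iff, Real.norm_eq_abs]
    exact hc.trans_le (min_le_left _ _)
  refine ⟨min ε (1 / 2), lt_min hε (by norm_num), min_le_right _ _, σ, C, C.2, hσ0,
    fun c hc => (hball (hmem c hc)).1, fun c c' hc hc' => ?_⟩
  have := hC.dist_le_mul c (hball (hmem c hc)).2 c' (hball (hmem c' hc')).2
  rwa [dist_eq_norm, dist_eq_norm, Real.norm_eq_abs] at this

/-- The family of fields in the statement of the theorem, before the change of the parameter. -/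
lemma exists_field_family {Ω : Set E3} {B : E3 → E3} {K : Plane → E3} {ω : Fin 2 → ℝ}
    (hΩan : HasAnalyticBoundary Ω) (hB : IsBeltramiField Ω B)
    (hK : IsAnalyticCoordinates (frontier Ω) K) (hY : ∀ x, B (K x) = fderiv ℝ K x ω)
    (hω : IsDiophantine ω) (hnd : IsNondegenerateTypeI K ω) :
    ∃ (β : ℝ) (H : Plane × ℝ → ℝ) (α : ℝ → Fin 2 → ℝ) (e : ℝ → ℝ) (Z : Plane × ℝ → Fin 2 → ℝ),
      AnalyticOnNhd ℝ H Set.univ ∧ AnalyticOnNhd ℝ α Set.univ ∧ AnalyticAt ℝ e 0 ∧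
      AnalyticOnNhd ℝ Z Set.univ ∧ (∀ s, IsPeriodic fun x => H (x, s)) ∧
      (∀ s, IsPeriodic fun x => Z (x, s)) ∧
      (∀ x s, Z (x, s) = ω + (metricMatrix K x)⁻¹ *ᵥ (partials (fun x => H (x, s)) x + α s)) ∧
      (∀ s (t : ℝ), IsClosedForm (flat K fun x => t • Z (x, s))) ∧
      (∀ s x, normSqField K (fun x => Z (x, s)) x =
        (1 + β * Real.sin s) * normSqField K (fun _ => ω) x + e s) ∧
      (∀ s (t : ℝ), IsAnalyticallyConjugateToLinear (fun x => t • Z (x, s)) (t • ω)) ∧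
      (∀ x, H (x, 0) = 0) ∧ α 0 = 0 ∧ e 0 = 0 ∧ deriv e 0 ≠ 0 := by
  obtain ⟨hKa, hKp, -, hKi, -⟩ := id hK
  obtain ⟨N, C, hC, hSD⟩ := hω.exists_smallDivisorBound
  have hGa := analyticOnNhd_metricMatrix hKa
  have hPa := analyticOnNhd_inv_metricMatrix hKa hKi
  have hGper := metricMatrix_periodic hKp
  have hPper : IsPeriodic fun x => (metricMatrix K x)⁻¹ := fun x k => by simp only [hGper x k]
  have hωa : ∀ (x : Plane) (i : Fin 2), AnalyticAt ℝ (fun _ : Plane => ω i) x :=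
    fun _ _ => analyticAt_const
  have hflata : ∀ i, AnalyticOnNhd ℝ (fun x => (metricMatrix K x *ᵥ ω) i) Set.univ := fun i x hx =>
    analyticAt_mulVec (fun i j => hGa i j x hx) (hωa x) i
  have hVa : AnalyticOnNhd ℝ (fun x => ω ⬝ᵥ (metricMatrix K x *ᵥ ω)) Set.univ := fun x hx =>
    analyticAt_dotProduct (hωa x) fun i => hflata i x hx
  have hVper : IsPeriodic fun x => ω ⬝ᵥ (metricMatrix K x *ᵥ ω) := fun x k => by
    simp only [hGper x k]
  obtain ⟨ρ, b, c, hρ, hPW, hVW⟩ := exists_uniform_RWiener hPa hPper hVa hVper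
  have hPc : ∀ i j, Continuous fun x => (metricMatrix K x)⁻¹ i j := fun i j =>
    continuousOn_univ.1 (hPa i j).continuousOn
  have hmean := det_mean_ne_zero hPc fun x z hz => dotProduct_inv_metricMatrix_pos hKi x hz
  have hGP := metricMatrix_mul_inv hKi
  have hPG : ∀ x, (metricMatrix K x)⁻¹ * metricMatrix K x = 1 := fun x => mul_eq_one_comm.1 (hGP x)
  have hsymm : ∀ x, ((metricMatrix K x)⁻¹)ᵀ = (metricMatrix K x)⁻¹ := fun x => by
    rw [Matrix.transpose_nonsing_inv, metricMatrix_transpose]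
  obtain ⟨β, hβ, H, α, e, v, hHa, hαa, hea, hva, hvp, hHp, hdiff, hZ, hN, hv0, hH0, hα0, he0⟩ :=
    exists_invariant_fields hSD hC hsymm hGP hGa hρ hPW hVW
      (Matrix.mul_nonsing_inv _ (isUnit_iff_ne_zero.2 hmean))
  have hω0 : ω ≠ 0 := fun h => by
    have := (hSD (Pi.single 0 1) (by simp)).1
    simp [h] at this
  have hm0 : 0 < torusMean (normSqField K fun _ => ω) :=
    torusMean_pos (continuousOn_univ.1 hVa.continuousOn) fun x => dotProduct_metricMatrix_pos hKi x hω0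
  have hd : deriv e 0 ≠ 0 := by
    obtain ⟨R, hR, hRp, -, hRe, hdet⟩ := hnd
    refine deriv_energy_ne_zero (m := torusMean (normSqField K fun _ => ω)) (R := R)
      (fun k hk => (hSD k hk).1) hsymm hGP hPa rfl hm0 hβ hHa hαa hea hva hvp hHp hZ hN hv0 hH0 hα0
      (hR.of_le (by exact_mod_cast le_top)) hRp (fun x => ?_) hdet
    -- The equation for `R` is stated for the normalized frequency `ω/√m`. It is rewritten for `ω`
    -- itself.
    have h1 := hRe x
    set m := torusMean (normSqField K fun _ => ω)
    have hsm : 0 < Real.sqrt m := Real.sqrt_pos.2 hm0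
    have hn : normalizedFreq K ω = (Real.sqrt m)⁻¹ • ω := rfl
    have h2 : normSqField K (fun _ => normalizedFreq K ω) x =
        m⁻¹ * (ω ⬝ᵥ (metricMatrix K x *ᵥ ω)) := by
      rw [normSqField, flat, hn, Matrix.mulVec_smul, dotProduct_smul, smul_dotProduct, smul_eq_mul,
        smul_eq_mul, ← mul_assoc, ← mul_inv, Real.mul_self_sqrt hm0.le]
    rw [h2, hn, smul_dotProduct, smul_eq_mul, inv_mul_eq_iff_eq_mul₀ hsm.ne'] at h1
    exact h1
  set Z : Plane × ℝ → Fin 2 → ℝ := fun q =>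
    ω + (metricMatrix K q.1)⁻¹ *ᵥ (partials (fun x => H (x, q.2)) q.1 + α q.2) with hZdef
  have hform : ∀ i, AnalyticOnNhd ℝ
      (fun q : Plane × ℝ => (partials (fun x => H (x, q.2)) q.1 + α q.2) i) Set.univ := fun i q hq =>
    (analyticOnNhd_partials hHa i q hq).fun_add
      ((analyticAt_pi_iff.1 (hαa q.2 (Set.mem_univ _)) i).fun_comp analyticAt_snd)
  have hZa : AnalyticOnNhd ℝ Z Set.univ := AnalyticOnNhd.pi fun i q hq =>
    AnalyticAt.fun_add (f := fun _ : Plane × ℝ => ω i) analyticAt_const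
      (analyticAt_mulVec (fun i j => (hPa i j q.1 (Set.mem_univ _)).fun_comp analyticAt_fst)
        (fun i => hform i q hq) i)
  have hflat : ∀ s x, metricMatrix K x *ᵥ Z (x, s) =
      metricMatrix K x *ᵥ ω + (partials (fun x => H (x, s)) x + α s) := fun s x => by
    simp only [hZdef]
    rw [Matrix.mulVec_add, Matrix.mulVec_mulVec, hGP, Matrix.one_mulVec]
  have hHs : ∀ s, AnalyticOnNhd ℝ (fun x => H (x, s)) Set.univ := analyticOnNhd_left hHa
  have hpd : ∀ s i, Differentiable ℝ fun x => partials (fun x => H (x, s)) x i := fun s i x =>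
    (analyticOnNhd_left (analyticOnNhd_partials hHa i) s x (Set.mem_univ _)).differentiableAt
  have hclosed : ∀ s, IsClosedForm (flat K fun x => Z (x, s)) := fun s => by
    have h1 : flat K (fun x => Z (x, s)) =
        fun x => metricMatrix K x *ᵥ ω + (partials (fun x => H (x, s)) x + α s) :=
      funext fun x => hflat s x
    rw [h1]
    refine (isClosedForm_flat_of_beltrami hΩan hB hK hY).add
      ((isClosedForm_partials (hHs s)).add (isClosedForm_const (α s)) (hpd s)
        fun i => differentiable_const _)
      (fun i x => (hflata i x (Set.mem_univ _)).differentiableAt)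
      fun i => (hpd s i).add (differentiable_const _)
  have hflatd : ∀ s i, Differentiable ℝ fun x => flat K (fun x => Z (x, s)) x i := fun s i x =>
    (analyticAt_mulVec (fun i j => hGa i j x (Set.mem_univ _))
      (analyticAt_pi_iff.1 (analyticOnNhd_left hZa s x (Set.mem_univ _))) i).differentiableAt
  refine ⟨β, H, α, e, Z, hHa, hαa, hea 0 (Set.mem_univ _), hZa, hHp, fun s x k => ?_, fun x s => rfl,
    fun s t => ?_, fun s x => hN s x, fun s t => ⟨_, hdiff s, fun θ => ?_⟩, hH0, hα0, he0, hd⟩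
  · simp only [hZdef]
    have h1 : partials (fun x => H (x, s)) (x + latticeVec k) = partials (fun x => H (x, s)) x :=
      funext fun i => periodic_partials (hHp s) i x k
    rw [h1, hGper x k]
  · have h1 : flat K (fun x => t • Z (x, s)) = fun x => t • flat K (fun x => Z (x, s)) x :=
      funext fun x => Matrix.mulVec_smul _ _ _
    rw [h1]
    exact (hclosed s).const_smul (hflatd s) t
  · have hvd : DifferentiableAt ℝ (v s) θ :=
      (analyticOnNhd_left hva s θ (Set.mem_univ _)).differentiableAt
    have h2 : fderiv ℝ (fun θ => θ + v s θ) θ ω = ω + jacobian (v s) θ *ᵥ ω := by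
      rw [fderiv_fun_add differentiableAt_fun_id hvd, ← fderiv_apply_eq_jacobian hvd]
      simp
    rw [map_smul, h2, ← hZ s θ]

end Beltrami

end

/-! ### Scaling and dependence on `c`. -/

theorem theorem5p1 (Ω : Set E3) (B : E3 → E3) (K : Plane → E3) (ω : Fin 2 → ℝ)
    (hΩ : IsToroidalDomain Ω) (hΩan : HasAnalyticBoundary Ω)
    (hB : IsBeltramiField Ω B)
    (hK : IsAnalyticCoordinates (frontier Ω) K)
    (hY : ∀ x, B (K x) = fderiv ℝ K x ω)
    (hω : IsDiophantine ω)
    (hnd : IsNondegenerateTypeI K ω) :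
    ∃ ε > 0, ∃ (H : ℝ → Plane → ℝ) (a : ℝ → Fin 2 → ℝ) (b : ℝ → ℝ)
      (X : ℝ → Plane → Fin 2 → ℝ),
      (∀ c : ℝ, |c| < ε →
        AnalyticOnNhd ℝ (H c) Set.univ ∧ IsPeriodic (H c) ∧
        AnalyticOnNhd ℝ (X c) Set.univ ∧ IsPeriodic (X c) ∧
        (∀ x, X c x = perturbedField K ω c (H c) (a c) x) ∧
        IsClosedForm (flat K (X c)) ∧
        (∀ x, normSqField K (X c) x = (1 + b c) * normSqField K (fun _ => ω) x + c) ∧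
        IsDiophantine (Real.sqrt (1 + c) • ω) ∧
        IsAnalyticallyConjugateToLinear (X c) (Real.sqrt (1 + c) • ω)) ∧
      (∀ r : ℕ, ∃ C : ℝ, ∀ c : ℝ, |c| < ε →
        crNorm r (H c) + ENNReal.ofReal (|b c| + |a c 0| + |a c 1|)
          ≤ ENNReal.ofReal (C * |c|)) ∧
      (∀ r : ℕ, ∀ c₀ : ℝ, |c₀| < ε →
        Filter.Tendsto (fun c => crNorm r (X c - X c₀)) (𝓝 c₀) (𝓝 0)) := by
  obtain ⟨β, H, α, e, Z, hHa, hαa, hea, hZa, hHp, hZp, hZ, hcl, hN, hconj, hH0, hα0, he0, hd⟩ :=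
    exists_field_family hΩan hB hK hY hω hnd
  obtain ⟨ε, hε, hε2, σ, C, hC0, hσ0, hσ, hp⟩ := exists_parameter hea he0 hd
  -- The constant `c` acts only through the torus parameter `σ c` and the scale `√(1+c)`. Objects
  -- smooth in this pair inherit all estimates from the Lipschitz bound on `p`.
  set p : ℝ → ℝ × ℝ := fun c => (σ c, Real.sqrt (1 + c)) with hp_def
  have hε1 : |(0 : ℝ)| < ε := by rwa [abs_zero]
  have hpos : ∀ c : ℝ, |c| < ε → 0 < 1 + c := fun c hc => by
    have := (abs_lt.1 hc).1
    linarith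
  -- the parameters stay in a compact convex set
  set S : Set (ℝ × ℝ) := Metric.closedBall (p 0) C with hS_def
  have hSc : IsCompact S := isCompact_closedBall _ _
  have hSv : Convex ℝ S := convex_closedBall _ _
  have hpS : ∀ c, |c| < ε → p c ∈ S := fun c hc => by
    rw [hS_def, Metric.mem_closedBall, dist_eq_norm]
    refine (hp c 0 hc hε1).trans (mul_le_of_le_one_right hC0 ?_)
    rw [sub_zero]
    linarith
  set UH : Plane × (ℝ × ℝ) → ℝ := fun q => q.2.2 * H (q.1, q.2.1) with hUH
  set UZ : Plane × (ℝ × ℝ) → Fin 2 → ℝ := fun q => q.2.2 • Z (q.1, q.2.1) with hUZ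
  have hHc : ContDiff ℝ (⊤ : ℕ∞) H := hHa.contDiff
  have hZc : ContDiff ℝ (⊤ : ℕ∞) Z := hZa.contDiff
  have hαc : ContDiff ℝ 1 α := hαa.contDiff
  have hproj : ContDiff ℝ (⊤ : ℕ∞) fun q : Plane × (ℝ × ℝ) => (q.1, q.2.1) :=
    contDiff_fst.prodMk (contDiff_fst.comp contDiff_snd)
  have hUHc : ContDiff ℝ (⊤ : ℕ∞) UH :=
    (contDiff_snd.comp contDiff_snd).mul (hHc.comp hproj)
  have hUZc : ContDiff ℝ (⊤ : ℕ∞) UZ :=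
    (contDiff_snd.comp contDiff_snd).smul (hZc.comp hproj)
  have hUac : ContDiff ℝ 1 fun q : ℝ × ℝ => q.2 • α q.1 :=
    contDiff_snd.smul (hαc.comp contDiff_fst)
  have hUbc : ContDiff ℝ 1 fun q : ℝ × ℝ => q.2 ^ 2 * (1 + β * Real.sin q.1) - 1 :=
    ((contDiff_snd.pow 2).mul (contDiff_const.add (contDiff_const.mul
      (Real.contDiff_sin.comp contDiff_fst)))).sub contDiff_const
  obtain ⟨Ca, hCa0, hCa⟩ := ContDiff.exists_lipschitz_bound hUac hSc hSv
  obtain ⟨Cb, hCb0, hCb⟩ := ContDiff.exists_lipschitz_bound hUbc hSc hSv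
  have hp0 : p 0 = (0, 1) := by simp [hp_def, hσ0]
  refine ⟨ε, hε, fun c x => UH (x, p c), fun c => (p c).2 • α (p c).1,
    fun c => (p c).2 ^ 2 * (1 + β * Real.sin (p c).1) - 1, fun c x => UZ (x, p c), ?_, ?_, ?_⟩
  · intro c hc
    have hHs : AnalyticOnNhd ℝ (fun x => H (x, σ c)) Set.univ := analyticOnNhd_left hHa _
    have h1c := hpos c hc
    have hsq : Real.sqrt (1 + c) ^ 2 = 1 + c := Real.sq_sqrt h1c.le
    refine ⟨fun x hx => analyticAt_const.fun_mul (hHs x hx), fun x k => ?_,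
      fun x hx => analyticAt_const.fun_smul (analyticOnNhd_left hZa (σ c) x hx), fun x k => ?_,
      fun x => ?_, hcl _ _, fun x => ?_, hω.smul (Real.sqrt_pos.2 h1c), hconj _ _⟩
    · exact congrArg ((p c).2 * ·) (hHp (p c).1 x k)
    · exact congrArg ((p c).2 • ·) (hZp (p c).1 x k)
    · refine Eq.trans ?_ (perturbedField_const_mul ω c
        (fun x => (hHs x (Set.mem_univ _)).differentiableAt) (α (σ c)) x).symm
      simp only [hUZ, hZ, hp_def]
    · have h1 : normSqField K (fun x => UZ (x, p c)) x =
          Real.sqrt (1 + c) ^ 2 * normSqField K (fun x => Z (x, σ c)) x := by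
        simp only [hUZ, hp_def, normSqField, flat, Matrix.mulVec_smul, dotProduct_smul,
          smul_dotProduct, smul_eq_mul]
        ring
      -- Multiplied by `1 + c`, the energy `e(σ c) = c/(1+c)` becomes `c`, and the coefficient of
      -- `|Y|²` becomes `(1+c)(1 + β sin σ(c)) = 1 + b`.
      rw [h1, hN, hσ c hc]
      simp only [hp_def, hsq]
      field_simp
      ring
  · intro r
    obtain ⟨Cr, hCr0, hCr⟩ := exists_crNorm_sub_le hUHc
      (fun q x k => congrArg (q.2 * ·) (hHp q.1 x k)) hSc hSv r
    refine ⟨Cr * C + (Cb * C + Ca * C + Ca * C), fun c hc => ?_⟩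
    have hpc : ‖p c - p 0‖ ≤ C * |c| := by
      have := hp c 0 hc hε1
      rwa [sub_zero] at this
    have h1 := hCr (p c) (hpS c hc) (p 0) (hpS 0 hε1)
    -- At `c = 0` the family is trivial, so the Lipschitz bound against `p 0` is already the linear
    -- bound in `|c|`.
    have h2 : ((fun x => UH (x, p c)) - fun x => UH (x, p 0)) = fun x => UH (x, p c) :=
      funext fun x => by simp [hUH, hp0, hH0]
    rw [h2] at h1
    have ha : ∀ i, |((p c).2 • α (p c).1) i| ≤ Ca * C * |c| := fun i => by
      have h3 := hCa (p c) (hpS c hc) (p 0) (hpS 0 hε1)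
      rw [hp0, hα0, smul_zero, sub_zero, ← hp0] at h3
      calc |((p c).2 • α (p c).1) i| ≤ ‖(p c).2 • α (p c).1‖ := norm_le_pi_norm ((p c).2 • α (p c).1) i
        _ ≤ Ca * ‖p c - p 0‖ := h3
        _ ≤ Ca * (C * |c|) := by gcongr
        _ = _ := by ring
    have hb : |(p c).2 ^ 2 * (1 + β * Real.sin (p c).1) - 1| ≤ Cb * C * |c| := by
      have h3 := hCb (p c) (hpS c hc) (p 0) (hpS 0 hε1)
      have h4 : (p 0).2 ^ 2 * (1 + β * Real.sin (p 0).1) - 1 = 0 := by simp [hp0]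
      rw [h4, sub_zero, Real.norm_eq_abs] at h3
      calc _ ≤ Cb * ‖p c - p 0‖ := h3
        _ ≤ Cb * (C * |c|) := by gcongr
        _ = _ := by ring
    calc _ ≤ ENNReal.ofReal (Cr * C * |c|) +
          ENNReal.ofReal (Cb * C * |c| + Ca * C * |c| + Ca * C * |c|) := by
          gcongr
          · refine h1.trans (ENNReal.ofReal_le_ofReal ?_)
            rw [mul_assoc]
            gcongr
          · exact ha 0
          · exact ha 1
      _ = _ := by
          rw [← ENNReal.ofReal_add (by positivity) (by positivity)]
          congr 1
          ring
  · intro r c₀ hc₀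
    obtain ⟨Cr, hCr0, hCr⟩ := exists_crNorm_sub_le hUZc
      (fun q x k => congrArg (q.2 • ·) (hZp q.1 x k)) hSc hSv r
    have hlim : Filter.Tendsto (fun c => ENNReal.ofReal (Cr * (C * |c - c₀|))) (𝓝 c₀) (𝓝 0) := by
      have h1 : Continuous fun c => ENNReal.ofReal (Cr * (C * |c - c₀|)) :=
        ENNReal.continuous_ofReal.comp (by fun_prop)
      simpa using h1.tendsto c₀
    refine tendsto_of_tendsto_of_tendsto_of_le_of_le' tendsto_const_nhds hlim
      (Filter.Eventually.of_forall fun _ => zero_le) ?_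
    have hev : ∀ᶠ c in 𝓝 c₀, |c| < ε := (continuous_abs.tendsto c₀).eventually_lt_const hc₀
    filter_upwards [hev] with c hc
    refine (hCr (p c) (hpS c hc) (p c₀) (hpS c₀ hc₀)).trans (ENNReal.ofReal_le_ofReal ?_)
    gcongr
    exact hp c c₀ hc hc₀
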